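/- Let $M$ be a connected paracompact Hausdorff smooth $n$-manifold, $\pi:T^*M\to M$ its cotangent bundle, $\mathbf s(\ell)=\ell\circ\pi_*$ the Liouville form and $\boldsymbol\sigma=d\mathbf s=\sum_i dp_i\wedge dq_i$. Let $U\subseteq M$ be open and contractible, $\alpha$ a real function, smooth on $U$, and $\Lambda=\{d\alpha(q): q\in U\}\subset T^*M$ (a manifold, diffeomorphic to $U$ by $\pi$). Let $J\subseteq\mathbb R$ be an open interval with $0\in J$, let $\mathcal O\subseteq T^*M$ be open with $\Lambda\subseteq\mathcal O$, and let $H:J\times\mathcal O\to\mathbb R$, $H_t=H(t,\cdot)$. Where $H_t$ is differentiable, its Hamiltonian vector $\vec H_t(\ell)$ is defined by $\langle dH_t(\ell),\cdot\rangle=\boldsymbol\sigma_\ell(\cdot,\vec H_t(\ell))$. Assume: 1. There is a locally Lipschitz map $\mathcal H:J\times\Lambda\to\mathcal O$, $(t,\ell)\mapsto\mathcal H_t(\ell)$ (the Hamiltonian flow), such that for a.e. $t\in J$ the function $H_t$ is differentiable at all points of $\mathcal H_t(\Lambda)$, and for each $\ell\in\Lambda$, $\mathcal H_0(\ell)=\ell$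 and $\frac{d}{dt}\mathcal H_t(\ell)=\vec H_t(\mathcal H_t(\ell))$ for a.e. $t\in J$. 2. The function $G(t,\ell)=\langle \mathcal H_t(\ell),\pi_*\vec H_t(\mathcal H_t(\ell))\rangle-H_t(\mathcal H_t(\ell))$ is Lipschitz--Carathéodory on $J\times\Lambda$: $G(t,\cdot)$ is locally Lipschitz for a.e. $t$; $G(\cdot,\ell)$ is measurable and (essentially) bounded on $J$ for every $\ell$; and each point of $\Lambda$ has a neighbourhood on which, for a.e. $t\in J$, $G(t,\cdot)$ is Lipschitz with a constant independent of $t$. (Lipschitz properties on manifolds are understood locally, in charts, or equivalently for any Riemannian distances.) Put $$\theta(t,\ell)=\alpha(\pi\ell)+\int_0^t G(s,\ell)\,ds ,\qquad \theta_t=\theta(t,\cdot),$$ and let $\mathcal H^*(\mathbf s-H\,dt)$ be the pullback of the Cartan form $\mathbf s-H\,dt$ on $J\times\mathcal O$ by $(t,\ell)\mapsto(t,\mathcal H_t(\ell))$. Then $\theta$ is locally Lipschitz on $J\times\Lambda$ and: (a) for every $t\in J$, at a.e. $\ell\in\Lambda$ the maps $\mathcal H_t$ and $\theta_t$ are differentiable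 and $\mathcal H_t^*\mathbf s=d\theta_t$; (b) the form $\mathcal H^*(\mathbf s-H\,dt)$ is exact on $J\times\Lambda$ with primitive $\theta$: at a.e. $(t,\ell)\in J\times\Lambda$ the maps $\mathcal H$ and $\theta$ are differentiable and $\mathcal H^*(\mathbf s-H\,dt)=d\theta$; moreover, for every Lipschitz curve $\mu:[0,1]\to J\times\Lambda$, writing $\hat\mu$ for its image under $(t,\ell)\mapsto(t,\mathcal H_t(\ell))$, the function $s\mapsto(\mathbf s-H\,dt)(\dot{\hat\mu}(s))$ is integrable on $[0,1]$ and its integral is $\theta(\mu(1))-\theta(\mu(0))$. -/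

import Mathlib

open Set MeasureTheory Manifold Topology
open scoped ContDiff NNReal

noncomputable section

namespace CartanForm

/-! ### Lipschitz maps and null sets on manifolds -/

section General

variable {E : Type*} [NormedAddCommGroup E] [NormedSpace ℝ E] {A : Type*} [TopologicalSpace A]
  {E' : Type*} [NormedAddCommGroup E'] [NormedSpace ℝ E'] {A' : Type*} [TopologicalSpace A']
  {X : Type*} [TopologicalSpace X] [ChartedSpace A X]
  {Y : Type*} [TopologicalSpace Y] [ChartedSpace A' Y]

/-- `f` is (locally) Lipschitz on `S`: near each point of `S` it is Lipschitz when read in the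
charts of source and target. This is the local Lipschitz property for the distances of any
Riemannian metrics on the two manifolds, and does not depend on their choice. -/
def LipschitzOnManifold (I : ModelWithCorners ℝ E A) (I' : ModelWithCorners ℝ E' A')
    (f : X → Y) (S : Set X) : Prop :=
  ∀ x ∈ S, ∃ C : ℝ≥0, ∃ V ∈ 𝓝[S] x,
    V ⊆ (extChartAt I x).source ∧ MapsTo f V (extChartAt I' (f x)).source ∧
    ∀ y ∈ V, ∀ z ∈ V,
      dist (extChartAt I' (f x) (f y)) (extChartAt I' (f x) (f z)) ≤
        C * dist (extChartAt I x y) (extChartAt I x z)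

/-- `P` holds at almost every point of the subset `S` of a manifold: the exceptional set has
Lebesgue measure zero in every chart. -/
def AlmostEverywhereOn [MeasureSpace E] (I : ModelWithCorners ℝ E A) (S : Set X)
    (P : X → Prop) : Prop :=
  ∀ x₀ : X, volume (extChartAt I x₀ '' ({x ∈ S | ¬ P x} ∩ (extChartAt I x₀).source)) = 0

/-- Lipschitz--Carathéodory functions `G : J × U → ℝ`, for `U` an open subset of a manifold:
`G t` is locally Lipschitz for almost every `t`; every `G · x` is bounded and measurable on `J`
(up to null sets); and, near each point of `U`, the Lipschitz constant of `G t` is bounded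
uniformly in almost every `t`. -/
structure LipschitzCaratheodory (I : ModelWithCorners ℝ E A) (J : Set ℝ) (U : Set X)
    (G : ℝ → X → ℝ) : Prop where
  lipschitz : ∀ᵐ t ∂(volume.restrict J), LipschitzOnManifold I 𝓘(ℝ, ℝ) (G t) U
  bounded_measurable : ∀ x ∈ U, AEMeasurable (fun t => G t x) (volume.restrict J) ∧
    ∃ C : ℝ, ∀ᵐ t ∂(volume.restrict J), |G t x| ≤ C
  uniform : ∀ x ∈ U, ∃ C : ℝ≥0, ∃ V ∈ 𝓝 x, V ⊆ (extChartAt I x).source ∧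
    ∀ᵐ t ∂(volume.restrict J), ∀ y ∈ V, ∀ z ∈ V,
      |G t y - G t z| ≤ C * dist (extChartAt I x y) (extChartAt I x z)

/-- The pullback `f^* β` of a differential 1-form along a map `f`, at points where `f` is
differentiable. -/
def pullbackForm (I : ModelWithCorners ℝ E A) (I' : ModelWithCorners ℝ E' A')
    (f : X → Y) (β : (y : Y) → (TangentSpace I' y →L[ℝ] ℝ)) (x : X) : TangentSpace I x →L[ℝ] ℝ :=
  (β (f x)).comp (mfderiv I I' f x)

end General

/-! ### The cotangent bundle -/

/-- The model vector space of an `n`-manifold. -/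
abbrev Model (n : ℕ) : Type := EuclideanSpace ℝ (Fin n)

section Cotangent

variable {n : ℕ} {M : Type*} [TopologicalSpace M] [ChartedSpace (Model n) M]
  [IsManifold (𝓡 n) ∞ M]

variable (n M) in
/-- The cotangent bundle `T^*M`. It is a manifold modelled on `ℝⁿ × (ℝⁿ)^*`; its preferred chart
at a point over `x` is the natural chart `(q, p)` induced by the preferred chart of `M` at `x`. -/
abbrev CotangentBundle : Type _ :=
  Bundle.TotalSpace (Model n →L[ℝ] ℝ) (fun x : M => TangentSpace (𝓡 n) x →L[ℝ] ℝ)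

variable (n) in
/-- The model with corners (no corners) of `T^*M`. -/
abbrev cotModel : ModelWithCorners ℝ (Model n × (Model n →L[ℝ] ℝ))
    (ModelProd (Model n) (Model n →L[ℝ] ℝ)) :=
  (𝓡 n).prod 𝓘(ℝ, Model n →L[ℝ] ℝ)

/-- The Liouville form `s(ℓ) = ℓ ∘ π_*` on `T^*M`. -/
def liouvilleForm (ℓ : CotangentBundle n M) : TangentSpace (cotModel n) ℓ →L[ℝ] ℝ :=
  ContinuousLinearMap.comp (ℓ.2 : TangentSpace (𝓡 n) ℓ.proj →L[ℝ] ℝ)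
    (mfderiv (cotModel n) (𝓡 n) (fun z : CotangentBundle n M => z.proj) ℓ)

/-- The canonical symplectic form `σ = ds = ∑ dpᵢ ∧ dqᵢ`. A tangent vector of `T^*M` at `ℓ` is
given by its coordinates `(δq, δp)` in the natural chart at `ℓ`. -/
def symplecticForm (ℓ : CotangentBundle n M) (v w : TangentSpace (cotModel n) ℓ) : ℝ :=
  let v' : Model n × (Model n →L[ℝ] ℝ) := v
  let w' : Model n × (Model n →L[ℝ] ℝ) := w
  v'.2 w'.1 - w'.2 v'.1

/-- The differential of a function on `T^*M` at `ℓ`, in the natural chart at `ℓ`. -/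
def cotDifferential (h : CotangentBundle n M → ℝ) (ℓ : CotangentBundle n M) :
    (Model n × (Model n →L[ℝ] ℝ)) →L[ℝ] ℝ :=
  mfderiv (cotModel n) 𝓘(ℝ, ℝ) h ℓ

/-- The Hamiltonian vector field of `h`, in natural coordinates `(∂h/∂p, -∂h/∂q)`. It is
characterised by `⟨dh(ℓ), ·⟩ = σ_ℓ(·, X)`, see `symplecticForm_hamiltonianVectorField` and
`eq_hamiltonianVectorField`. -/
def hamiltonianVectorField (h : CotangentBundle n M → ℝ) (ℓ : CotangentBundle n M) :
    TangentSpace (cotModel n) ℓ :=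
  ((∑ i : Fin n, cotDifferential h ℓ (0, EuclideanSpace.proj i) • EuclideanSpace.single i (1 : ℝ),
    -((cotDifferential h ℓ).comp (ContinuousLinearMap.inl ℝ (Model n) (Model n →L[ℝ] ℝ)))) :
    Model n × (Model n →L[ℝ] ℝ))

theorem dual_eq_sum (p : Model n →L[ℝ] ℝ) :
    p = ∑ i : Fin n, p (EuclideanSpace.single i (1 : ℝ)) •
      (EuclideanSpace.proj i : Model n →L[ℝ] ℝ) := by
  apply ContinuousLinearMap.coe_injective
  refine (EuclideanSpace.basisFun (Fin n) ℝ).toBasis.ext fun j => ?_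
  simp [EuclideanSpace.basisFun_apply]

theorem symplecticForm_hamiltonianVectorField (h : CotangentBundle n M → ℝ)
    (ℓ : CotangentBundle n M) (v : TangentSpace (cotModel n) ℓ) :
    mfderiv (cotModel n) 𝓘(ℝ, ℝ) h ℓ v = symplecticForm ℓ v (hamiltonianVectorField h ℓ) := by
  change cotDifferential h ℓ v = _
  obtain ⟨a, b⟩ := (v : Model n × (Model n →L[ℝ] ℝ))
  have hab : ((a, b) : Model n × (Model n →L[ℝ] ℝ)) = (a, 0) + (0, b) := by simp
  have hb : cotDifferential h ℓ (0, b) = ∑ i : Fin n, b (EuclideanSpace.single i (1 : ℝ)) *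
      cotDifferential h ℓ (0, EuclideanSpace.proj i) := by
    change ((cotDifferential h ℓ).comp (ContinuousLinearMap.inr ℝ (Model n) (Model n →L[ℝ] ℝ))) b
      = _
    conv_lhs => rw [dual_eq_sum b]
    simp
  rw [hab, map_add, hb]
  simp [symplecticForm, hamiltonianVectorField, mul_comm, add_comm]

theorem eq_hamiltonianVectorField (h : CotangentBundle n M → ℝ)
    (ℓ : CotangentBundle n M) (w : TangentSpace (cotModel n) ℓ)
    (hw : ∀ v, mfderiv (cotModel n) 𝓘(ℝ, ℝ) h ℓ v = symplecticForm ℓ v w) :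
    w = hamiltonianVectorField h ℓ := by
  have key : ∀ v, symplecticForm ℓ v w = symplecticForm ℓ v (hamiltonianVectorField h ℓ) :=
    fun v => by rw [← hw, symplecticForm_hamiltonianVectorField]
  generalize hamiltonianVectorField h ℓ = w' at key
  change (w : Model n × (Model n →L[ℝ] ℝ)) = w'
  refine Prod.ext ?_ ?_
  · ext i
    have := key ((0, EuclideanSpace.proj i) : Model n × (Model n →L[ℝ] ℝ))
    simpa [symplecticForm] using this
  · ext a
    have := key ((a, 0) : Model n × (Model n →L[ℝ] ℝ))
    simpa [symplecticForm] using this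

/-- The Cartan form `s - H dt` on `ℝ × T^*M`. -/
def cartanForm (H : ℝ → CotangentBundle n M → ℝ) (z : ℝ × CotangentBundle n M) :
    TangentSpace (𝓘(ℝ, ℝ).prod (cotModel n)) z →L[ℝ] ℝ :=
  ContinuousLinearMap.comp (liouvilleForm z.2 : (Model n × (Model n →L[ℝ] ℝ)) →L[ℝ] ℝ)
      (ContinuousLinearMap.snd ℝ ℝ (Model n × (Model n →L[ℝ] ℝ))) -
    H z.1 z.2 • ContinuousLinearMap.fst ℝ ℝ (Model n × (Model n →L[ℝ] ℝ))

/-- `⟨ℓ, π_* H⃗_t(ℓ)⟩ - H_t(ℓ)`. -/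
def actionDensity (H : ℝ → CotangentBundle n M → ℝ) (t : ℝ) (ℓ : CotangentBundle n M) : ℝ :=
  liouvilleForm ℓ (hamiltonianVectorField (H t) ℓ) - H t ℓ

/-! ### The horizontal Lagrangian manifold and the flow emanating from it -/

/-- The section `q ↦ dα(q)` of the cotangent bundle. -/
def dSection (α : M → ℝ) (q : M) : CotangentBundle n M :=
  ⟨q, (mfderiv (𝓡 n) 𝓘(ℝ, ℝ) α q : Model n →L[ℝ] ℝ)⟩

/-- `Λ`, the graph of `dα` over `U`. Its manifold structure is the one for which
`q ↦ dα(q)` is a diffeomorphism from `U` onto `Λ`; maps on `Λ` (and on `J × Λ`) are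
differentiated, and null sets are measured, through this parametrization. -/
def graphOfDifferential (α : M → ℝ) (U : Set M) : Set (CotangentBundle n M) :=
  dSection (n := n) α '' U

/-- The function `θ(t, ℓ) = α(π ℓ) + ∫₀ᵗ (⟨𝓗_s ℓ, π_* H⃗_s(𝓗_s ℓ)⟩ - H_s(𝓗_s ℓ)) ds`. -/
def theta (α : M → ℝ) (H : ℝ → CotangentBundle n M → ℝ)
    (Φ : ℝ → CotangentBundle n M → CotangentBundle n M) (t : ℝ) (ℓ : CotangentBundle n M) : ℝ :=
  α ℓ.proj + ∫ s in (0 : ℝ)..t, actionDensity H s (Φ s ℓ)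

/-- The map `(t, ℓ) ↦ (t, 𝓗_t ℓ)` on `J × Λ`, with `Λ` parametrized by `ℓ = dα(q)`. -/
def flowGraph (α : M → ℝ) (Φ : ℝ → CotangentBundle n M → CotangentBundle n M) (z : ℝ × M) :
    ℝ × CotangentBundle n M :=
  (z.1, Φ z.1 (dSection α z.2))

/-- The map `𝓗_t` on `Λ`, with `Λ` parametrized by `ℓ = dα(q)`. -/
def flowAt (α : M → ℝ) (Φ : ℝ → CotangentBundle n M → CotangentBundle n M) (t : ℝ) (q : M) :
    CotangentBundle n M :=
  Φ t (dSection α q)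

/-- The function `θ` on `J × Λ`, with `Λ` parametrized by `ℓ = dα(q)`. -/
def thetaGraph (α : M → ℝ) (H : ℝ → CotangentBundle n M → ℝ)
    (Φ : ℝ → CotangentBundle n M → CotangentBundle n M) (z : ℝ × M) : ℝ :=
  theta α H Φ z.1 (dSection α z.2)

/-- The regularity assumptions on the Hamiltonian `H : J × O → ℝ`: its flow `Φ` (written `𝓗` in
the comments) is well defined and Lipschitz on `J × Λ`, and
`(t, ℓ) ↦ ⟨𝓗_t ℓ, π_* H⃗_t(𝓗_t ℓ)⟩ - H_t(𝓗_t ℓ)` is Lipschitz--Carathéodory on `J × Λ`. -/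
structure HamiltonianFlowAssumption (J : Set ℝ) (α : M → ℝ) (U : Set M)
    (O : Set (CotangentBundle n M)) (H : ℝ → CotangentBundle n M → ℝ)
    (Φ : ℝ → CotangentBundle n M → CotangentBundle n M) : Prop where
  /-- The trajectories stay in the domain of the Hamiltonian. -/
  mem : ∀ t ∈ J, ∀ ℓ ∈ graphOfDifferential (n := n) α U, Φ t ℓ ∈ O
  initial : ∀ ℓ ∈ graphOfDifferential (n := n) α U, Φ 0 ℓ = ℓ
  /-- The vector field `H⃗_t` exists at the points of `𝓗_t(Λ)`. -/
  differentiable : ∀ᵐ t ∂(volume.restrict J), ∀ ℓ ∈ graphOfDifferential (n := n) α U,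
    MDifferentiableAt (cotModel n) 𝓘(ℝ, ℝ) (H t) (Φ t ℓ)
  /-- The Hamiltonian system, for almost every time. -/
  ode : ∀ ℓ ∈ graphOfDifferential (n := n) α U, ∀ᵐ t ∂(volume.restrict J),
    HasMFDerivAt 𝓘(ℝ, ℝ) (cotModel n) (fun s => Φ s ℓ) t
      ((1 : ℝ →L[ℝ] ℝ).smulRight (hamiltonianVectorField (H t) (Φ t ℓ)))
  lipschitz : LipschitzOnManifold (𝓘(ℝ, ℝ).prod (𝓡 n)) (cotModel n)
    (fun z : ℝ × M => flowAt α Φ z.1 z.2) (J ×ˢ U)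
  lipschitzCaratheodory : LipschitzCaratheodory (𝓡 n) J U
    (fun t q => actionDensity H t (flowAt α Φ t q))

end Cotangent

end CartanForm

end

open Filter

/-! ### Lipschitz functions of a real variable -/

/-! For smooth data this is the first variation formula: the Lie derivative of `s` along the
Hamiltonian field is the differential of the action density, so `𝓗_t^* s - dθ_t` does not depend on
`t`, and it vanishes at `t = 0` because `s` restricted to `Λ` is `d(α ∘ π)`. Here `H_t` is only
differentiable at the points of the flow, and the velocity of a trajectory exists outside a null set
of times that depends on the trajectory. The system therefore cannot be differentiated in the
initial data.

The substitute is a comparison of two trajectories in natural coordinates `z = (x, p)`, with initial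
data `s` and `s'` on a curve. By Hamilton's equations the difference quotient of the action equals
the boundary terms `p(s) (x(s') - x(s)) / (s' - s)`, plus the integral of the quotient of `p`
against the time derivative of `x(s') - x(s)`, plus the integrated Taylor remainder of `H` divided
by `s' - s`. The first integral vanishes in the limit because the derivatives of functions
converging uniformly to zero converge weakly to zero (`tendsto_integral_clm_deriv_zero`). The second
vanishes by dominated convergence; the domination is a Lipschitz bound on the energy
(`energy_lipschitz_curve`), which comes from `‖dH‖ ≤ 2‖X‖`, `X` being the velocity, and from Fubini.
Hence the property that `dθ_t = p dx` almost everywhere along segments is carried by the flow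
(`primitiveAlongSegments`), and connectedness of `J` propagates it from time zero
(`exists_flowBox_primitive`). Since `p` is Lipschitz, it improves to a quadratic Taylor estimate at
every point and every time (`PrimitiveAlongSegments.abs_sub_le`). With Rademacher's theorem this
gives (a).

In the time direction `G + H = p ẋ`. The energy is Lipschitz in the initial data, so almost every
time is a Lebesgue point of the energy for all initial data at once. Outside a null set of times,
`dθ = p dx - H dt` then holds in the frozen form of `hasFDerivAt_action`, which gives (b) almost
everywhere. A curve may spend positive measure at exceptional times, but there its time component
has zero derivative almost everywhere, and the weaker estimate `abs_action_sub_le`, valid at all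
times, is enough. -/

/-- The radius on which the bound holds varies with the point. Splitting `A` by that radius, and
each piece into cells no longer than the radius, yields sets on which `f` is Lipschitz with constant
`K`, where Hausdorff measure scales as required. `A` need not be measurable. -/
theorem volume_image_le_of_eventually_le {f : ℝ → ℝ} {S A : Set ℝ} (hA : A ⊆ S) (K : ℝ≥0)
    (h : ∀ s ∈ A, ∀ᶠ s' in 𝓝[S] s, |f s' - f s| ≤ K * |s' - s|) :
    volume (f '' A) ≤ K * volume A := by
  set B : ℕ → Set ℝ := fun k =>
    {s ∈ A | ∀ s' ∈ S, |s' - s| < 1 / (k + 1 : ℝ) → |f s' - f s| ≤ K * |s' - s|} with hB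
  have hBmono : Monotone B := fun k l hkl s hs => ⟨hs.1, fun s' hs' hd =>
    hs.2 s' hs' (hd.trans_le (one_div_le_one_div_of_le (by positivity) (by gcongr)))⟩
  have hBU : A = ⋃ k, B k := by
    refine Subset.antisymm (fun s hs => ?_) (iUnion_subset fun k => fun s hs => hs.1)
    obtain ⟨ε, hε, hsub⟩ := Metric.mem_nhdsWithin_iff.1 (h s hs)
    obtain ⟨k, hk⟩ := exists_nat_one_div_lt hε
    refine mem_iUnion.2 ⟨k, hs, fun s' hs' hd => hsub ⟨?_, hs'⟩⟩
    rw [Metric.mem_ball, Real.dist_eq]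
    exact hd.trans hk
  have key : ∀ k, volume (f '' B k) ≤ K * volume (B k) := by
    intro k
    set δ : ℝ := 1 / (k + 1 : ℝ) with hδ
    have hδ0 : 0 < δ := by positivity
    set P : ℤ → Set ℝ := fun j => Ico (j • δ) ((j + 1) • δ) with hP
    have hPU : ⋃ j, P j = univ := iUnion_Ico_zsmul hδ0
    have hpart : f '' B k = ⋃ j, f '' (B k ∩ P j) := by
      rw [← image_iUnion, ← inter_iUnion, hPU, inter_univ]
    have hlip : ∀ j, volume (f '' (B k ∩ P j)) ≤ K * volume (B k ∩ P j) := by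
      intro j
      have hL : LipschitzOnWith K f (B k ∩ P j) := by
        refine LipschitzOnWith.of_dist_le_mul fun x hx y hy => ?_
        rw [Real.dist_eq, Real.dist_eq]
        refine hy.1.2 x (hA hx.1.1) ?_
        have h1 := hx.2
        have h2 := hy.2
        simp only [hP, mem_Ico, add_smul, one_smul] at h1 h2
        rw [abs_lt]
        constructor <;> linarith [h1.1, h1.2, h2.1, h2.2]
      have := hL.hausdorffMeasure_image_le (d := 1) zero_le_one
      rwa [hausdorffMeasure_real, ENNReal.rpow_one] at this
    calc volume (f '' B k) ≤ ∑' j, volume (f '' (B k ∩ P j)) := by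
          rw [hpart]; exact measure_iUnion_le _
      _ ≤ ∑' j, K * volume (B k ∩ P j) := ENNReal.tsum_le_tsum hlip
      -- `B k` may fail to be measurable, but the cells are measurable, so the restricted measure is
      -- still additive over them.
      _ = K * ∑' j, (volume.restrict (B k)) (P j) := by
          rw [ENNReal.tsum_mul_left]
          congr 2
          ext j
          rw [Measure.restrict_apply measurableSet_Ico, inter_comm]
      _ = K * volume (B k) := by
          rw [← measure_iUnion (pairwise_disjoint_Ico_zsmul δ) fun j => measurableSet_Ico, hPU,
            Measure.restrict_apply_univ]
  calc volume (f '' A) = volume (⋃ k, f '' B k) := by rw [← image_iUnion, ← hBU]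
    _ = ⨆ k, volume (f '' B k) := by
        refine Monotone.measure_iUnion fun k l hkl => image_mono (hBmono hkl)
    _ ≤ K * volume A := iSup_le fun k => (key k).trans (by
        gcongr
        exact fun s hs => hs.1)

/-- A function which is pointwise Lipschitz everywhere, with constant `C` almost everywhere,
has increments at most `C` times the length of the interval. -/
theorem abs_sub_le_of_ae_eventually_le {f : ℝ → ℝ} {a b : ℝ} (hab : a ≤ b) (C : ℝ≥0)
    (hfin : ∀ s ∈ Icc a b, ∃ K : ℝ, ∀ᶠ s' in 𝓝[Icc a b] s, |f s' - f s| ≤ K * |s' - s|)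
    (hae : ∀ᵐ s, s ∈ Icc a b → ∀ᶠ s' in 𝓝[Icc a b] s, |f s' - f s| ≤ C * |s' - s|) :
    |f b - f a| ≤ C * (b - a) := by
  have hcont : ContinuousOn f (Icc a b) := by
    intro s hs
    obtain ⟨K, hK⟩ := hfin s hs
    have h2 : Tendsto (fun s' : ℝ => K * |s' - s|) (𝓝[Icc a b] s) (𝓝 0) := by
      have : Continuous fun s' : ℝ => K * |s' - s| := by fun_prop
      simpa [ContinuousWithinAt] using this.continuousWithinAt (s := Icc a b) (x := s)
    refine tendsto_iff_dist_tendsto_zero.2 (squeeze_zero' (Eventually.of_forall fun _ =>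
      dist_nonneg) (hK.mono fun s' h => ?_) h2)
    rwa [Real.dist_eq]
  set Good : Set ℝ := {s ∈ Icc a b | ∀ᶠ s' in 𝓝[Icc a b] s, |f s' - f s| ≤ C * |s' - s|}
  set N : Set ℝ := Icc a b \ Good
  set M : ℕ → Set ℝ := fun k => {s ∈ N | ∀ᶠ s' in 𝓝[Icc a b] s, |f s' - f s| ≤ k * |s' - s|}
  have hN : volume N = 0 := by
    refine measure_mono_null (fun s hs => ?_) hae
    intro h
    exact hs.2 ⟨hs.1, h hs.1⟩
  have hNU : N ⊆ ⋃ k, M k := by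
    intro s hs
    obtain ⟨K, hK⟩ := hfin s hs.1
    obtain ⟨k, hk⟩ := exists_nat_ge K
    refine mem_iUnion.2 ⟨k, hs, hK.mono fun s' h => h.trans (by gcongr)⟩
  -- This is the role of the finite pointwise constants on the exceptional null set: they keep its
  -- image null and so exclude functions of Cantor type.
  have hNim : volume (f '' N) = 0 := by
    refine measure_mono_null ((image_mono hNU).trans_eq (image_iUnion)) ?_
    refine measure_iUnion_null fun k => ?_
    have := volume_image_le_of_eventually_le (f := f) (S := Icc a b) (A := M k)
      (fun s hs => hs.1.1) (k : ℝ≥0) (fun s hs => by simpa using hs.2)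
    rw [measure_mono_null (show M k ⊆ N from fun s hs => hs.1) hN, mul_zero] at this
    exact le_antisymm this zero_le
  -- By the intermediate value theorem the increment is at most the measure of the image, to which
  -- only the good points contribute.
  have hsub : uIcc (f a) (f b) ⊆ f '' Icc a b := by
    have := intermediate_value_uIcc (f := f) (a := a) (b := b) (by rwa [uIcc_of_le hab])
    rwa [uIcc_of_le hab] at this
  have hle : volume (uIcc (f a) (f b)) ≤ C * volume (Icc a b) := by
    calc volume (uIcc (f a) (f b)) ≤ volume (f '' Icc a b) := measure_mono hsub
      _ ≤ volume (f '' Good ∪ f '' N) := by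
          refine measure_mono ?_
          rw [← image_union]
          refine image_mono fun s hs => ?_
          by_cases h : s ∈ Good
          · exact Or.inl h
          · exact Or.inr ⟨hs, h⟩
      _ ≤ volume (f '' Good) + volume (f '' N) := measure_union_le _ _
      _ ≤ C * volume Good := by
          rw [hNim, add_zero]
          exact volume_image_le_of_eventually_le (fun s hs => hs.1) C fun s hs => hs.2
      _ ≤ C * volume (Icc a b) := by
          gcongr
          exact fun s hs => hs.1
  rw [Real.volume_interval, Real.volume_Icc, ← ENNReal.ofReal_coe_nnreal,
    ← ENNReal.ofReal_mul C.coe_nonneg] at hle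
  exact (ENNReal.ofReal_le_ofReal_iff (mul_nonneg C.coe_nonneg (sub_nonneg.2 hab))).1 hle

/-! ### Pairings of Lipschitz functions and weak convergence of derivatives. -/

section ClmApply

variable {E : Type*} [NormedAddCommGroup E] [NormedSpace ℝ E]

theorem LipschitzOnWith.exists_norm_le_Icc {F : Type*} [NormedAddCommGroup F] {a b : ℝ}
    {K : ℝ≥0} {f : ℝ → F} (hf : LipschitzOnWith K f (Icc a b)) :
    ∃ M : ℝ≥0, ∀ t ∈ Icc a b, ‖f t‖ ≤ M := by
  obtain ⟨M, hM⟩ := isCompact_Icc.exists_bound_of_continuousOn hf.continuousOn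
  exact ⟨M.toNNReal, fun t ht => (hM t ht).trans (Real.le_coe_toNNReal M)⟩

theorem LipschitzOnWith.exists_clm_apply {a b : ℝ} {K L : ℝ≥0} {P : ℝ → E →L[ℝ] ℝ} {Y : ℝ → E}
    (hP : LipschitzOnWith K P (Icc a b)) (hY : LipschitzOnWith L Y (Icc a b)) :
    ∃ C, LipschitzOnWith C (fun t => P t (Y t)) (Icc a b) := by
  obtain ⟨M, hM⟩ := hP.exists_norm_le_Icc
  obtain ⟨M', hM'⟩ := hY.exists_norm_le_Icc
  refine ⟨K * M' + M * L, LipschitzOnWith.of_dist_le_mul fun s hs t ht => ?_⟩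
  rw [Real.dist_eq]
  have e : P s (Y s) - P t (Y t) = (P s - P t) (Y s) + P t (Y s - Y t) := by simp
  have h1 := hP.dist_le_mul s hs t ht
  have h2 := hY.dist_le_mul s hs t ht
  rw [dist_eq_norm] at h1 h2
  calc |P s (Y s) - P t (Y t)| ≤ ‖(P s - P t) (Y s)‖ + ‖P t (Y s - Y t)‖ := by
        rw [e]; exact norm_add_le ((P s - P t) (Y s)) _
    _ ≤ ‖P s - P t‖ * ‖Y s‖ + ‖P t‖ * ‖Y s - Y t‖ :=
        add_le_add (ContinuousLinearMap.le_opNorm _ _) (ContinuousLinearMap.le_opNorm _ _)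
    _ ≤ (K * dist s t) * M' + M * (L * dist s t) := by
        gcongr
        · exact hM' s hs
        · exact hM t ht
    _ = _ := by push_cast; ring

variable [FiniteDimensional ℝ E]

theorem LipschitzOnWith.ae_differentiableAt_Icc {F : Type*} [NormedAddCommGroup F]
    [NormedSpace ℝ F] [FiniteDimensional ℝ F] {a b : ℝ} {K : ℝ≥0} {f : ℝ → F}
    (hf : LipschitzOnWith K f (Icc a b)) :
    ∀ᵐ t ∂(volume.restrict (Icc a b)), DifferentiableAt ℝ f t ∧ ‖deriv f t‖ ≤ K := by
  rw [restrict_Ioo_eq_restrict_Icc.symm, ae_restrict_iff' measurableSet_Ioo]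
  filter_upwards [hf.ae_differentiableWithinAt_of_mem_real] with t ht hti
  have hn : Icc a b ∈ 𝓝 t := Icc_mem_nhds hti.1 hti.2
  exact ⟨(ht (Ioo_subset_Icc_self hti)).differentiableAt hn, norm_deriv_le_of_lipschitzOn hn hf⟩

theorem ae_uIoc_of_ae_restrict_Icc {a b : ℝ} (hab : a ≤ b) {p : ℝ → Prop}
    (h : ∀ᵐ t ∂(volume.restrict (Icc a b)), p t) : ∀ᵐ t, t ∈ uIoc a b → p t := by
  rw [ae_restrict_iff' measurableSet_Icc] at h
  filter_upwards [h] with t ht hti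
  rw [uIoc_of_le hab] at hti
  exact ht (Ioc_subset_Icc_self hti)

/-- The fundamental theorem of calculus for the pairing of two Lipschitz functions. -/
theorem integral_deriv_clm_apply {a b : ℝ} (hab : a ≤ b) {K L : ℝ≥0} {P : ℝ → E →L[ℝ] ℝ}
    {Y : ℝ → E} (hP : LipschitzOnWith K P (Icc a b)) (hY : LipschitzOnWith L Y (Icc a b)) :
    IntervalIntegrable (fun t => deriv P t (Y t) + P t (deriv Y t)) volume a b ∧
    ∫ t in a..b, (deriv P t (Y t) + P t (deriv Y t)) = P b (Y b) - P a (Y a) := by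
  obtain ⟨C, hC⟩ := hP.exists_clm_apply hY
  rw [← uIcc_of_le hab] at hC
  have hac := hC.absolutelyContinuousOnInterval
  have hd : ∀ᵐ t, t ∈ uIoc a b →
      deriv (fun t => P t (Y t)) t = deriv P t (Y t) + P t (deriv Y t) := by
    refine ae_uIoc_of_ae_restrict_Icc hab ?_
    filter_upwards [hP.ae_differentiableAt_Icc, hY.ae_differentiableAt_Icc] with t h1 h2
    exact (h1.1.hasDerivAt.clm_apply h2.1.hasDerivAt).deriv
  refine ⟨hac.intervalIntegrable_deriv.congr_ae ?_, ?_⟩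
  · rwa [EventuallyEq, ae_restrict_iff' measurableSet_uIoc]
  · rw [← hac.integral_deriv_eq_sub]
    exact (intervalIntegral.integral_congr_ae hd).symm

/-- If the functions `y i` are uniformly Lipschitz and converge uniformly to zero, their
derivatives converge to zero weakly, against bounded sequences converging almost everywhere. -/
theorem tendsto_integral_clm_deriv_zero {ι : Type*} {l : Filter ι} [l.IsCountablyGenerated]
    [l.NeBot] {a b : ℝ} (hab : a ≤ b) {y : ι → ℝ → E} {g : ι → ℝ → E →L[ℝ] ℝ}
    {g₀ : ℝ → E →L[ℝ] ℝ} (K : ℝ≥0) (hy : ∀ i, LipschitzOnWith K (y i) (Icc a b))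
    (hy0 : ∀ ε > (0 : ℝ), ∀ᶠ i in l, ∀ t ∈ Icc a b, ‖y i t‖ ≤ ε)
    (hg : ∀ i, AEStronglyMeasurable (g i) (volume.restrict (Icc a b)))
    (hgK : ∀ᶠ i in l, ∀ᵐ t ∂(volume.restrict (Icc a b)), ‖g i t‖ ≤ K)
    (hlim : ∀ᵐ t ∂(volume.restrict (Icc a b)), Tendsto (fun i => g i t) l (𝓝 (g₀ t))) :
    Tendsto (fun i => ∫ t in a..b, g i t (deriv (y i) t)) l (𝓝 0) := by
  set μ := volume.restrict (Icc a b) with hμ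
  have hfin : IsFiniteMeasure μ := inferInstance
  have hint : ∀ f : ℝ → ℝ, ∫ t in a..b, f t = ∫ t, f t ∂μ := fun f => by
    rw [intervalIntegral.integral_of_le hab, hμ, integral_Icc_eq_integral_Ioc]
  have hg₀ : AEStronglyMeasurable g₀ μ := aestronglyMeasurable_of_tendsto_ae l hg hlim
  have hdy : ∀ i, AEStronglyMeasurable (deriv (y i)) μ := fun i =>
    aestronglyMeasurable_deriv (y i) μ
  -- The bound passes to the almost everywhere limit along a sequence, so that only countably many
  -- null sets are united.
  obtain ⟨u, hu⟩ := l.exists_seq_tendsto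
  have hg₀K : ∀ᵐ t ∂μ, ‖g₀ t‖ ≤ K := by
    obtain ⟨N, hN⟩ := (hu.eventually hgK).exists_forall_of_atTop
    have : ∀ᵐ t ∂μ, ∀ n, N ≤ n → ‖g (u n) t‖ ≤ K :=
      ae_all_iff.2 fun n => by
        by_cases hn : N ≤ n
        · filter_upwards [hN n hn] with t ht _ using ht
        · exact Eventually.of_forall fun t h => absurd h hn
    filter_upwards [this, hlim] with t h1 h2
    exact le_of_tendsto ((h2.comp hu).norm) ((eventually_ge_atTop N).mono fun n hn => h1 n hn)
  have hDK : ∀ᵐ t ∂μ, ∀ i, ‖deriv (y i) t‖ ≤ K := by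
    rw [hμ, restrict_Ioo_eq_restrict_Icc.symm, ae_restrict_iff' measurableSet_Ioo]
    exact Eventually.of_forall fun t ht i =>
      norm_deriv_le_of_lipschitzOn (Icc_mem_nhds ht.1 ht.2) (hy i)
  have hmeas : ∀ {P : ℝ → E →L[ℝ] ℝ} {D : ℝ → E}, AEStronglyMeasurable P μ →
      AEStronglyMeasurable D μ → AEStronglyMeasurable (fun t => P t (D t)) μ := fun hP hD =>
    (isBoundedBilinearMap_apply (𝕜 := ℝ) (E := E) (F := ℝ)).continuous.comp_aestronglyMeasurable
      (hP.prodMk hD)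
  -- the difference `g i - g₀` contributes nothing in the limit
  have h1 : Tendsto (fun i => ∫ t, (g i t - g₀ t) (deriv (y i) t) ∂μ) l (𝓝 0) := by
    have : (0 : ℝ) = ∫ t, (0 : ℝ) ∂μ := by simp
    rw [this]
    refine tendsto_integral_filter_of_dominated_convergence (fun _ => (2 * K * K : ℝ))
      (Eventually.of_forall fun i => hmeas ((hg i).sub hg₀) (hdy i)) ?_ (integrable_const _) ?_
    · filter_upwards [hgK] with i hi
      filter_upwards [hi, hg₀K, hDK] with t h1 h2 h3
      calc ‖(g i t - g₀ t) (deriv (y i) t)‖ ≤ ‖g i t - g₀ t‖ * ‖deriv (y i) t‖ :=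
            ContinuousLinearMap.le_opNorm _ _
        _ ≤ (K + K) * K := by
            gcongr
            · exact (norm_sub_le _ _).trans (add_le_add h1 h2)
            · exact h3 i
        _ = 2 * K * K := by ring
    · filter_upwards [hlim, hDK] with t ht hD
      have h0 : Tendsto (fun i => ‖g i t - g₀ t‖ * K) l (𝓝 0) := by
        have := ((ht.sub_const (g₀ t)).norm).mul_const (K : ℝ)
        simpa using this
      refine squeeze_zero_norm (fun i => ?_) h0
      exact (ContinuousLinearMap.le_opNorm _ _).trans (by gcongr; exact hD i)
  -- With a fixed coefficient, `g₀` is approximated in `L¹` by a smooth `G`; the error is controlled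
  -- by the uniform bound on `deriv (y i)`. For `G`, integration by parts leaves only values of `y
  -- i`, which are uniformly small.
  have h2 : Tendsto (fun i => ∫ t, g₀ t (deriv (y i) t) ∂μ) l (𝓝 0) := by
    rw [Metric.tendsto_nhds]
    intro ε hε
    have hmem : MemLp g₀ 1 μ := MemLp.of_bound hg₀ K hg₀K
    obtain ⟨G, hGc, hGs, hGle⟩ := hmem.exist_eLpNorm_sub_le ENNReal.one_ne_top le_rfl
      (ε := ε / (2 * (K + 1))) (by positivity)
    obtain ⟨L, hL⟩ := (hGs.of_le (m := 1) (by simp)).lipschitzWith_of_hasCompactSupport hGc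
      one_ne_zero
    have hGb : ∃ M : ℝ, ∀ t, ‖G t‖ ≤ M := hGc.exists_bound_of_continuous hGs.continuous
    obtain ⟨M, hM⟩ := hGb
    have hM0 : 0 ≤ M := (norm_nonneg _).trans (hM 0)
    -- The two boundary terms and the integral of `deriv G` add up to at most `(2 * M + L * (b - a))
    -- * δ ≤ ε / 4`; the `L¹` error takes at most `ε / 2`.
    set δ : ℝ := ε / (4 * (2 * M + L * (b - a) + 1)) with hδ
    have hba : 0 ≤ b - a := sub_nonneg.2 hab
    have hδ0 : 0 < δ := by positivity
    have hGm : AEStronglyMeasurable G μ := hGs.continuous.aestronglyMeasurable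
    have hGi : Integrable (g₀ - G) μ :=
      (hmem.integrable le_rfl).sub (Integrable.of_bound hGm M (Eventually.of_forall hM))
    have hGn : ∫ t, ‖(g₀ - G) t‖ ∂μ ≤ ε / (2 * (K + 1)) := by
      rw [integral_norm_eq_lintegral_enorm hGi.1, ← eLpNorm_one_eq_lintegral_enorm]
      exact ENNReal.toReal_le_of_le_ofReal (by positivity) hGle
    filter_upwards [hy0 δ hδ0] with i hi
    obtain ⟨hI, hE⟩ := integral_deriv_clm_apply hab (hL.lipschitzOnWith (s := Icc a b)) (hy i)
    have hIG : Integrable (fun t => G t (deriv (y i) t)) μ :=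
      Integrable.of_bound (hmeas hGm (hdy i)) (M * K) (hDK.mono fun t ht =>
        (ContinuousLinearMap.le_opNorm _ _).trans (mul_le_mul (hM t) (ht i) (norm_nonneg _) hM0))
    have hIg : Integrable (fun t => (g₀ - G) t (deriv (y i) t)) μ :=
      Integrable.mono' (hGi.norm.mul_const (K : ℝ)) (hmeas (hmem.1.sub hGm) (hdy i))
        (hDK.mono fun t ht => (ContinuousLinearMap.le_opNorm _ _).trans
          (mul_le_mul_of_nonneg_left (ht i) (norm_nonneg _)))
    have hyb : ∀ᵐ t ∂μ, ‖y i t‖ ≤ δ := by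
      rw [hμ, ae_restrict_iff' measurableSet_Icc]
      exact Eventually.of_forall hi
    have hdG : ∀ t, ‖deriv G t‖ ≤ L := fun t => norm_deriv_le_of_lipschitz hL
    have hIdb : ∀ᵐ t ∂μ, ‖deriv G t (y i t)‖ ≤ L * δ := hyb.mono fun t ht =>
      (ContinuousLinearMap.le_opNorm _ _).trans (mul_le_mul (hdG t) ht (norm_nonneg _) L.2)
    have hId : Integrable (fun t => deriv G t (y i t)) μ :=
      Integrable.of_bound (hmeas (aestronglyMeasurable_deriv G μ)
        ((hy i).continuousOn.aestronglyMeasurable measurableSet_Icc)) (L * δ) hIdb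
    have e1 : ∫ t, G t (deriv (y i) t) ∂μ =
        G b (y i b) - G a (y i a) - ∫ t, deriv G t (y i t) ∂μ := by
      rw [← hE, hint, integral_add hId hIG]
      ring
    have e2 : ∫ t, g₀ t (deriv (y i) t) ∂μ =
        ∫ t, (g₀ - G) t (deriv (y i) t) ∂μ + ∫ t, G t (deriv (y i) t) ∂μ := by
      rw [← integral_add hIg hIG]
      simp
    have b1 : ‖∫ t, (g₀ - G) t (deriv (y i) t) ∂μ‖ ≤ ε / (2 * (K + 1)) * K := by
      calc _ ≤ ∫ t, ‖(g₀ - G) t‖ * K ∂μ :=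
            norm_integral_le_of_norm_le (hGi.norm.mul_const (K : ℝ)) (hDK.mono fun t ht =>
              (ContinuousLinearMap.le_opNorm _ _).trans
                (mul_le_mul_of_nonneg_left (ht i) (norm_nonneg _)))
        _ ≤ _ := by
            rw [integral_mul_const]
            gcongr
    have b2 : ‖∫ t, deriv G t (y i t) ∂μ‖ ≤ L * δ * (b - a) := by
      have := norm_integral_le_of_norm_le_const hIdb
      rwa [hμ, measureReal_restrict_apply_univ, Real.volume_real_Icc_of_le hab] at this
    have b3 : ∀ t ∈ Icc a b, |G t (y i t)| ≤ M * δ := fun t ht =>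
      ((G t).le_opNorm _).trans (mul_le_mul (hM t) (hi t ht) (norm_nonneg _) hM0)
    have c1 : ε / (2 * (K + 1)) * K ≤ ε / 2 := by
      rw [div_mul_eq_mul_div, div_le_div_iff₀ (by positivity) (by positivity)]
      nlinarith [K.coe_nonneg]
    have c2 : (2 * M + L * (b - a)) * δ ≤ ε / 4 := by
      rw [hδ, mul_div_assoc', div_le_div_iff₀ (by positivity) (by positivity)]
      have : 0 ≤ 2 * M + L * (b - a) := by positivity
      nlinarith
    rw [dist_zero_right, e2, e1]
    have h3 := b3 a (left_mem_Icc.2 hab)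
    have h4 := b3 b (right_mem_Icc.2 hab)
    rw [Real.norm_eq_abs] at b1 b2 ⊢
    rw [abs_le] at b1 b2 h3 h4
    rw [abs_lt]
    constructor <;> linarith [b1.1, b1.2, b2.1, b2.2, h3.1, h3.2, h4.1, h4.2]
  have h3 := h1.add h2
  rw [add_zero] at h3
  refine h3.congr' ?_
  filter_upwards [hgK] with i hi
  rw [hint, ← integral_add]
  · simp
  · refine Integrable.of_bound (hmeas ((hg i).sub hg₀) (hdy i)) ((K + K) * K) ?_
    filter_upwards [hi, hg₀K, hDK] with t h1 h2 h3
    exact (ContinuousLinearMap.le_opNorm _ _).trans (mul_le_mul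
      ((norm_sub_le _ _).trans (add_le_add h1 h2)) (h3 i) (norm_nonneg _) (by positivity))
  · refine Integrable.of_bound (hmeas hg₀ (hdy i)) (K * K) ?_
    filter_upwards [hg₀K, hDK] with t h1 h2
    exact (ContinuousLinearMap.le_opNorm _ _).trans
      (mul_le_mul h1 (h2 i) (norm_nonneg _) K.coe_nonneg)

end ClmApply

/-! ### Hamiltonian flows in canonical coordinates -/

section CoordinateFlow

variable {E : Type*} [NormedAddCommGroup E] [NormedSpace ℝ E]
  {F : Type*} [NormedAddCommGroup F]

/-- A family `z · u` of trajectories of the Hamiltonian system of `H` in `E × E^*`, Lipschitz in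
time and in the parameter `u ∈ B`, with action density `G`. -/
structure CoordinateFlow (a b : ℝ) (B : Set F) (K : ℝ≥0) (z : ℝ → F → E × (E →L[ℝ] ℝ))
    (H : ℝ → E × (E →L[ℝ] ℝ) → ℝ) (G : ℝ → F → ℝ) : Prop where
  lip : LipschitzOnWith K (fun x : ℝ × F => z x.1 x.2) (Icc a b ×ˢ B)
  diff : ∀ᵐ t ∂(volume.restrict (Icc a b)), ∀ u ∈ B, DifferentiableAt ℝ (H t) (z t u)
  ode : ∀ u ∈ B, ∀ᵐ t ∂(volume.restrict (Icc a b)), ∃ X : E × (E →L[ℝ] ℝ),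
    HasDerivAt (fun s => z s u) X t ∧
    (∀ v, fderiv ℝ (H t) (z t u) v = v.2 X.1 - X.2 v.1) ∧
    G t u = (z t u).2 X.1 - H t (z t u)
  meas : ∀ u ∈ B, AEMeasurable (fun t => G t u) (volume.restrict (Icc a b))
  bdd : ∀ u ∈ B, ∃ C : ℝ, ∀ᵐ t ∂(volume.restrict (Icc a b)), |G t u| ≤ C
  unif : ∃ C : ℝ≥0, ∀ᵐ t ∂(volume.restrict (Icc a b)), ∀ u ∈ B, ∀ v ∈ B,
    |G t u - G t v| ≤ C * dist u v

namespace CoordinateFlow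

variable {a b : ℝ} {B : Set F} {K : ℝ≥0} {z : ℝ → F → E × (E →L[ℝ] ℝ)}
  {H : ℝ → E × (E →L[ℝ] ℝ) → ℝ} {G : ℝ → F → ℝ}

theorem mono_interval (h : CoordinateFlow a b B K z H G) {a' b' : ℝ} (ha : a ≤ a') (hb : b' ≤ b) :
    CoordinateFlow a' b' B K z H G := by
  have hs : Icc a' b' ⊆ Icc a b := Icc_subset_Icc ha hb
  have hac := ae_mono (Measure.restrict_mono (μ := volume) hs le_rfl)
  refine ⟨h.lip.mono (prod_mono hs Subset.rfl), hac h.diff, fun u hu => hac (h.ode u hu),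
    fun u hu => (h.meas u hu).mono_measure (Measure.restrict_mono hs le_rfl), fun u hu => ?_, ?_⟩
  · obtain ⟨C, hC⟩ := h.bdd u hu
    exact ⟨C, hac hC⟩
  · obtain ⟨C, hC⟩ := h.unif
    exact ⟨C, hac hC⟩

theorem mono_set (h : CoordinateFlow a b B K z H G) {B' : Set F} (hs : B' ⊆ B) :
    CoordinateFlow a b B' K z H G := by
  obtain ⟨C, hC⟩ := h.unif
  exact ⟨h.lip.mono (prod_mono Subset.rfl hs), h.diff.mono fun t ht u hu => ht u (hs hu),
    fun u hu => h.ode u (hs hu), fun u hu => h.meas u (hs hu), fun u hu => h.bdd u (hs hu),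
    C, hC.mono fun t ht u hu v hv => ht u (hs hu) v (hs hv)⟩

/-- Restricting the initial data to a curve reduces the analysis to one real parameter. The time
variable is untouched, hence `max 1 L` in place of `L`. -/
theorem comp_curve (h : CoordinateFlow a b B K z H G) {γ : ℝ → F} {L : ℝ≥0}
    (hγ : LipschitzWith L γ) (hB : ∀ s, γ s ∈ B) :
    CoordinateFlow a b univ (K * max 1 L) (fun t s => z t (γ s)) H (fun t s => G t (γ s)) := by
  refine ⟨?_, h.diff.mono fun t ht s _ => ht _ (hB s), fun s _ => h.ode _ (hB s),
    fun s _ => h.meas _ (hB s), fun s _ => h.bdd _ (hB s), ?_⟩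
  · have : LipschitzWith (max 1 L) (fun x : ℝ × ℝ => (x.1, γ x.2)) := by
      have := LipschitzWith.prod_fst (α := ℝ) (β := ℝ) |>.prodMk
        (hγ.comp (LipschitzWith.prod_snd (α := ℝ) (β := ℝ)))
      simpa using this
    exact h.lip.comp this.lipschitzOnWith fun x hx => ⟨hx.1, hB _⟩
  · obtain ⟨C, hC⟩ := h.unif
    refine ⟨C * L, hC.mono fun t ht s _ s' _ => (ht _ (hB s) _ (hB s')).trans ?_⟩
    push_cast
    rw [mul_assoc]
    gcongr
    exact hγ.dist_le_mul s s'

theorem lip_time (h : CoordinateFlow a b B K z H G) {u : F} (hu : u ∈ B) :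
    LipschitzOnWith K (fun t => z t u) (Icc a b) := by
  refine LipschitzOnWith.of_dist_le_mul fun t ht t' ht' => ?_
  simpa [Prod.dist_eq] using h.lip.dist_le_mul (t, u) ⟨ht, hu⟩ (t', u) ⟨ht', hu⟩

theorem lip_param (h : CoordinateFlow a b B K z H G) {t : ℝ} (ht : t ∈ Icc a b) :
    LipschitzOnWith K (z t) B := by
  refine LipschitzOnWith.of_dist_le_mul fun u hu u' hu' => ?_
  simpa [Prod.dist_eq] using h.lip.dist_le_mul (t, u) ⟨ht, hu⟩ (t, u') ⟨ht, hu'⟩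

theorem lip_fst (h : CoordinateFlow a b B K z H G) {u : F} (hu : u ∈ B) :
    LipschitzOnWith K (fun t => (z t u).1) (Icc a b) := by
  rw [← one_mul K]
  exact (LipschitzWith.prod_fst (α := E) (β := E →L[ℝ] ℝ)).comp_lipschitzOnWith (h.lip_time hu)

theorem lip_snd (h : CoordinateFlow a b B K z H G) {u : F} (hu : u ∈ B) :
    LipschitzOnWith K (fun t => (z t u).2) (Icc a b) := by
  rw [← one_mul K]
  exact (LipschitzWith.prod_snd (α := E) (β := E →L[ℝ] ℝ)).comp_lipschitzOnWith (h.lip_time hu)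

/-- Almost every time, the velocity of a trajectory is bounded by its Lipschitz constant. -/
theorem ode_bound (h : CoordinateFlow a b B K z H G) {u : F} (hu : u ∈ B) :
    ∀ᵐ t ∂(volume.restrict (Icc a b)), ∃ X : E × (E →L[ℝ] ℝ),
      HasDerivAt (fun s => z s u) X t ∧ ‖X‖ ≤ K ∧
      (∀ v, fderiv ℝ (H t) (z t u) v = v.2 X.1 - X.2 v.1) ∧
      G t u = (z t u).2 X.1 - H t (z t u) := by
  have h1 := h.ode u hu
  rw [restrict_Ioo_eq_restrict_Icc.symm] at h1 ⊢
  filter_upwards [h1, ae_restrict_mem measurableSet_Ioo] with t ht hti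
  obtain ⟨X, hX, h2, h3⟩ := ht
  refine ⟨X, hX, ?_, h2, h3⟩
  rw [← hX.deriv]
  exact norm_deriv_le_of_lipschitzOn (Icc_mem_nhds hti.1 hti.2) (h.lip_time hu)

/-- Since `dH = σ(·, X)`, the bound `‖X‖ ≤ K` on the velocity becomes a bound on the differential,
each of the two terms of `σ` contributing `K`. The exceptional set of times depends on `u`. -/
theorem norm_fderiv_le (h : CoordinateFlow a b B K z H G) {u : F} (hu : u ∈ B) :
    ∀ᵐ t ∂(volume.restrict (Icc a b)), ∀ v, |fderiv ℝ (H t) (z t u) v| ≤ 2 * K * ‖v‖ := by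
  filter_upwards [h.ode_bound hu] with t ht v
  obtain ⟨X, -, hX, hD, -⟩ := ht
  rw [hD]
  calc |v.2 X.1 - X.2 v.1| ≤ ‖v.2 X.1‖ + ‖X.2 v.1‖ := norm_sub_le (v.2 X.1) _
    _ ≤ ‖v.2‖ * ‖X.1‖ + ‖X.2‖ * ‖v.1‖ :=
        add_le_add (ContinuousLinearMap.le_opNorm _ _) (ContinuousLinearMap.le_opNorm _ _)
    _ ≤ ‖v‖ * K + K * ‖v‖ := by
        gcongr
        · exact norm_snd_le v
        · exact (norm_fst_le X).trans hX
        · exact (norm_snd_le X).trans hX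
        · exact norm_fst_le v
    _ = 2 * K * ‖v‖ := by ring

theorem aestronglyMeasurable_clm_apply {μ : Measure ℝ} {P : ℝ → E →L[ℝ] ℝ} {D : ℝ → E}
    (hP : AEStronglyMeasurable P μ) (hD : AEStronglyMeasurable D μ) :
    AEStronglyMeasurable (fun t => P t (D t)) μ :=
  (isBoundedBilinearMap_apply (𝕜 := ℝ) (E := E) (F := ℝ)).continuous.comp_aestronglyMeasurable
    (hP.prodMk hD)

theorem intervalIntegrable_density (h : CoordinateFlow a b B K z H G) {u : F} (hu : u ∈ B) :
    IntegrableOn (fun t => G t u) (Icc a b) := by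
  obtain ⟨C, hC⟩ := h.bdd u hu
  exact Integrable.of_bound (h.meas u hu).aestronglyMeasurable C hC

/-- `H` carries no measurability assumption in time; measurability and integrability of the energy
along a trajectory are read off from the right-hand side. -/
theorem energy_ae_eq (h : CoordinateFlow a b B K z H G) {u : F} (hu : u ∈ B) :
    ∀ᵐ t ∂(volume.restrict (Icc a b)),
      H t (z t u) = (z t u).2 (deriv (fun s => (z s u).1) t) - G t u := by
  filter_upwards [h.ode u hu] with t ht
  obtain ⟨X, hX, -, hG⟩ := ht
  have hX1 : HasDerivAt (fun s => (z s u).1) X.1 t := hX.fst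
  rw [hX1.deriv, hG]
  ring

variable [FiniteDimensional ℝ E]

theorem energy_integrableOn (h : CoordinateFlow a b B K z H G) {u : F} (hu : u ∈ B) :
    IntegrableOn (fun t => H t (z t u)) (Icc a b) := by
  refine Integrable.congr ?_ ((h.energy_ae_eq hu).mono fun t ht => ht.symm)
  refine Integrable.sub ?_ (h.intervalIntegrable_density hu)
  obtain ⟨M, hM⟩ := (h.lip_snd hu).exists_norm_le_Icc
  refine Integrable.of_bound (aestronglyMeasurable_clm_apply
    ((h.lip_snd hu).continuousOn.aestronglyMeasurable measurableSet_Icc)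
    (aestronglyMeasurable_deriv _ _)) (M * K) ?_
  filter_upwards [(h.lip_fst hu).ae_differentiableAt_Icc, ae_restrict_mem measurableSet_Icc]
    with t h1 h2
  exact (ContinuousLinearMap.le_opNorm _ _).trans
    (mul_le_mul (hM t h2) h1.2 (norm_nonneg _) M.coe_nonneg)

/-- Along a Lipschitz curve of initial data, the energy is Lipschitz for almost every time. -/
theorem energy_lipschitz_curve {z : ℝ → ℝ → E × (E →L[ℝ] ℝ)} {G : ℝ → ℝ → ℝ}
    (h : CoordinateFlow a b univ K z H G) {L : ℝ≥0} (hL : ∀ t ∈ Icc a b, LipschitzWith L (z t)) :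
    ∀ᵐ t ∂(volume.restrict (Icc a b)),
      LipschitzWith ((2 * K + 1) * L) (fun s => H t (z t s)) := by
  set μ := volume.restrict (Icc a b) with hμ
  set K' : ℝ≥0 := (2 * K + 1) * L with hK'
  have hcont : ∀ᵐ t ∂μ, Continuous fun s => H t (z t s) := by
    filter_upwards [h.diff, ae_restrict_mem measurableSet_Icc] with t ht hti
    exact continuous_iff_continuousAt.2 fun s =>
      (ht s (mem_univ s)).continuousAt.comp (f := z t) (hL t hti).continuous.continuousAt
  have hm : ∀ s, AEMeasurable (fun t => H t (z t s)) μ := fun s =>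
    (h.energy_integrableOn (mem_univ s)).1.aemeasurable
  have hq : ∀ᵐ t ∂μ, ∀ r : ℚ, H t (z t r) = (hm r).mk _ t := ae_all_iff.2 fun r => (hm r).ae_eq_mk
  obtain ⟨T', hT'sub, hT'm, hT'0⟩ := exists_measurable_superset_of_null
    (s := {t | ¬ ((Continuous fun s => H t (z t s)) ∧ ∀ r : ℚ, H t (z t r) = (hm r).mk _ t)})
    (hcont.and hq)
  set T := T'ᶜ with hT
  have hTm : MeasurableSet T := hT'm.compl
  have hTc : ∀ t ∈ T, Continuous fun s => H t (z t s) := fun t ht => by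
    by_contra hc
    exact ht (hT'sub fun h' => hc h'.1)
  have hTq : ∀ t ∈ T, ∀ r : ℚ, H t (z t r) = (hm r).mk _ t := fun t ht => by
    by_contra hc
    exact ht (hT'sub fun h' => hc h'.2)
  have hTae : ∀ᵐ t ∂μ, t ∈ T := by
    rw [ae_iff]
    simpa [hT] using hT'0
  -- Set to zero off the full-measure set `T` of times, the energy is continuous in `s` and
  -- measurable in `t`, hence jointly measurable, as Fubini requires.
  set U : ℝ → ℝ → ℝ := fun s t => T.indicator (fun t => H t (z t s)) t with hU
  have hUc : ∀ t, Continuous fun s => U s t := fun t => by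
    by_cases ht : t ∈ T
    · simpa [hU, ht] using hTc t ht
    · simpa [hU, ht] using continuous_const
  have hUq : ∀ r : ℚ, Measurable (U r) := fun r => by
    have : U r = T.indicator ((hm r).mk _) := by
      ext t
      by_cases ht : t ∈ T
      · simp [hU, ht, hTq t ht r]
      · simp [hU, ht]
    rw [this]
    exact (hm r).measurable_mk.indicator hTm
  have hUm : ∀ s, Measurable (U s) := fun s => by
    have hd : DenseRange ((↑) : ℚ → ℝ) := Rat.denseRange_cast
    have hs : s ∈ closure (range ((↑) : ℚ → ℝ)) := hd s
    obtain ⟨x, hx, hxs⟩ := mem_closure_iff_seq_limit.1 hs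
    choose r hr using hx
    refine measurable_of_tendsto_metrizable (f := fun n => U (r n)) (fun n => hUq _) ?_
    rw [tendsto_pi_nhds]
    intro t
    refine ((hUc t).tendsto s).comp ?_
    simpa [hr] using hxs
  have hUU : Measurable (Function.uncurry U) :=
    (stronglyMeasurable_uncurry_of_continuous_of_stronglyMeasurable hUc
      fun s => (hUm s).stronglyMeasurable).measurable
  -- Testing only rational points and the radii `1 / (k + 1)` makes this a countable combination of
  -- measurable conditions; continuity in `s` restores the real points later.
  set p : ℝ → ℝ → Prop := fun s t => ∃ k : ℕ, ∀ r : ℚ, |(r : ℝ) - s| < 1 / (k + 1 : ℝ) →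
    |U r t - U s t| ≤ K' * |(r : ℝ) - s| with hp
  have hpm : MeasurableSet {x : ℝ × ℝ | p x.1 x.2} := by
    simp only [hp, ofPred_exists, ofPred_forall]
    refine MeasurableSet.iUnion fun k => MeasurableSet.iInter fun r => ?_
    have e : {x : ℝ × ℝ | |(r : ℝ) - x.1| < 1 / (k + 1 : ℝ) →
        |U r x.2 - U x.1 x.2| ≤ K' * |(r : ℝ) - x.1|} =
        {x : ℝ × ℝ | |(r : ℝ) - x.1| < 1 / (k + 1 : ℝ)}ᶜ ∪
        {x : ℝ × ℝ | |U r x.2 - U x.1 x.2| ≤ K' * |(r : ℝ) - x.1|} := by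
      ext x
      simp only [mem_ofPred_eq, mem_union, mem_compl_iff]
      tauto
    have e1 : Measurable fun x : ℝ × ℝ => |(r : ℝ) - x.1| := by fun_prop
    have e2 : Measurable fun x : ℝ × ℝ => |U r x.2 - U x.1 x.2| :=
      (((hUm r).comp measurable_snd).sub hUU).abs
    rw [e]
    exact (measurableSet_lt e1 measurable_const).compl.union
      (measurableSet_le e2 (e1.const_mul _))
  -- For fixed `s` almost every time has `‖dH‖ ≤ 2K`; the extra `1` in `2K + 1` absorbs the
  -- remainder in the definition of the derivative.
  have hev : ∀ s, ∀ᵐ t ∂μ, p s t := fun s => by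
    filter_upwards [h.diff, h.norm_fderiv_le (mem_univ s), hTae, ae_restrict_mem measurableSet_Icc]
      with t hd hb hti htI
    have hlo := (hd s (mem_univ s)).hasFDerivAt.isLittleO.def one_pos
    have hlo' := ((hL t htI).continuous.tendsto s).eventually hlo
    obtain ⟨ε, hε, hball⟩ := Metric.eventually_nhds_iff.1 hlo'
    obtain ⟨k, hk⟩ := exists_nat_one_div_lt hε
    refine ⟨k, fun r hr => ?_⟩
    have h1 := hball (y := (r : ℝ)) (by rw [Real.dist_eq]; exact hr.trans hk)
    have h2 := hb (z t r - z t s)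
    have h3 := (hL t htI).dist_le_mul (r : ℝ) s
    rw [Real.dist_eq, dist_eq_norm] at h3
    rw [one_mul, Real.norm_eq_abs] at h1
    simp only [hU, indicator_of_mem hti]
    have h4 : |H t (z t r) - H t (z t s)| ≤ (2 * K + 1) * ‖z t r - z t s‖ := by
      rw [abs_le] at h1 h2 ⊢
      constructor <;> linarith [h1.1, h1.2, h2.1, h2.2]
    refine h4.trans ?_
    rw [hK']
    push_cast
    rw [mul_assoc]
    gcongr
  -- Fubini exchanges the quantifiers: the null set of times no longer depends on `s`. The null set
  -- of parameters left over is harmless, because differentiability of `H t` gives a finite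
  -- pointwise constant at every `s`.
  have hcomm : ∀ᵐ t ∂μ, ∀ᵐ s, p s t :=
    (Measure.ae_ae_comm hpm).1 (Eventually.of_forall hev)
  filter_upwards [hcomm, hTae, h.diff, ae_restrict_mem measurableSet_Icc] with t hpt ht hd htI
  have hfin : ∀ s, ∃ C : ℝ, ∀ᶠ s' in 𝓝 s, |H t (z t s') - H t (z t s)| ≤ C * |s' - s| := by
    intro s
    obtain ⟨c, hc, hO⟩ := (hd s (mem_univ s)).isBigO_sub.exists_nonneg
    refine ⟨c * L, ?_⟩
    filter_upwards [((hL t htI).continuous.tendsto s).eventually hO.bound] with s' hs'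
    have h3 := (hL t htI).dist_le_mul s' s
    rw [Real.dist_eq, dist_eq_norm] at h3
    rw [mul_assoc]
    exact hs'.trans (by gcongr)
  have hle : ∀ s s', s ≤ s' → |H t (z t s') - H t (z t s)| ≤ K' * (s' - s) := by
    intro s s' hss
    refine abs_sub_le_of_ae_eventually_le (f := fun s => H t (z t s)) hss K' (fun x _ => ?_) ?_
    · obtain ⟨C, hC⟩ := hfin x
      exact ⟨C, hC.filter_mono nhdsWithin_le_nhds⟩
    · filter_upwards [hpt] with x hx _
      obtain ⟨k, hk⟩ := hx
      simp only [hU, indicator_of_mem ht] at hk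
      refine Eventually.filter_mono nhdsWithin_le_nhds ?_
      have hcl : IsClosed {y : ℝ | |H t (z t y) - H t (z t x)| ≤ K' * |y - x|} := by
        exact isClosed_le ((hTc t ht).sub continuous_const).abs (by fun_prop)
      have hd : Dense (range ((↑) : ℚ → ℝ)) := Rat.denseRange_cast
      have hsub : Metric.ball x (1 / (k + 1 : ℝ)) ⊆
          {y : ℝ | |H t (z t y) - H t (z t x)| ≤ K' * |y - x|} := by
        refine (hd.open_subset_closure_inter Metric.isOpen_ball).trans
          (closure_minimal ?_ hcl)
        rintro y ⟨hy, r, rfl⟩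
        exact hk r (by simpa [Real.dist_eq] using hy)
      filter_upwards [Metric.ball_mem_nhds x (show (0 : ℝ) < 1 / (k + 1 : ℝ) by positivity)]
        with y hy using hsub hy
  refine LipschitzWith.of_dist_le_mul fun s s' => ?_
  rw [Real.dist_eq, Real.dist_eq]
  rcases le_total s s' with hss | hss
  · rw [abs_sub_comm, abs_sub_comm s, abs_of_nonneg (sub_nonneg.2 hss)]
    exact hle s s' hss
  · rw [abs_of_nonneg (sub_nonneg.2 hss)]
    exact hle s' s hss

end CoordinateFlow

end CoordinateFlow

/-! ### Variation of the action along a curve of initial data. -/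

namespace CoordinateFlow

section Curve

variable {E : Type*} [NormedAddCommGroup E] [NormedSpace ℝ E] [FiniteDimensional ℝ E]
  {a b : ℝ} {K L : ℝ≥0} {z : ℝ → ℝ → E × (E →L[ℝ] ℝ)}
  {H : ℝ → E × (E →L[ℝ] ℝ) → ℝ} {G : ℝ → ℝ → ℝ}

/-- Write `z = (x, p)`. Subtracting from `G t s' - G t s` the time derivative of `p(s) (x(s') -
x(s))` removes the boundary terms. By Hamilton's equations what remains is `(p(s') - p(s))` applied
to the time derivative of `x(s') - x(s)`, plus `dH (z(s') - z(s)) - (H(z(s')) - H(z(s)))`. After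
division by `s' - s` these are the two integrands `g s' t (deriv (y s') t)` and `ρ s' t`, whose
integrals both tend to zero. -/
theorem hasDerivAt_action_at (h : CoordinateFlow a b univ K z H G) (hab : a ≤ b)
    (hL : ∀ t ∈ Icc a b, LipschitzWith L (z t)) {s : ℝ}
    (hs : ∀ᵐ t ∂(volume.restrict (Icc a b)), DifferentiableAt ℝ (z t) s) :
    HasDerivAt (fun s' => (∫ t in a..b, G t s') - (z b s).2 (z b s').1 + (z a s).2 (z a s').1)
      0 s := by
  set μ := volume.restrict (Icc a b) with hμ
  have hint : ∀ f : ℝ → ℝ, ∫ t in a..b, f t = ∫ t, f t ∂μ := fun f => by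
    rw [intervalIntegral.integral_of_le hab, hμ, integral_Icc_eq_integral_Ioc]
  set y : ℝ → ℝ → E := fun s' t => (z t s').1 - (z t s).1 with hy
  set g : ℝ → ℝ → E →L[ℝ] ℝ := fun s' t => (s' - s)⁻¹ • ((z t s').2 - (z t s).2) with hg
  set ρ : ℝ → ℝ → ℝ := fun s' t => (s' - s)⁻¹ *
    (fderiv ℝ (H t) (z t s) (z t s' - z t s) - (H t (z t s') - H t (z t s))) with hρ
  have hyL : ∀ s', LipschitzOnWith (K + K) (y s') (Icc a b) := fun s' =>
    (h.lip_fst (mem_univ s')).sub (h.lip_fst (mem_univ s))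
  have hdiff : ∀ t ∈ Icc a b, ∀ s', ‖z t s' - z t s‖ ≤ L * |s' - s| := fun t ht s' => by
    have := (hL t ht).dist_le_mul s' s
    rwa [dist_eq_norm, Real.dist_eq] at this
  have hgm : ∀ s', AEStronglyMeasurable (g s') μ := fun s' =>
    AEStronglyMeasurable.const_smul (f := fun t => (z t s').2 - (z t s).2)
      (((h.lip_snd (mem_univ s')).continuousOn.sub
        (h.lip_snd (mem_univ s)).continuousOn).aestronglyMeasurable measurableSet_Icc) (s' - s)⁻¹
  have hgb : ∀ t ∈ Icc a b, ∀ s', ‖g s' t‖ ≤ L := fun t ht s' => by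
    rw [hg, norm_smul, norm_inv, Real.norm_eq_abs]
    have h1 : ‖(z t s').2 - (z t s).2‖ ≤ L * |s' - s| :=
      (norm_snd_le (z t s' - z t s)).trans (hdiff t ht s')
    rcases eq_or_ne s' s with rfl | hne
    · simp
    · rw [inv_mul_le_iff₀ (abs_pos.2 (sub_ne_zero.2 hne)), mul_comm]
      exact h1
  -- the integral identity
  have hslope : ∀ s', s' ≠ s → slope (fun s' => (∫ t in a..b, G t s') - (z b s).2 (z b s').1 +
      (z a s).2 (z a s').1) s s' = (∫ t in a..b, g s' t (deriv (y s') t)) + ∫ t, ρ s' t ∂μ := by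
    intro s' hne
    obtain ⟨hI, hE⟩ := integral_deriv_clm_apply hab (h.lip_snd (mem_univ s)) (hyL s')
    have hGi : Integrable (fun t => G t s' - G t s) μ :=
      (h.intervalIntegrable_density (mem_univ s')).sub (h.intervalIntegrable_density (mem_univ s))
    have hIi : Integrable (fun t => deriv (fun t => (z t s).2) t (y s' t) +
        (z t s).2 (deriv (y s') t)) μ :=
      (intervalIntegrable_iff_integrableOn_Icc_of_le hab).1 hI
    have hgi : Integrable (fun t => g s' t (deriv (y s') t)) μ := by
      refine Integrable.of_bound (aestronglyMeasurable_clm_apply (hgm s')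
        (aestronglyMeasurable_deriv _ _)) (L * (K + K)) ?_
      filter_upwards [(hyL s').ae_differentiableAt_Icc, ae_restrict_mem measurableSet_Icc]
        with t h1 h2
      exact (ContinuousLinearMap.le_opNorm _ _).trans
        (mul_le_mul (hgb t h2 s') (by simpa using h1.2) (norm_nonneg _) L.coe_nonneg)
    have hae : ∀ᵐ t ∂μ, (s' - s)⁻¹ * ((G t s' - G t s) -
        (deriv (fun t => (z t s).2) t (y s' t) + (z t s).2 (deriv (y s') t))) -
          g s' t (deriv (y s') t) = ρ s' t := by
      filter_upwards [h.ode s (mem_univ s), h.ode s' (mem_univ s')] with t h1 h2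
      obtain ⟨X, hX, hD, hG⟩ := h1
      obtain ⟨X', hX', -, hG'⟩ := h2
      have e1 : deriv (fun t => (z t s).2) t = X.2 := (show HasDerivAt _ X.2 t from hX.snd).deriv
      have e2 : deriv (y s') t = X'.1 - X.1 :=
        ((show HasDerivAt _ X'.1 t from hX'.fst).sub
          (show HasDerivAt _ X.1 t from hX.fst)).deriv
      simp only [e2]
      simp only [hρ, hg, hD, e1, hG, hG', hy, map_sub,
        sub_apply, smul_apply, smul_eq_mul]
      ring
    have hρe : ∫ t, ρ s' t ∂μ = (s' - s)⁻¹ * (∫ t, (G t s' - G t s) ∂μ -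
        ∫ t, (deriv (fun t => (z t s).2) t (y s' t) + (z t s).2 (deriv (y s') t)) ∂μ) -
          ∫ t, g s' t (deriv (y s') t) ∂μ := by
      rw [← integral_congr_ae hae, integral_sub _ hgi, integral_const_mul, integral_sub hGi hIi]
      exact (hGi.sub hIi).const_mul _
    rw [hρe, ← hint (fun t => deriv (fun t => (z t s).2) t (y s' t) + (z t s).2 (deriv (y s') t)),
      hE, ← hint (fun t => g s' t (deriv (y s') t)), slope_def_field, hint, hint,
      integral_sub (h.intervalIntegrable_density (mem_univ s'))
        (h.intervalIntegrable_density (mem_univ s))]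
    simp only [hy, map_sub]
    field_simp
    ring
  rw [hasDerivAt_iff_tendsto_slope]
  -- The quotients `g s'` are bounded by `L` and converge for almost every time, whereas `deriv (y
  -- s')` is only known to be bounded. The limit is zero because `y s'` tends to zero uniformly, so
  -- its derivatives do so weakly.
  have hW : Tendsto (fun s' => ∫ t in a..b, g s' t (deriv (y s') t)) (𝓝[≠] s) (𝓝 0) := by
    refine tendsto_integral_clm_deriv_zero hab (K + K + L)
      (g₀ := fun t => deriv (fun s' => (z t s').2) s)
      (fun s' => (hyL s').weaken le_self_add) (fun ε hε => ?_) hgm ?_ ?_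
    · have : Tendsto (fun s' : ℝ => (L : ℝ) * |s' - s|) (𝓝[≠] s) (𝓝 0) := by
        have hc : Continuous fun s' : ℝ => (L : ℝ) * |s' - s| := by fun_prop
        have := (hc.tendsto s).mono_left (nhdsWithin_le_nhds (s := {s}ᶜ))
        simpa using this
      filter_upwards [this.eventually (gt_mem_nhds hε)] with s' hs' t ht
      exact ((norm_fst_le (z t s' - z t s)).trans (hdiff t ht s')).trans hs'.le
    · refine Eventually.of_forall fun s' => ?_
      filter_upwards [ae_restrict_mem measurableSet_Icc] with t ht
      refine (hgb t ht s').trans ?_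
      push_cast
      linarith [K.coe_nonneg]
    · filter_upwards [hs] with t ht
      have h2 : HasDerivAt (fun s' => (z t s').2) (deriv (fun s' => (z t s').2) s) s :=
        ht.snd.hasDerivAt
      exact h2.tendsto_slope
  have hR : Tendsto (fun s' => ∫ t, ρ s' t ∂μ) (𝓝[≠] s) (𝓝 0) := by
    have h0 : (0 : ℝ) = ∫ t, (0 : ℝ) ∂μ := by simp
    rw [h0]
    have hDm : ∀ s', AEStronglyMeasurable (ρ s') μ := fun s' => by
      -- The differential of `H t` is not known to be measurable in `t`; Hamilton's equations
      -- replace it by velocities of the trajectory.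
      have hm : AEStronglyMeasurable (fun t => (s' - s)⁻¹ *
          (((z t s').2 - (z t s).2) (deriv (fun t => (z t s).1) t) -
            deriv (fun t => (z t s).2) t ((z t s').1 - (z t s).1) -
            (H t (z t s') - H t (z t s)))) μ := by
        refine AEStronglyMeasurable.const_mul ?_ _
        have c1 := (h.lip_fst (mem_univ s)).continuousOn.aestronglyMeasurable
          (μ := volume) measurableSet_Icc
        have c2 := (h.lip_snd (mem_univ s)).continuousOn.aestronglyMeasurable
          (μ := volume) measurableSet_Icc
        have c3 := (h.lip_fst (mem_univ s')).continuousOn.aestronglyMeasurable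
          (μ := volume) measurableSet_Icc
        have c4 := (h.lip_snd (mem_univ s')).continuousOn.aestronglyMeasurable
          (μ := volume) measurableSet_Icc
        exact ((aestronglyMeasurable_clm_apply (c4.sub c2) (aestronglyMeasurable_deriv _ _)).sub
          (aestronglyMeasurable_clm_apply (aestronglyMeasurable_deriv _ _) (c3.sub c1))).sub
          ((h.energy_integrableOn (mem_univ s')).1.sub (h.energy_integrableOn (mem_univ s)).1)
      refine hm.congr ?_
      filter_upwards [h.ode s (mem_univ s)] with t h1
      obtain ⟨X, hX, hD, -⟩ := h1
      have e1 : deriv (fun t => (z t s).2) t = X.2 := (show HasDerivAt _ X.2 t from hX.snd).deriv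
      have e2 : deriv (fun t => (z t s).1) t = X.1 := (show HasDerivAt _ X.1 t from hX.fst).deriv
      simp only [hρ, hD, e1, e2, Prod.fst_sub, Prod.snd_sub]
    -- The dominating constant adds the bound `2K` on `dH` times `L` to the Lipschitz constant `(2K
    -- + 1) L` of the energy; differentiability of `H t` gives the pointwise limit.
    refine tendsto_integral_filter_of_dominated_convergence
      (fun _ => (2 * K * L + (2 * K + 1) * L : ℝ))
      (Eventually.of_forall hDm) ?_ (integrable_const _) ?_
    · filter_upwards [self_mem_nhdsWithin] with s' hne
      filter_upwards [h.norm_fderiv_le (mem_univ s), h.energy_lipschitz_curve hL,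
        ae_restrict_mem measurableSet_Icc] with t h1 h2 ht
      have h3 := h1 (z t s' - z t s)
      have h4 := h2.dist_le_mul s' s
      have h5 := hdiff t ht s'
      rw [Real.dist_eq, Real.dist_eq] at h4
      push_cast at h4
      rw [hρ, norm_mul, norm_inv, Real.norm_eq_abs, Real.norm_eq_abs,
        inv_mul_le_iff₀ (abs_pos.2 (sub_ne_zero.2 hne))]
      calc _ ≤ |fderiv ℝ (H t) (z t s) (z t s' - z t s)| + |H t (z t s') - H t (z t s)| :=
            abs_sub _ _
        _ ≤ 2 * K * (L * |s' - s|) + (2 * K + 1) * L * |s' - s| :=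
            add_le_add (h3.trans (by gcongr)) h4
        _ = _ := by ring
    · filter_upwards [h.diff, ae_restrict_mem measurableSet_Icc] with t h1 ht
      have hlo := (h1 s (mem_univ s)).hasFDerivAt.isLittleO
      have hlo2 := hlo.comp_tendsto (((hL t ht).continuous.tendsto s).mono_left
        (nhdsWithin_le_nhds (s := {s}ᶜ)))
      have hO : (fun s' => z t s' - z t s) =O[𝓝[≠] s] fun s' => s' - s :=
        Asymptotics.IsBigO.of_bound L (Eventually.of_forall fun s' => by
          simpa using hdiff t ht s')
      have hlo3 := hlo2.trans_isBigO hO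
      have := (Asymptotics.isLittleO_iff_tendsto' (by
        filter_upwards [self_mem_nhdsWithin] with s' hne h0
        exact absurd (sub_eq_zero.1 h0) hne)).1 hlo3
      have := this.neg
      rw [neg_zero] at this
      refine this.congr fun s' => ?_
      simp only [hρ, Function.comp]
      ring
  have := hW.add hR
  rw [add_zero] at this
  refine this.congr' ?_
  filter_upwards [self_mem_nhdsWithin] with s' hs' using (hslope s' hs').symm

/-- For almost every parameter `s`, the variation of the action along a curve of initial data
is given by the Liouville form, simultaneously for all times. -/
theorem hasDerivAt_action (h : CoordinateFlow a b univ K z H G)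
    (hL : ∀ t ∈ Icc a b, LipschitzWith L (z t)) :
    ∀ᵐ s : ℝ, ∀ t₀ ∈ Icc a b, ∀ t₁ ∈ Icc a b,
      HasDerivAt (fun s' => (∫ t in t₀..t₁, G t s') - (z t₁ s).2 (z t₁ s').1 +
        (z t₀ s).2 (z t₀ s').1) 0 s := by
  -- Rademacher on the strip, then Fubini with `s` as outer variable. The null set of `s` found here
  -- does not involve `t₀` and `t₁`, which is why they can be quantified after it.
  have hd : ∀ᵐ x : ℝ × ℝ, x ∈ Icc a b ×ˢ (univ : Set ℝ) →
      DifferentiableWithinAt ℝ (fun x : ℝ × ℝ => z x.1 x.2) (Icc a b ×ˢ univ) x :=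
    h.lip.ae_differentiableWithinAt_of_mem
  have hd2 : ∀ᵐ s : ℝ, ∀ᵐ t : ℝ, (t, s) ∈ Icc a b ×ˢ (univ : Set ℝ) →
      DifferentiableWithinAt ℝ (fun x : ℝ × ℝ => z x.1 x.2) (Icc a b ×ˢ univ) (t, s) := by
    have : ∀ᵐ x : ℝ × ℝ, (x.2, x.1) ∈ Icc a b ×ˢ (univ : Set ℝ) →
        DifferentiableWithinAt ℝ (fun x : ℝ × ℝ => z x.1 x.2) (Icc a b ×ˢ univ) (x.2, x.1) :=
      (Measure.measurePreserving_swap (μ := (volume : Measure ℝ))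
        (ν := (volume : Measure ℝ))).quasiMeasurePreserving.ae hd
    exact Measure.ae_ae_of_ae_prod this
  filter_upwards [hd2] with s hs
  have hs' : ∀ᵐ t ∂(volume.restrict (Icc a b)), DifferentiableAt ℝ (z t) s := by
    rw [ae_restrict_iff' measurableSet_Icc]
    filter_upwards [hs] with t ht hti
    have h1 := ht ⟨hti, mem_univ _⟩
    have h2 : DifferentiableAt ℝ (fun s' : ℝ => (t, s')) s := by fun_prop
    have h3 := DifferentiableWithinAt.comp (t := Icc a b ×ˢ univ) (s := univ) s h1 h2.differentiableWithinAt fun s' _ => ⟨hti, mem_univ _⟩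
    exact differentiableWithinAt_univ.1 h3
  have key : ∀ t₀ ∈ Icc a b, ∀ t₁ ∈ Icc a b, t₀ ≤ t₁ →
      HasDerivAt (fun s' => (∫ t in t₀..t₁, G t s') - (z t₁ s).2 (z t₁ s').1 +
        (z t₀ s).2 (z t₀ s').1) 0 s := fun t₀ h₀ t₁ h₁ hle =>
    (h.mono_interval h₀.1 h₁.2).hasDerivAt_action_at hle
      (fun t ht => hL t ⟨h₀.1.trans ht.1, ht.2.trans h₁.2⟩)
      (ae_mono (Measure.restrict_mono (Icc_subset_Icc h₀.1 h₁.2) le_rfl) hs')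
  intro t₀ h₀ t₁ h₁
  rcases le_total t₀ t₁ with hle | hle
  · exact key t₀ h₀ t₁ h₁ hle
  · have := (key t₁ h₁ t₀ h₀ hle).neg
    rw [neg_zero] at this
    refine this.congr_of_eventuallyEq (Eventually.of_forall fun s' => ?_)
    simp only [Pi.neg_apply]
    rw [intervalIntegral.integral_symm]
    ring

end Curve

end CoordinateFlow

/-! ### Primitives of the pulled back Liouville form in coordinates -/

section Primitive

variable {E : Type*} [NormedAddCommGroup E] [NormedSpace ℝ E]
  {F : Type*} [NormedAddCommGroup F] [NormedSpace ℝ F]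

open AffineMap (lineMap lineMap_apply_zero lineMap_apply_one)

/-- Along every segment in `B`, the derivative of `θ` is given by the pullback under `ζ` of the
Liouville form, almost everywhere. -/
def PrimitiveAlongSegments (B : Set F) (θ : F → ℝ) (ζ : F → E × (E →L[ℝ] ℝ)) : Prop :=
  ∀ u ∈ B, ∀ v ∈ B, ∀ᵐ s : ℝ, s ∈ Ioo (0 : ℝ) 1 →
    HasDerivAt (fun s' => θ (lineMap u v s') -
      (ζ (lineMap u v s)).2 (ζ (lineMap u v s')).1) 0 s

theorem lineMap_mem_of_convex {B : Set F} (hB : Convex ℝ B) {u v : F} (hu : u ∈ B) (hv : v ∈ B)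
    {s : ℝ} (hs : s ∈ Icc (0 : ℝ) 1) : lineMap u v s ∈ B :=
  hB.segment_subset hu hv (by
    rw [segment_eq_image_lineMap]
    exact mem_image_of_mem _ hs)

/-- The segment from `u` to `v`, stopped at its end points. -/
noncomputable def clampedSegment (u v : F) (s : ℝ) : F := lineMap u v (projIcc (0 : ℝ) 1 zero_le_one s : ℝ)

theorem clampedSegment_mem {B : Set F} (hB : Convex ℝ B) {u v : F} (hu : u ∈ B) (hv : v ∈ B)
    (s : ℝ) : clampedSegment u v s ∈ B :=
  lineMap_mem_of_convex hB hu hv (projIcc (0 : ℝ) 1 zero_le_one s).2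

theorem clampedSegment_eq {u v : F} {s : ℝ} (hs : s ∈ Icc (0 : ℝ) 1) :
    clampedSegment u v s = lineMap u v s := by
  simp [clampedSegment, projIcc_of_mem zero_le_one hs]

theorem lipschitzWith_clampedSegment (u v : F) : LipschitzWith (nndist u v) (clampedSegment u v) := by
  have h1 : LipschitzWith (nndist u v) (lineMap u v : ℝ → F) := lipschitzWith_lineMap u v
  have h2 : LipschitzWith 1 (fun s : ℝ => (projIcc (0 : ℝ) 1 zero_le_one s : ℝ)) := by
    rw [← one_mul (1 : ℝ≥0)]
    exact (LipschitzWith.subtype_val (Icc (0 : ℝ) 1)).comp (LipschitzWith.projIcc zero_le_one)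
  rw [← mul_one (nndist u v)]
  exact h1.comp h2

/-- A primitive along segments satisfies a quadratic Taylor estimate. -/
theorem PrimitiveAlongSegments.abs_sub_le {B : Set F} (hB : Convex ℝ B) {θ : F → ℝ}
    {ζ : F → E × (E →L[ℝ] ℝ)} (h : PrimitiveAlongSegments B θ ζ) {K D : ℝ≥0}
    (hζ : LipschitzOnWith K ζ B) (hθ : LipschitzOnWith D θ B) {u v : F} (hu : u ∈ B) (hv : v ∈ B) :
    |θ v - θ u - (ζ u).2 ((ζ v).1 - (ζ u).1)| ≤ K ^ 2 * dist u v ^ 2 := by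
  set γ : ℝ → F := fun s => lineMap u v s with hγ
  have hmem : ∀ s ∈ Icc (0 : ℝ) 1, γ s ∈ B := fun s hs => lineMap_mem_of_convex hB hu hv hs
  have hγd : ∀ s s', dist (γ s) (γ s') = dist s s' * dist u v := fun s s' =>
    dist_lineMap_lineMap u v s s'
  have hx : ∀ s ∈ Icc (0 : ℝ) 1, ∀ s' ∈ Icc (0 : ℝ) 1,
      ‖(ζ (γ s')).1 - (ζ (γ s)).1‖ ≤ K * dist u v * |s' - s| := fun s hs s' hs' => by
    have h1 := hζ.dist_le_mul _ (hmem s' hs') _ (hmem s hs)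
    rw [hγd, dist_eq_norm, Real.dist_eq] at h1
    calc _ ≤ ‖ζ (γ s') - ζ (γ s)‖ := norm_fst_le (ζ (γ s') - ζ (γ s))
      _ ≤ _ := h1.trans_eq (by ring)
  -- With the momentum frozen at `u`, an infinitesimal increment of `V` is the momentum difference
  -- between `γ s` and `u` applied to the increment of position. Each factor is at most `K * dist u
  -- v`, per unit of `s` for the second; the slack `ε` absorbs the remainder of the derivative.
  set V : ℝ → ℝ := fun s => θ (γ s) - (ζ u).2 (ζ (γ s)).1 with hV
  suffices hsuff : ∀ ε : ℝ≥0, 0 < ε → |V 1 - V 0| ≤ K ^ 2 * dist u v ^ 2 + ε by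
    have h0 : V 1 - V 0 = θ v - θ u - (ζ u).2 ((ζ v).1 - (ζ u).1) := by
      simp only [hV, hγ, lineMap_apply_one, lineMap_apply_zero, map_sub]
      ring
    rw [← h0]
    refine le_of_forall_pos_le_add fun ε hε => ?_
    exact hsuff ⟨ε, hε.le⟩ hε
  intro ε hε
  have key := abs_sub_le_of_ae_eventually_le (f := V) zero_le_one
    (K ^ 2 * nndist u v ^ 2 + ε) (fun s hs => ?_) ?_
  · simpa using key
  · refine ⟨D * dist u v + ‖(ζ u).2‖ * (K * dist u v), ?_⟩
    filter_upwards [self_mem_nhdsWithin] with s' hs'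
    have h1 := hθ.dist_le_mul _ (hmem s' hs') _ (hmem s hs)
    rw [hγd, Real.dist_eq, Real.dist_eq] at h1
    have e : V s' - V s = (θ (γ s') - θ (γ s)) - (ζ u).2 ((ζ (γ s')).1 - (ζ (γ s)).1) := by
      simp only [hV, map_sub]
      ring
    rw [e]
    calc _ ≤ |θ (γ s') - θ (γ s)| + |(ζ u).2 ((ζ (γ s')).1 - (ζ (γ s)).1)| := abs_sub _ _
      _ ≤ D * (|s' - s| * dist u v) + ‖(ζ u).2‖ * (K * dist u v * |s' - s|) := by
          refine add_le_add h1 (((ζ u).2.le_opNorm _).trans ?_)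
          gcongr
          exact hx s hs s' hs'
      _ = _ := by ring
  · have hend : ∀ᵐ s : ℝ, s ≠ 0 ∧ s ≠ 1 := by
      have h0 : ∀ᵐ s : ℝ, s ≠ 0 := by simp [ae_iff, measure_singleton]
      have h1 : ∀ᵐ s : ℝ, s ≠ 1 := by simp [ae_iff, measure_singleton]
      exact h0.and h1
    filter_upwards [h u hu v hv, hend] with s hs hne hsI
    have hso : s ∈ Ioo (0 : ℝ) 1 :=
      ⟨lt_of_le_of_ne hsI.1 (Ne.symm hne.1), lt_of_le_of_ne hsI.2 hne.2⟩
    have hlo := (hs hso).hasFDerivAt.isLittleO.def (show (0 : ℝ) < ε from hε)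
    filter_upwards [self_mem_nhdsWithin, hlo.filter_mono nhdsWithin_le_nhds] with s' hs' h1
    simp only [ContinuousLinearMap.toSpanSingleton_apply, smul_zero, sub_zero,
      Real.norm_eq_abs] at h1
    have e : V s' - V s = (θ (γ s') - (ζ (γ s)).2 (ζ (γ s')).1 -
        (θ (γ s) - (ζ (γ s)).2 (ζ (γ s)).1)) +
        ((ζ (γ s)).2 - (ζ u).2) ((ζ (γ s')).1 - (ζ (γ s)).1) := by
      simp only [hV, map_sub, sub_apply]
      ring
    have hp2 := ((ζ (γ s)).2 - (ζ u).2).le_opNorm ((ζ (γ s')).1 - (ζ (γ s)).1)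
    have hp : ‖(ζ (γ s)).2 - (ζ u).2‖ ≤ K * dist u v := by
      have h2 := hζ.dist_le_mul _ (hmem s hsI) _ hu
      have h3 : dist (γ s) u ≤ dist u v := by
        have := hγd s 0
        simp only [hγ, lineMap_apply_zero, Real.dist_eq, sub_zero] at this
        simp only [hγ, this, abs_of_nonneg hsI.1]
        exact mul_le_of_le_one_left dist_nonneg hsI.2
      rw [dist_eq_norm] at h2
      calc _ ≤ ‖ζ (γ s) - ζ u‖ := norm_snd_le (ζ (γ s) - ζ u)
        _ ≤ K * dist (γ s) u := h2
        _ ≤ _ := by gcongr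
    rw [e]
    push_cast
    calc _ ≤ _ := abs_add_le _ _
      _ ≤ ε * |s' - s| + (K * dist u v) * (K * dist u v * |s' - s|) := by
          refine add_le_add h1 (hp2.trans ?_)
          gcongr
          exact hx s hsI s' hs'
      _ = _ := by ring

namespace CoordinateFlow

variable {a b : ℝ} {B : Set F} {K : ℝ≥0} {z : ℝ → F → E × (E →L[ℝ] ℝ)}
  {H : ℝ → E × (E →L[ℝ] ℝ) → ℝ} {G : ℝ → F → ℝ}

variable [FiniteDimensional ℝ E]

/-- Being a primitive along segments is preserved by the flow. -/
theorem primitiveAlongSegments (h : CoordinateFlow a b B K z H G) (hB : Convex ℝ B)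
    {θ : ℝ → F → ℝ} (hθ : ∀ t₀ ∈ Icc a b, ∀ t₁ ∈ Icc a b, ∀ u ∈ B,
      θ t₁ u - θ t₀ u = ∫ t in t₀..t₁, G t u) {t₀ t₁ : ℝ} (h₀ : t₀ ∈ Icc a b) (h₁ : t₁ ∈ Icc a b)
    (hP : PrimitiveAlongSegments B (θ t₀) (z t₀)) : PrimitiveAlongSegments B (θ t₁) (z t₁) := by
  intro u hu v hv
  have hmem := clampedSegment_mem hB hu hv
  have hc := h.comp_curve (lipschitzWith_clampedSegment u v) hmem
  have hL : ∀ t ∈ Icc a b, LipschitzWith (K * nndist u v) (fun s => z t (clampedSegment u v s)) :=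
    fun t ht => lipschitzOnWith_univ.1 ((h.lip_param ht).comp
      (lipschitzWith_clampedSegment u v).lipschitzOnWith fun s _ => hmem s)
  filter_upwards [hc.hasDerivAt_action hL, hP u hu v hv] with s h2 h3 hs
  -- The boundary term at `t₀` in the variation of the action cancels the one in the hypothesis,
  -- leaving the term at `t₁`.
  have h4 := (h2 t₀ h₀ t₁ h₁).add (h3 hs)
  rw [add_zero] at h4
  refine h4.congr_of_eventuallyEq ?_
  filter_upwards [isOpen_Ioo.mem_nhds hs] with s' hs'
  simp only [clampedSegment_eq (Ioo_subset_Icc_self hs), clampedSegment_eq (Ioo_subset_Icc_self hs'),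
    Pi.add_apply, ← hθ t₀ h₀ t₁ h₁ _ (lineMap_mem_of_convex hB hu hv (Ioo_subset_Icc_self hs'))]
  ring

variable [FiniteDimensional ℝ F]

theorem exists_countable_dense_subset (hBo : IsOpen B) :
    ∃ D ⊆ B, D.Countable ∧ B ⊆ closure D := by
  obtain ⟨D, hDc, hDd⟩ := TopologicalSpace.exists_countable_dense F
  exact ⟨B ∩ D, inter_subset_left, hDc.mono inter_subset_right, hDd.open_subset_closure_inter hBo⟩

/-- The energy is Lipschitz in the initial data, uniformly in almost every time. -/
theorem energy_lipschitz (h : CoordinateFlow a b B K z H G) (hB : Convex ℝ B) (hBo : IsOpen B)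
    (hB1 : ∀ u ∈ B, ∀ v ∈ B, dist u v ≤ 1) :
    ∀ᵐ t ∂(volume.restrict (Icc a b)),
      LipschitzOnWith ((2 * K + 1) * K) (fun u => H t (z t u)) B := by
  obtain ⟨D, hDB, hDc, hDd⟩ := exists_countable_dense_subset hBo
  have hpair : ∀ u ∈ D, ∀ v ∈ D, ∀ᵐ t ∂(volume.restrict (Icc a b)),
      dist (H t (z t u)) (H t (z t v)) ≤ ((2 * K + 1) * K : ℝ≥0) * dist u v := by
    intro u hu v hv
    have hmem := clampedSegment_mem hB (hDB hu) (hDB hv)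
    have hc := h.comp_curve (lipschitzWith_clampedSegment u v) hmem
    have hL : ∀ t ∈ Icc a b,
        LipschitzWith (K * nndist u v) (fun s => z t (clampedSegment u v s)) :=
      fun t ht => lipschitzOnWith_univ.1 ((h.lip_param ht).comp
        (lipschitzWith_clampedSegment u v).lipschitzOnWith fun s _ => hmem s)
    -- Since `B` has diameter at most one, the segment does not enlarge the constant in time, and
    -- the length of the segment enters only once.
    have hmax : max 1 (nndist u v) = 1 := max_eq_left (by
      rw [← NNReal.coe_le_coe, coe_nndist]
      exact hB1 u (hDB hu) v (hDB hv))
    rw [hmax, mul_one] at hc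
    filter_upwards [hc.energy_lipschitz_curve hL] with t ht
    have := ht.dist_le_mul 0 1
    simp only [clampedSegment_eq (left_mem_Icc.2 (zero_le_one' ℝ)),
      clampedSegment_eq (right_mem_Icc.2 (zero_le_one' ℝ)), lineMap_apply_zero,
      lineMap_apply_one] at this
    refine this.trans_eq ?_
    simp
    ring
  -- The countably many pairs from `D` share one null set of times; continuity of the energy extends
  -- the bound to `B`.
  have hall : ∀ᵐ t ∂(volume.restrict (Icc a b)), ∀ u ∈ D, ∀ v ∈ D,
      dist (H t (z t u)) (H t (z t v)) ≤ ((2 * K + 1) * K : ℝ≥0) * dist u v :=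
    (ae_ball_iff hDc).2 fun u hu => (ae_ball_iff hDc).2 fun v hv => hpair u hu v hv
  filter_upwards [hall, h.diff, ae_restrict_mem measurableSet_Icc] with t ht hd htI
  have hcont : ContinuousOn (fun u => H t (z t u)) B := fun u hu =>
    (hd u hu).continuousAt.comp_continuousWithinAt ((h.lip_param htI).continuousOn u hu)
  refine LipschitzOnWith.of_dist_le_mul fun u hu v hv => ?_
  obtain ⟨x, hx, hxu⟩ := mem_closure_iff_seq_limit.1 (hDd hu)
  obtain ⟨y, hy, hyv⟩ := mem_closure_iff_seq_limit.1 (hDd hv)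
  have h1 := (hcont u hu).tendsto.comp (tendsto_nhdsWithin_iff.2
    ⟨hxu, Eventually.of_forall fun n => hDB (hx n)⟩)
  have h2 := (hcont v hv).tendsto.comp (tendsto_nhdsWithin_iff.2
    ⟨hyv, Eventually.of_forall fun n => hDB (hy n)⟩)
  exact le_of_tendsto_of_tendsto' (h1.dist h2) ((hxu.dist hyv).const_mul _)
    fun n => ht _ (hx n) _ (hy n)

/-- For almost every time, all initial data are Lebesgue points of the energy in time. -/
theorem hasDerivAt_integral_energy (h : CoordinateFlow a b B K z H G) (hab : a ≤ b)
    (hB : Convex ℝ B) (hBo : IsOpen B) (hB1 : ∀ u ∈ B, ∀ v ∈ B, dist u v ≤ 1) :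
    ∀ᵐ t, t ∈ Icc a b → ∀ u ∈ B,
      HasDerivAt (fun t' => ∫ τ in a..t', H τ (z τ u)) (H t (z t u)) t := by
  obtain ⟨D, hDB, hDc, hDd⟩ := exists_countable_dense_subset hBo
  have hii : ∀ u ∈ B, IntervalIntegrable (fun τ => H τ (z τ u)) volume a b := fun u hu =>
    (intervalIntegrable_iff_integrableOn_Icc_of_le hab).2 (h.energy_integrableOn hu)
  have hii2 : ∀ u ∈ B, ∀ s ∈ Icc a b, ∀ s' ∈ Icc a b,
      IntervalIntegrable (fun τ => H τ (z τ u)) volume s s' := fun u hu s hs s' hs' =>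
    (hii u hu).mono_set (by
      rw [uIcc_of_le hab]
      exact uIcc_subset_Icc hs hs')
  have hall : ∀ᵐ t, ∀ u ∈ D, t ∈ uIcc a b →
      HasDerivAt (fun t' => ∫ τ in a..t', H τ (z τ u)) (H t (z t u)) t :=
    (ae_ball_iff hDc).2 fun u hu => by
      filter_upwards [(hii u (hDB hu)).ae_hasDerivAt_integral] with t ht hti
      exact ht hti a left_mem_uIcc
  set C : ℝ≥0 := (2 * K + 1) * K with hC
  have hlip := h.energy_lipschitz hB hBo hB1
  have hlip' := hlip
  rw [ae_restrict_iff' measurableSet_Icc] at hlip'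
  have hend : ∀ᵐ t : ℝ, t ≠ a ∧ t ≠ b := by
    have h0 : ∀ᵐ s : ℝ, s ≠ a := by simp [ae_iff, measure_singleton]
    have h1 : ∀ᵐ s : ℝ, s ≠ b := by simp [ae_iff, measure_singleton]
    exact h0.and h1
  filter_upwards [hall, hlip', hend] with t ht hLt hne htI u hu
  have hto : t ∈ Ioo a b := ⟨lt_of_le_of_ne htI.1 (Ne.symm hne.1), lt_of_le_of_ne htI.2 hne.2⟩
  rw [hasDerivAt_iff_isLittleO, Asymptotics.isLittleO_iff]
  intro ε hε
  -- A point of the countable dense set so close to `u` that exchanging the two costs at most `ε /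
  -- 3` per unit of time, both in the integral and in the value at `t`.
  obtain ⟨d, hd, hdu⟩ := Metric.mem_closure_iff.1 (hDd hu) (ε / (3 * (C + 1))) (by positivity)
  have hCd : C * dist u d ≤ ε / 3 := by
    calc C * dist u d ≤ (C + 1) * (ε / (3 * (C + 1))) := by gcongr; linarith
      _ = ε / 3 := by field_simp
  have h1 := (hasDerivAt_iff_isLittleO.1 (ht d hd (by rwa [uIcc_of_le hab]))).def
    (show 0 < ε / 3 by positivity)
  filter_upwards [h1, isOpen_Ioo.mem_nhds hto] with t' h2 ht'
  have ht'I := Ioo_subset_Icc_self ht'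
  have hdiffI : ∀ w ∈ B, (∫ τ in a..t', H τ (z τ w)) - ∫ τ in a..t, H τ (z τ w) =
      ∫ τ in t..t', H τ (z τ w) := fun w hw =>
    intervalIntegral.integral_interval_sub_left (hii2 w hw a (left_mem_Icc.2 hab) t' ht'I)
      (hii2 w hw a (left_mem_Icc.2 hab) t htI)
  rw [hdiffI u hu]
  rw [hdiffI d (hDB hd)] at h2
  have h3 : ‖(∫ τ in t..t', H τ (z τ u)) - ∫ τ in t..t', H τ (z τ d)‖ ≤
      C * dist u d * |t' - t| := by
    rw [← intervalIntegral.integral_sub (hii2 u hu t htI t' ht'I)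
      (hii2 d (hDB hd) t htI t' ht'I)]
    refine intervalIntegral.norm_integral_le_of_norm_le_const_ae ?_
    filter_upwards [hlip'] with τ hτ hτI
    exact (hτ (uIcc_subset_Icc htI ht'I (uIoc_subset_uIcc hτI))).dist_le_mul u hu d (hDB hd)
  have h4 : ‖H t (z t u) - H t (z t d)‖ ≤ C * dist u d :=
    (hLt htI).dist_le_mul u hu d (hDB hd)
  have e : (∫ τ in t..t', H τ (z τ u)) - (t' - t) • H t (z t u) =
      ((∫ τ in t..t', H τ (z τ u)) - ∫ τ in t..t', H τ (z τ d)) +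
      ((∫ τ in t..t', H τ (z τ d)) - (t' - t) • H t (z t d)) -
      (t' - t) • (H t (z t u) - H t (z t d)) := by
    simp only [smul_eq_mul]
    ring
  rw [e]
  calc _ ≤ _ := norm_sub_le _ _
    _ ≤ C * dist u d * |t' - t| + ε / 3 * |t' - t| + |t' - t| * (C * dist u d) := by
        refine add_le_add ((norm_add_le _ _).trans (add_le_add h3 h2)) ?_
        rw [norm_smul, Real.norm_eq_abs]
        gcongr
    _ ≤ ε / 3 * |t' - t| + ε / 3 * |t' - t| + |t' - t| * (ε / 3) := by gcongr
    _ = ε * ‖t' - t‖ := by rw [Real.norm_eq_abs]; ring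

end CoordinateFlow

end Primitive

/-! ### Differentiability of the action jointly in time and initial data. -/

namespace CoordinateFlow

section Action

variable {E : Type*} [NormedAddCommGroup E] [NormedSpace ℝ E] [FiniteDimensional ℝ E]
  {F : Type*} [NormedAddCommGroup F] [NormedSpace ℝ F] [FiniteDimensional ℝ F]
  {a b : ℝ} {B : Set F} {K : ℝ≥0} {z : ℝ → F → E × (E →L[ℝ] ℝ)}
  {H : ℝ → E × (E →L[ℝ] ℝ) → ℝ} {G : ℝ → F → ℝ} {θ : ℝ → F → ℝ}

omit [NormedSpace ℝ F] [FiniteDimensional ℝ F] in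
-- Almost everywhere along a trajectory `G + H = p ẋ`. Freezing `p` at an intermediate time `t₀`
-- leaves `(p τ - p t₀) ẋ`, at most `K |s' - s| * K`.
theorem abs_integral_density_le (h : CoordinateFlow a b B K z H G) {u : F} (hu : u ∈ B)
    {s s' t₀ : ℝ} (hs : s ∈ Icc a b) (hs' : s' ∈ Icc a b) (ht₀ : t₀ ∈ uIcc s s') :
    |(∫ τ in s..s', G τ u) + (∫ τ in s..s', H τ (z τ u)) -
      (z t₀ u).2 ((z s' u).1 - (z s u).1)| ≤ K ^ 2 * |s' - s| ^ 2 := by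
  wlog hle : s ≤ s' generalizing s s'
  · have := this hs' hs (uIcc_comm s s' ▸ ht₀) (le_of_not_ge hle)
    rw [← abs_neg, abs_sub_comm s' s]
    convert this using 2
    rw [intervalIntegral.integral_symm s' s, intervalIntegral.integral_symm s' s, map_sub, map_sub]
    ring
  rw [uIcc_of_le hle] at ht₀
  have ht₀I : t₀ ∈ Icc a b := ⟨hs.1.trans ht₀.1, ht₀.2.trans hs'.2⟩
  have hr := h.mono_interval hs.1 hs'.2
  obtain ⟨hI, hE⟩ := integral_deriv_clm_apply hle
    ((LipschitzWith.const (z t₀ u).2).lipschitzOnWith (s := Icc s s')) (hr.lip_fst hu)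
  have hG : IntervalIntegrable (fun τ => G τ u) volume s s' :=
    (intervalIntegrable_iff_integrableOn_Icc_of_le hle).2 (hr.intervalIntegrable_density hu)
  have hH : IntervalIntegrable (fun τ => H τ (z τ u)) volume s s' :=
    (intervalIntegrable_iff_integrableOn_Icc_of_le hle).2 (hr.energy_integrableOn hu)
  rw [map_sub, ← hE, ← intervalIntegral.integral_add hG hH,
    ← intervalIntegral.integral_sub (hG.add hH) hI]
  have hb : ∀ᵐ τ, τ ∈ uIoc s s' → ‖G τ u + H τ (z τ u) - (deriv (fun _ => (z t₀ u).2) τ (z τ u).1 +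
      (z t₀ u).2 (deriv (fun t => (z t u).1) τ))‖ ≤ K ^ 2 * |s' - s| := by
    refine ae_uIoc_of_ae_restrict_Icc hle ?_
    filter_upwards [hr.energy_ae_eq hu, (hr.lip_fst hu).ae_differentiableAt_Icc,
      ae_restrict_mem measurableSet_Icc] with τ h1 h2 hτ
    have hτI : τ ∈ Icc a b := ⟨hs.1.trans hτ.1, hτ.2.trans hs'.2⟩
    have e : G τ u + H τ (z τ u) - (deriv (fun _ => (z t₀ u).2) τ (z τ u).1 +
      (z t₀ u).2 (deriv (fun t => (z t u).1) τ)) =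
        ((z τ u).2 - (z t₀ u).2) (deriv (fun t => (z t u).1) τ) := by
      rw [h1, deriv_const]
      simp
    have h3 := (h.lip_snd hu).dist_le_mul τ hτI t₀ ht₀I
    rw [dist_eq_norm, Real.dist_eq] at h3
    have h4 : |τ - t₀| ≤ |s' - s| := by
      rw [abs_of_nonneg (sub_nonneg.2 hle), abs_le]
      constructor <;> linarith [hτ.1, hτ.2, ht₀.1, ht₀.2]
    rw [e]
    calc _ ≤ _ := ContinuousLinearMap.le_opNorm _ _
      _ ≤ (K * |τ - t₀|) * K := mul_le_mul h3 h2.2 (norm_nonneg _) (by positivity)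
      _ ≤ (K * |s' - s|) * K := by gcongr
      _ = _ := by ring
  refine (intervalIntegral.norm_integral_le_of_norm_le_const_ae hb).trans_eq ?_
  ring

variable (h : CoordinateFlow a b B K z H G)
  (hθ : ∀ t₀ ∈ Icc a b, ∀ t₁ ∈ Icc a b, ∀ u ∈ B, θ t₁ u - θ t₀ u = ∫ t in t₀..t₁, G t u)
  {C : ℝ≥0} (hQ : ∀ t ∈ Icc a b, ∀ u ∈ B, ∀ v ∈ B,
    |θ t v - θ t u - (z t u).2 ((z t v).1 - (z t u).1)| ≤ C * dist u v ^ 2)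

omit [FiniteDimensional ℝ E] [NormedSpace ℝ F] [FiniteDimensional ℝ F] in
include h in
theorem abs_mixed_le {t t' : ℝ} (ht : t ∈ Icc a b) (ht' : t' ∈ Icc a b) {u u' : F} (hu : u ∈ B)
    (hu' : u' ∈ B) : |((z t' u).2 - (z t u).2) ((z t' u').1 - (z t' u).1)| ≤
      K ^ 2 * |t' - t| * dist u u' := by
  have h1 := (h.lip_snd hu).dist_le_mul t' ht' t ht
  have h2 := (h.lip_param ht').dist_le_mul u' hu' u hu
  rw [dist_eq_norm, Real.dist_eq] at h1
  rw [dist_eq_norm, dist_comm] at h2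
  calc _ ≤ _ := ((z t' u).2 - (z t u).2).le_opNorm ((z t' u').1 - (z t' u).1)
    _ ≤ (K * |t' - t|) * (K * dist u u') := by
        gcongr
        exact (norm_fst_le (z t' u' - z t' u)).trans h2
    _ = _ := by ring

include hθ hQ

omit [FiniteDimensional ℝ E] [NormedSpace ℝ F] [FiniteDimensional ℝ F] in
include h in
/-- At every point, the action is approximated by the Liouville form, up to a term of first order
in time. -/
theorem abs_action_sub_le (hB1 : ∀ u ∈ B, ∀ v ∈ B, dist u v ≤ 1) {t : ℝ}
    (ht : t ∈ Icc a b) {u : F} (hu : u ∈ B) : ∃ D : ℝ, ∀ t' ∈ Icc a b, ∀ u' ∈ B,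
      |θ t' u' - θ t u - (z t u).2 ((z t' u').1 - (z t u).1)| ≤
        D * (dist u u' ^ 2 + |t' - t|) := by
  obtain ⟨A, hA⟩ := h.bdd u hu
  -- No cancellation is used in the time direction, so exceptional times are allowed: `|A|` bounds
  -- the increment of `θ`, `‖p‖ K` that of `p x`, and `K ^ 2` the mixed term, where `dist u u' ≤ 1`.
  refine ⟨C + (|A| + ‖(z t u).2‖ * K + K ^ 2), fun t' ht' u' hu' => ?_⟩
  have e : θ t' u' - θ t u - (z t u).2 ((z t' u').1 - (z t u).1) =
      (θ t' u' - θ t' u - (z t' u).2 ((z t' u').1 - (z t' u).1)) + (∫ τ in t..t', G τ u) +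
      ((z t' u).2 - (z t u).2) ((z t' u').1 - (z t' u).1) -
      (z t u).2 ((z t' u).1 - (z t u).1) := by
    rw [← hθ t ht t' ht' u hu]
    simp only [map_sub, sub_apply]
    ring
  have h1 := hQ t' ht' u hu u' hu'
  have h2 := h.abs_mixed_le ht ht' hu hu'
  have h3 : |∫ τ in t..t', G τ u| ≤ |A| * |t' - t| := by
    rw [ae_restrict_iff' measurableSet_Icc] at hA
    rw [← Real.norm_eq_abs (∫ τ in t..t', G τ u)]
    refine intervalIntegral.norm_integral_le_of_norm_le_const_ae ?_
    filter_upwards [hA] with τ hτ hτI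
    exact (hτ (uIcc_subset_Icc ht ht' (uIoc_subset_uIcc hτI))).trans (le_abs_self A)
  have h4 : |(z t u).2 ((z t' u).1 - (z t u).1)| ≤ ‖(z t u).2‖ * K * |t' - t| := by
    have := (h.lip_fst hu).dist_le_mul t' ht' t ht
    rw [dist_eq_norm (z t' u).1, Real.dist_eq] at this
    rw [mul_assoc]
    exact ((z t u).2.le_opNorm ((z t' u).1 - (z t u).1)).trans (by gcongr)
  have h5 : K ^ 2 * |t' - t| * dist u u' ≤ K ^ 2 * |t' - t| :=
    mul_le_of_le_one_right (by positivity) (hB1 u hu u' hu')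
  have h6 : 0 ≤ (C : ℝ) * |t' - t| := by positivity
  have h7 : 0 ≤ (|A| + ‖(z t u).2‖ * K + K ^ 2) * dist u u' ^ 2 := by positivity
  rw [e]
  calc _ ≤ |θ t' u' - θ t' u - (z t' u).2 ((z t' u').1 - (z t' u).1)| + |∫ τ in t..t', G τ u| +
        |((z t' u).2 - (z t u).2) ((z t' u').1 - (z t' u).1)| +
        |(z t u).2 ((z t' u).1 - (z t u).1)| :=
          (abs_sub _ _).trans (add_le_add ((abs_add_le _ _).trans
            (add_le_add (abs_add_le _ _) le_rfl)) le_rfl)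
    _ ≤ _ := by nlinarith

include h in
/-- For almost every time, the differential of the action is the pullback of the Cartan form. -/
theorem hasFDerivAt_action (hab : a ≤ b) (hB : Convex ℝ B) (hBo : IsOpen B)
    (hB1 : ∀ u ∈ B, ∀ v ∈ B, dist u v ≤ 1) :
    ∀ᵐ t, t ∈ Ioo a b → ∀ u ∈ B, HasFDerivAt (fun x : ℝ × F =>
      θ x.1 x.2 - (z t u).2 (z x.1 x.2).1 + H t (z t u) * x.1) (0 : ℝ × F →L[ℝ] ℝ) (t, u) := by
  -- A good time is a Lebesgue point of the energy for every `u ∈ B`. The exceptional set is thus a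
  -- null set of times, independent of `u`, and the treatment of curves relies on this.
  filter_upwards [h.hasDerivAt_integral_energy hab hB hBo hB1] with t hE htI u hu
  have ht := Ioo_subset_Icc_self htI
  have hii : IntervalIntegrable (fun τ => H τ (z τ u)) volume a b :=
    (intervalIntegrable_iff_integrableOn_Icc_of_le hab).2 (h.energy_integrableOn hu)
  have hii2 : ∀ s ∈ Icc a b, IntervalIntegrable (fun τ => H τ (z τ u)) volume a s :=
    fun s hs => hii.mono_set (by
      rw [uIcc_of_le hab]
      exact uIcc_subset_Icc (left_mem_Icc.2 hab) hs)
  refine HasFDerivAt.of_isLittleO ?_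
  rw [Asymptotics.isLittleO_iff]
  intro ε hε
  have h1 := (hasDerivAt_iff_isLittleO.1 (hE ht u hu)).def (show 0 < ε / 2 by positivity)
  set δ : ℝ := ε / (2 * (C + 2 * K ^ 2 + 1)) with hδ
  have hδ0 : 0 < δ := by positivity
  have hδε : (C + 2 * K ^ 2) * δ ≤ ε / 2 := by
    calc (C + 2 * K ^ 2) * δ ≤ (C + 2 * K ^ 2 + 1) * δ :=
          mul_le_mul_of_nonneg_right (by linarith) hδ0.le
      _ = ε / 2 := by rw [hδ]; field_simp
  have hn1 : ∀ᶠ x : ℝ × F in 𝓝 (t, u), x.1 ∈ Ioo a b :=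
    continuous_fst.continuousAt.eventually (isOpen_Ioo.mem_nhds htI)
  have hn2 : ∀ᶠ x : ℝ × F in 𝓝 (t, u), x.2 ∈ B :=
    continuous_snd.continuousAt.eventually (hBo.mem_nhds hu)
  have hn3 : ∀ᶠ x : ℝ × F in 𝓝 (t, u), ‖x - (t, u)‖ < δ := by
    filter_upwards [Metric.ball_mem_nhds (t, u) hδ0] with x hx
    rwa [← dist_eq_norm]
  have hn4 := (continuous_fst (X := ℝ) (Y := F)).continuousAt (x := (t, u)) |>.eventually h1
  filter_upwards [hn1, hn2, hn3, hn4] with x hx1 hx2 hx3 hx4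
  obtain ⟨t', u'⟩ := x
  simp only at hx1 hx2 hx4 ⊢
  have ht' := Ioo_subset_Icc_self hx1
  set N : ℝ := ‖((t', u') : ℝ × F) - (t, u)‖ with hN
  have hN0 : 0 ≤ N := norm_nonneg _
  have hNt : |t' - t| ≤ N := norm_fst_le (((t', u') : ℝ × F) - (t, u))
  have hNu : dist u u' ≤ N := by
    rw [dist_comm, dist_eq_norm]
    exact norm_snd_le (((t', u') : ℝ × F) - (t, u))
  have hdiffI : (∫ τ in a..t', H τ (z τ u)) - ∫ τ in a..t, H τ (z τ u) =
      ∫ τ in t..t', H τ (z τ u) :=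
    intervalIntegral.integral_interval_sub_left (hii2 t' ht') (hii2 t ht)
  rw [hdiffI] at hx4
  -- The four terms are the Taylor error in the initial data at time `t'`, the mixed increment, the
  -- Taylor error in time with the energy added, and the Lebesgue point error. The first three are
  -- quadratic and the last is `o(|t' - t|)`.
  have e : θ t' u' - (z t u).2 (z t' u').1 + H t (z t u) * t' -
      (θ t u - (z t u).2 (z t u).1 + H t (z t u) * t) -
        (0 : ℝ × F →L[ℝ] ℝ) (((t', u') : ℝ × F) - (t, u)) =
      (θ t' u' - θ t' u - (z t' u).2 ((z t' u').1 - (z t' u).1)) +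
      ((z t' u).2 - (z t u).2) ((z t' u').1 - (z t' u).1) +
      ((∫ τ in t..t', G τ u) + (∫ τ in t..t', H τ (z τ u)) -
        (z t u).2 ((z t' u).1 - (z t u).1)) -
      ((∫ τ in t..t', H τ (z τ u)) - (t' - t) • H t (z t u)) := by
    rw [← hθ t ht t' ht' u hu]
    simp only [map_sub, sub_apply, zero_apply, smul_eq_mul]
    ring
  have b1 := hQ t' ht' u hu u' hx2
  have b2 := h.abs_mixed_le ht ht' hu hx2
  have b3 := h.abs_integral_density_le hu ht ht' (left_mem_uIcc (a := t) (b := t'))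
  rw [e, Real.norm_eq_abs]
  calc _ ≤ |θ t' u' - θ t' u - (z t' u).2 ((z t' u').1 - (z t' u).1)| +
        |((z t' u).2 - (z t u).2) ((z t' u').1 - (z t' u).1)| +
        |(∫ τ in t..t', G τ u) + (∫ τ in t..t', H τ (z τ u)) -
          (z t u).2 ((z t' u).1 - (z t u).1)| +
        |(∫ τ in t..t', H τ (z τ u)) - (t' - t) • H t (z t u)| :=
          (abs_sub _ _).trans (add_le_add ((abs_add_le _ _).trans
            (add_le_add (abs_add_le _ _) le_rfl)) le_rfl)
    _ ≤ C * dist u u' ^ 2 + K ^ 2 * |t' - t| * dist u u' + K ^ 2 * |t' - t| ^ 2 +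
        ε / 2 * |t' - t| := add_le_add (add_le_add (add_le_add b1 b2) b3) hx4
    _ ≤ C * N ^ 2 + K ^ 2 * N * N + K ^ 2 * N ^ 2 + ε / 2 * N := by gcongr
    _ = (C + 2 * K ^ 2) * N * N + ε / 2 * N := by ring
    _ ≤ (C + 2 * K ^ 2) * δ * N + ε / 2 * N := by gcongr
    _ ≤ ε / 2 * N + ε / 2 * N := by gcongr
    _ = ε * N := by ring

end Action

end CoordinateFlow

/-! ### Natural charts of the cotangent bundle -/

namespace CartanForm

section NaturalCharts

variable {n : ℕ} {M : Type*} [TopologicalSpace M] [ChartedSpace (Model n) M]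
  [IsManifold (𝓡 n) ∞ M]

theorem extChartAt_cotangent_apply (ℓ₀ ℓ : CotangentBundle n M) :
    extChartAt (cotModel n) ℓ₀ ℓ = (extChartAt (𝓡 n) ℓ₀.proj ℓ.proj,
      (trivializationAt (Model n →L[ℝ] ℝ)
        (fun x : M => TangentSpace (𝓡 n) x →L[ℝ] ℝ) ℓ₀.proj ℓ).2) := by
  rw [FiberBundle.extChartAt]
  rfl

theorem extChartAt_cotangent_source (ℓ₀ : CotangentBundle n M) :
    (extChartAt (cotModel n) ℓ₀).source =
      {ℓ : CotangentBundle n M | ℓ.proj ∈ (extChartAt (𝓡 n) ℓ₀.proj).source} := by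
  rw [FiberBundle.extChartAt]
  ext ℓ
  have e : (trivializationAt (Model n →L[ℝ] ℝ)
        (fun x : M => TangentSpace (𝓡 n) x →L[ℝ] ℝ) ℓ₀.proj ℓ).1 = ℓ.proj := rfl
  simp only [PartialEquiv.trans_source, mem_inter_iff, mem_preimage, PartialEquiv.prod_source,
    PartialEquiv.refl_source, mem_prod, mem_univ, and_true, mem_ofPred_eq, extChartAt_source]
  change _ ∧ (trivializationAt (Model n →L[ℝ] ℝ)
    (fun x : M => TangentSpace (𝓡 n) x →L[ℝ] ℝ) ℓ₀.proj ℓ).1 ∈ _ ↔ _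
  rw [e]
  simp

theorem extChartAt_cotangent_fst (ℓ₀ ℓ : CotangentBundle n M) :
    (extChartAt (cotModel n) ℓ₀ ℓ).1 = extChartAt (𝓡 n) ℓ₀.proj ℓ.proj := by
  rw [extChartAt_cotangent_apply]

/-- The fibre coordinate of `ℓ` is `ℓ` composed with the inverse of the derivative of the base
chart, which cancels that derivative. -/
theorem extChartAt_cotangent_snd_apply (ℓ₀ ℓ : CotangentBundle n M)
    (h : ℓ.proj ∈ (chartAt (Model n) ℓ₀.proj).source) (w : TangentSpace (𝓡 n) ℓ.proj) :
    (extChartAt (cotModel n) ℓ₀ ℓ).2 (mfderiv (𝓡 n) 𝓘(ℝ, Model n) (extChartAt (𝓡 n) ℓ₀.proj)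
      ℓ.proj w) = (ℓ.2 : TangentSpace (𝓡 n) ℓ.proj →L[ℝ] ℝ) w := by
  rw [← TangentBundle.continuousLinearMapAt_trivializationAt h]
  have e : (trivializationAt (Model n →L[ℝ] ℝ)
        (fun x : M => TangentSpace (𝓡 n) x →L[ℝ] ℝ) ℓ₀.proj ℓ).2 =
      ContinuousLinearMap.comp (ℓ.2 : TangentSpace (𝓡 n) ℓ.proj →L[ℝ] ℝ)
        ((trivializationAt (Model n) (TangentSpace (𝓡 n) : M → Type _) ℓ₀.proj).symmL ℝ ℓ.proj) := by
    rw [hom_trivializationAt_apply]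
    ext v
    simp [ContinuousLinearMap.inCoordinates]
  rw [extChartAt_cotangent_apply, e]
  have hb : ℓ.proj ∈ (trivializationAt (Model n) (TangentSpace (𝓡 n) : M → Type _)
    ℓ₀.proj).baseSet := h
  exact congrArg (ℓ.2 : TangentSpace (𝓡 n) ℓ.proj →L[ℝ] ℝ)
    (Bundle.Trivialization.symmL_continuousLinearMapAt _ hb w)

theorem mem_extChartAt_cotangent_source {ℓ₀ ℓ : CotangentBundle n M} :
    ℓ ∈ (extChartAt (cotModel n) ℓ₀).source ↔
      ℓ.proj ∈ (chartAt (Model n) ℓ₀.proj).source := by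
  rw [extChartAt_cotangent_source]
  simp

/-- The derivative at `ℓ` of the natural chart centred at `ℓ₀`. -/
noncomputable def chartDeriv (ℓ₀ ℓ : CotangentBundle n M) :
    (Model n × (Model n →L[ℝ] ℝ)) →L[ℝ] Model n × (Model n →L[ℝ] ℝ) :=
  mfderiv (cotModel n) 𝓘(ℝ, Model n × (Model n →L[ℝ] ℝ)) (extChartAt (cotModel n) ℓ₀) ℓ

/-- The derivative at `y` of the inverse of the natural chart centred at `ℓ₀`. -/
noncomputable def chartSymmDeriv (ℓ₀ : CotangentBundle n M) (y : Model n × (Model n →L[ℝ] ℝ)) :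
    (Model n × (Model n →L[ℝ] ℝ)) →L[ℝ] Model n × (Model n →L[ℝ] ℝ) :=
  mfderiv 𝓘(ℝ, Model n × (Model n →L[ℝ] ℝ)) (cotModel n) (extChartAt (cotModel n) ℓ₀).symm y

theorem hasMFDerivAt_chart {ℓ₀ ℓ : CotangentBundle n M}
    (h : ℓ ∈ (extChartAt (cotModel n) ℓ₀).source) :
    HasMFDerivAt (cotModel n) 𝓘(ℝ, Model n × (Model n →L[ℝ] ℝ)) (extChartAt (cotModel n) ℓ₀) ℓ
      (chartDeriv ℓ₀ ℓ) :=
  (mdifferentiableAt_extChartAt (by simpa using h)).hasMFDerivAt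

theorem hasMFDerivAt_chart_symm {ℓ₀ : CotangentBundle n M} {y : Model n × (Model n →L[ℝ] ℝ)}
    (h : y ∈ (extChartAt (cotModel n) ℓ₀).target) :
    HasMFDerivAt 𝓘(ℝ, Model n × (Model n →L[ℝ] ℝ)) (cotModel n)
      (extChartAt (cotModel n) ℓ₀).symm y (chartSymmDeriv ℓ₀ y) := by
  have h1 : ContMDiffAt 𝓘(ℝ, Model n × (Model n →L[ℝ] ℝ)) (cotModel n) ∞
      (extChartAt (cotModel n) ℓ₀).symm y :=
    (contMDiffOn_extChartAt_symm ℓ₀).contMDiffAt ((isOpen_extChartAt_target ℓ₀).mem_nhds h)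
  exact (h1.mdifferentiableAt (by simp)).hasMFDerivAt

theorem chartDeriv_comp_chartSymmDeriv {ℓ₀ : CotangentBundle n M}
    {y : Model n × (Model n →L[ℝ] ℝ)} (h : y ∈ (extChartAt (cotModel n) ℓ₀).target) :
    (chartDeriv ℓ₀ ((extChartAt (cotModel n) ℓ₀).symm y)).comp (chartSymmDeriv ℓ₀ y) =
      ContinuousLinearMap.id ℝ (Model n × (Model n →L[ℝ] ℝ)) := by
  have c1 : HasFDerivAt (extChartAt (cotModel n) ℓ₀ ∘ (extChartAt (cotModel n) ℓ₀).symm)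
      ((chartDeriv ℓ₀ ((extChartAt (cotModel n) ℓ₀).symm y)).comp (chartSymmDeriv ℓ₀ y)) y :=
    ((hasMFDerivAt_chart ((extChartAt (cotModel n) ℓ₀).map_target h)).comp y
      (hasMFDerivAt_chart_symm h)).hasFDerivAt
  have c2 : HasFDerivAt (extChartAt (cotModel n) ℓ₀ ∘ (extChartAt (cotModel n) ℓ₀).symm)
      (ContinuousLinearMap.id ℝ (Model n × (Model n →L[ℝ] ℝ))) y :=
    (hasFDerivAt_id y).congr_of_eventuallyEq (by
      filter_upwards [(isOpen_extChartAt_target ℓ₀).mem_nhds h] with y' hy'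
      exact (extChartAt (cotModel n) ℓ₀).right_inv hy')
  exact c1.unique c2

/-- The Liouville form in a natural chart is `p dq`. -/
theorem liouvilleForm_eq (ℓ₀ ℓ : CotangentBundle n M)
    (h : ℓ ∈ (extChartAt (cotModel n) ℓ₀).source) (v : TangentSpace (cotModel n) ℓ) :
    liouvilleForm ℓ v = (extChartAt (cotModel n) ℓ₀ ℓ).2 (chartDeriv ℓ₀ ℓ v).1 := by
  have h' := mem_extChartAt_cotangent_source.1 h
  have hχ : MDifferentiableAt (cotModel n) 𝓘(ℝ, Model n × (Model n →L[ℝ] ℝ))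
      (extChartAt (cotModel n) ℓ₀) ℓ := mdifferentiableAt_extChartAt (by simpa using h)
  have hπ : MDifferentiableAt (cotModel n) (𝓡 n) (fun z : CotangentBundle n M => z.proj) ℓ :=
    Bundle.mdifferentiableAt_proj (fun x : M => TangentSpace (𝓡 n) x →L[ℝ] ℝ)
  have hψ : MDifferentiableAt (𝓡 n) 𝓘(ℝ, Model n) (extChartAt (𝓡 n) ℓ₀.proj) ℓ.proj :=
    mdifferentiableAt_extChartAt h'
  have e1 : mfderiv (cotModel n) 𝓘(ℝ, Model n)
      (fun z : CotangentBundle n M => (extChartAt (cotModel n) ℓ₀ z).1) ℓ =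
      (ContinuousLinearMap.fst ℝ (Model n) (Model n →L[ℝ] ℝ)).comp
      (mfderiv (cotModel n) 𝓘(ℝ, Model n × (Model n →L[ℝ] ℝ)) (extChartAt (cotModel n) ℓ₀) ℓ) := by
    have hf : HasMFDerivAt 𝓘(ℝ, Model n × (Model n →L[ℝ] ℝ)) 𝓘(ℝ, Model n) Prod.fst
      (extChartAt (cotModel n) ℓ₀ ℓ) (ContinuousLinearMap.fst ℝ (Model n) (Model n →L[ℝ] ℝ)) :=
      (hasFDerivAt_fst).hasMFDerivAt
    exact (hf.comp ℓ hχ.hasMFDerivAt).mfderiv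
  have e2 : (fun z : CotangentBundle n M => (extChartAt (cotModel n) ℓ₀ z).1) =
      extChartAt (𝓡 n) ℓ₀.proj ∘ fun z : CotangentBundle n M => z.proj := by
    ext1 z
    exact extChartAt_cotangent_fst ℓ₀ z
  rw [e2, mfderiv_comp ℓ hψ hπ] at e1
  have e3 := DFunLike.congr_fun e1 v
  calc liouvilleForm ℓ v = (ℓ.2 : TangentSpace (𝓡 n) ℓ.proj →L[ℝ] ℝ)
        (mfderiv (cotModel n) (𝓡 n) (fun z : CotangentBundle n M => z.proj) ℓ v) := rfl
    _ = _ := by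
      rw [← extChartAt_cotangent_snd_apply ℓ₀ ℓ h']
      exact congrArg _ e3

/-- The Liouville form is intrinsic and reads `p dq` in both charts, so the transition map preserves
`p dq`. The identity is needed on a neighbourhood because it will be differentiated. -/
theorem liouvilleForm_coordChange (ℓ₀ ℓ : CotangentBundle n M)
    (h : ℓ ∈ (extChartAt (cotModel n) ℓ₀).source) :
    ∀ᶠ y in 𝓝 (extChartAt (cotModel n) ℓ ℓ), ∀ a : Model n × (Model n →L[ℝ] ℝ),
      (extChartAt (cotModel n) ℓ₀ ((extChartAt (cotModel n) ℓ).symm y)).2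
        (fderiv ℝ (extChartAt (cotModel n) ℓ₀ ∘ (extChartAt (cotModel n) ℓ).symm) y a).1 =
      y.2 a.1 := by
  have hy : ∀ᶠ y in 𝓝 (extChartAt (cotModel n) ℓ ℓ), y ∈ (extChartAt (cotModel n) ℓ).target :=
    extChartAt_target_mem_nhds ℓ
  have hs : ∀ᶠ y in 𝓝 (extChartAt (cotModel n) ℓ ℓ),
      (extChartAt (cotModel n) ℓ).symm y ∈ (extChartAt (cotModel n) ℓ₀).source := by
    have hc := continuousAt_extChartAt_symm (I := cotModel n) ℓ
    refine hc.eventually ((isOpen_extChartAt_source ℓ₀).mem_nhds ?_)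
    rwa [extChartAt_to_inv]
  filter_upwards [hy, hs] with y hyt hys a
  set m := (extChartAt (cotModel n) ℓ).symm y with hm
  have hm1 : m ∈ (extChartAt (cotModel n) ℓ).source := (extChartAt (cotModel n) ℓ).map_target hyt
  have h1 := liouvilleForm_eq ℓ m hm1 (chartSymmDeriv ℓ y a)
  have h2 := liouvilleForm_eq ℓ₀ m hys (chartSymmDeriv ℓ y a)
  have e1 : chartDeriv ℓ m (chartSymmDeriv ℓ y a) = a :=
    DFunLike.congr_fun (chartDeriv_comp_chartSymmDeriv hyt) a
  have e2 : chartDeriv ℓ₀ m (chartSymmDeriv ℓ y a) =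
      fderiv ℝ (extChartAt (cotModel n) ℓ₀ ∘ (extChartAt (cotModel n) ℓ).symm) y a := by
    have c1 : HasFDerivAt (extChartAt (cotModel n) ℓ₀ ∘ (extChartAt (cotModel n) ℓ).symm)
        ((chartDeriv ℓ₀ m).comp (chartSymmDeriv ℓ y)) y :=
      ((hasMFDerivAt_chart hys).comp y (hasMFDerivAt_chart_symm hyt)).hasFDerivAt
    rw [c1.fderiv]
    rfl
  rw [h2, e1, e2] at h1
  rw [h1, hm, (extChartAt (cotModel n) ℓ).right_inv hyt]

/-- Natural charts are symplectic. -/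
theorem symplecticForm_eq (ℓ₀ ℓ : CotangentBundle n M)
    (h : ℓ ∈ (extChartAt (cotModel n) ℓ₀).source) (v w : TangentSpace (cotModel n) ℓ) :
    symplecticForm ℓ v w = (chartDeriv ℓ₀ ℓ v).2 (chartDeriv ℓ₀ ℓ w).1 -
      (chartDeriv ℓ₀ ℓ w).2 (chartDeriv ℓ₀ ℓ v).1 := by
  set κ := extChartAt (cotModel n) ℓ₀ ∘ (extChartAt (cotModel n) ℓ).symm with hκ
  set y₀ := extChartAt (cotModel n) ℓ ℓ with hy₀
  have hm : MDifferentiableAt (cotModel n) 𝓘(ℝ, Model n × (Model n →L[ℝ] ℝ))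
      (extChartAt (cotModel n) ℓ₀) ℓ := mdifferentiableAt_extChartAt (by simpa using h)
  have hD : chartDeriv ℓ₀ ℓ = fderiv ℝ κ y₀ := by
    rw [chartDeriv]
    rw [hm.mfderiv]
    rw [ModelWithCorners.Boundaryless.range_eq_univ, fderivWithin_univ]
    rfl
  have hκs : ContDiffAt ℝ 2 κ y₀ := by
    have h1 : ContMDiffAt 𝓘(ℝ, Model n × (Model n →L[ℝ] ℝ)) (cotModel n) ∞
        (extChartAt (cotModel n) ℓ).symm y₀ :=
      (contMDiffOn_extChartAt_symm ℓ).contMDiffAt (extChartAt_target_mem_nhds ℓ)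
    have h2 : ContMDiffAt (cotModel n) 𝓘(ℝ, Model n × (Model n →L[ℝ] ℝ)) ∞
        (extChartAt (cotModel n) ℓ₀) ((extChartAt (cotModel n) ℓ).symm y₀) := by
      rw [hy₀, extChartAt_to_inv]
      exact contMDiffAt_extChartAt' (by simpa using h)
    exact (h2.comp y₀ h1).contDiffAt.of_le (by norm_cast)
  have hsym := hκs.isSymmSndFDerivAt (by simp)
  have hκ1 : HasFDerivAt κ (fderiv ℝ κ y₀) y₀ := (hκs.differentiableAt (by simp)).hasFDerivAt
  have hκ2 : HasFDerivAt (fderiv ℝ κ) (fderiv ℝ (fderiv ℝ κ) y₀) y₀ :=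
    ((hκs.fderiv_right (m := 1) le_rfl).differentiableAt (by simp)).hasFDerivAt
  -- The invariance of `p dq` is differentiated at `y₀` in the direction `b`. Exchanging the two
  -- vectors and subtracting removes the second derivative, which is symmetric, and leaves the
  -- invariance of `σ`.
  have key : ∀ a b : Model n × (Model n →L[ℝ] ℝ), (fderiv ℝ κ y₀ b).2 (fderiv ℝ κ y₀ a).1 +
      (κ y₀).2 (fderiv ℝ (fderiv ℝ κ) y₀ b a).1 = b.2 a.1 := by
    intro a b
    have hev := liouvilleForm_coordChange ℓ₀ ℓ h
    have c0 := (hκ2.clm_apply (hasFDerivAt_const a y₀)).fst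
    have c1 := hκ1.snd.clm_apply c0
    have c2 : HasFDerivAt (fun y : Model n × (Model n →L[ℝ] ℝ) => y.2 a.1)
        ((ContinuousLinearMap.apply ℝ ℝ a.1).comp
          (ContinuousLinearMap.snd ℝ (Model n) (Model n →L[ℝ] ℝ))) y₀ :=
      (ContinuousLinearMap.apply ℝ ℝ a.1).hasFDerivAt.comp y₀ hasFDerivAt_snd
    have c3 := c2.congr_of_eventuallyEq (f₁ := fun y => (κ y).2 (fderiv ℝ κ y a).1)
      (hev.mono fun y hy => hy a)
    have := DFunLike.congr_fun (c1.unique c3) b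
    simp only [ContinuousLinearMap.comp_zero, zero_add, add_apply, ContinuousLinearMap.comp_apply,
      ContinuousLinearMap.flip_apply, ContinuousLinearMap.coe_fst', ContinuousLinearMap.coe_snd',
      ContinuousLinearMap.apply_apply] at this
    rw [← this]
    ring
  rw [hD]
  have h1 := key v w
  have h2 := key w v
  have h3 := hsym v w
  rw [h3] at h2
  have e : symplecticForm ℓ v w = (v : Model n × (Model n →L[ℝ] ℝ)).2
      (w : Model n × (Model n →L[ℝ] ℝ)).1 - (w : Model n × (Model n →L[ℝ] ℝ)).2
      (v : Model n × (Model n →L[ℝ] ℝ)).1 := rfl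
  rw [e, ← h1, ← h2]
  ring

end NaturalCharts

end CartanForm

/-! ### Derivatives and null sets in charts -/

/-- A function has vanishing derivative almost everywhere on the preimage of a null set. -/
theorem ae_deriv_eq_zero_of_mem_null {τ : ℝ → ℝ} {N : Set ℝ} (hN : volume N = 0) :
    ∀ᵐ s, τ s ∈ N → DifferentiableAt ℝ τ s → deriv τ s = 0 := by
  -- A point of `τ⁻¹(N)` with nonzero derivative lies in some `S k`. On a cell of length `1 / (k +
  -- 1)` the map `τ` is injective on `S k` with Lipschitz inverse, so that piece is a Lipschitz
  -- image of a subset of `N`.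
  set S : ℕ → Set ℝ := fun k => {s | τ s ∈ N ∧ ∀ s', |s' - s| < 1 / (k + 1 : ℝ) →
    |s' - s| ≤ (k + 1) * |τ s' - τ s|} with hS
  have hS0 : ∀ k, volume (S k) = 0 := by
    intro k
    set δ : ℝ := 1 / (k + 1 : ℝ) with hδ
    have hδ0 : 0 < δ := by positivity
    have hpart : S k = ⋃ j : ℤ, S k ∩ Ico (j • δ) ((j + 1) • δ) := by
      rw [← inter_iUnion, iUnion_Ico_zsmul hδ0, inter_univ]
    rw [hpart]
    refine measure_iUnion_null fun j => ?_
    set A := S k ∩ Ico (j • δ) ((j + 1) • δ) with hA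
    have hanti : ∀ x ∈ A, ∀ y ∈ A, dist x y ≤ (k + 1 : ℝ≥0) * dist (τ x) (τ y) := by
      intro x hx y hy
      rw [Real.dist_eq, Real.dist_eq]
      have h1 := hx.2
      have h2 := hy.2
      simp only [mem_Ico, add_smul, one_smul] at h1 h2
      refine (hy.1.2 x ?_).trans_eq (by simp)
      rw [abs_lt]
      constructor <;> linarith [h1.1, h1.2, h2.1, h2.2]
    have hinj : InjOn τ A := fun x hx y hy hxy => by
      have := hanti x hx y hy
      rw [hxy, dist_self, mul_zero] at this
      exact dist_le_zero.1 this
    have hlip : LipschitzOnWith (k + 1 : ℝ≥0) (Function.invFunOn τ A) (τ '' A) := by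
      refine LipschitzOnWith.of_dist_le_mul ?_
      rintro _ ⟨x, hx, rfl⟩ _ ⟨y, hy, rfl⟩
      rw [hinj.leftInvOn_invFunOn hx, hinj.leftInvOn_invFunOn hy]
      exact hanti x hx y hy
    have h1 := hlip.hausdorffMeasure_image_le (d := 1) zero_le_one
    rw [hausdorffMeasure_real, hinj.leftInvOn_invFunOn.image_image,
      measure_mono_null (show τ '' A ⊆ N by rintro _ ⟨x, hx, rfl⟩; exact hx.1.1) hN,
      mul_zero] at h1
    exact le_antisymm h1 zero_le
  have hU : volume (⋃ k, S k) = 0 := measure_iUnion_null hS0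
  filter_upwards [compl_mem_ae_iff.2 hU] with s hs hsN hd
  by_contra hne
  refine hs ?_
  set c := |deriv τ s| with hc
  have hc0 : 0 < c := abs_pos.2 hne
  have hlo := (hasDerivAt_iff_isLittleO.1 hd.hasDerivAt).def (half_pos hc0)
  obtain ⟨ε, hε, hball⟩ := Metric.eventually_nhds_iff.1 hlo
  obtain ⟨k₁, hk₁⟩ := exists_nat_one_div_lt hε
  obtain ⟨k₂, hk₂⟩ := exists_nat_ge (2 / c)
  refine mem_iUnion.2 ⟨max k₁ k₂, hsN, fun s' hs' => ?_⟩
  have h1 : |s' - s| < ε := hs'.trans (lt_of_le_of_lt (one_div_le_one_div_of_le (by positivity)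
    (by gcongr; exact_mod_cast le_max_left k₁ k₂)) hk₁)
  have h2 := hball (y := s') (by rwa [Real.dist_eq])
  rw [smul_eq_mul, Real.norm_eq_abs, Real.norm_eq_abs] at h2
  have h3 : |s' - s| * c ≤ |τ s' - τ s| + c / 2 * |s' - s| := by
    calc |s' - s| * c = |(τ s' - τ s) - (τ s' - τ s - (s' - s) * deriv τ s)| := by
          rw [hc, ← abs_mul]; ring_nf
      _ ≤ _ := (abs_sub _ _).trans (add_le_add le_rfl h2)
  have h4 : |s' - s| ≤ 2 / c * |τ s' - τ s| := by
    rw [div_mul_eq_mul_div, le_div_iff₀ hc0]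
    linarith
  refine h4.trans ?_
  gcongr
  have : (k₂ : ℝ) ≤ (max k₁ k₂ : ℕ) := by exact_mod_cast le_max_right k₁ k₂
  linarith

section Charts

variable {E : Type*} [NormedAddCommGroup E] [NormedSpace ℝ E] {A : Type*} [TopologicalSpace A]
  {E' : Type*} [NormedAddCommGroup E'] [NormedSpace ℝ E'] {A' : Type*} [TopologicalSpace A']
  {X : Type*} [TopologicalSpace X] [ChartedSpace A X]
  {Y : Type*} [TopologicalSpace Y] [ChartedSpace A' Y]
  {I : ModelWithCorners ℝ E A} {I' : ModelWithCorners ℝ E' A'}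

/-- A vanishing derivative needs no transformation rule between charts, which is why equalities of
forms are brought to this shape. -/
theorem hasMFDerivAt_zero_of_chart [IsManifold I ∞ X] {x₀ x : X}
    (hx : x ∈ (extChartAt I x₀).source) {g : X → ℝ}
    (h : HasFDerivAt (g ∘ (extChartAt I x₀).symm) (0 : E →L[ℝ] ℝ) (extChartAt I x₀ x)) :
    HasMFDerivAt I 𝓘(ℝ, ℝ) g x (0 : TangentSpace I x →L[ℝ] ℝ) := by
  have : IsManifold I 1 X := IsManifold.of_le (n := ∞) (by simp)
  have h1 : HasMFDerivAt I 𝓘(ℝ, E) (extChartAt I x₀) x _ :=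
    (mdifferentiableAt_extChartAt (by simpa using hx)).hasMFDerivAt
  have h2 : HasMFDerivAt I 𝓘(ℝ, ℝ) ((g ∘ (extChartAt I x₀).symm) ∘ extChartAt I x₀) x
      (0 : TangentSpace I x →L[ℝ] ℝ) := by
    refine (h.hasMFDerivAt.comp x h1).congr_mfderiv ?_
    ext v
    rfl
  refine h2.congr_of_eventuallyEq ?_
  filter_upwards [(isOpen_extChartAt_source x₀).mem_nhds hx] with y hy
  simp only [Function.comp]
  rw [(extChartAt I x₀).left_inv hy]

theorem mdifferentiableAt_of_chart [IsManifold I ∞ X] [IsManifold I' ∞ Y] [I'.Boundaryless]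
    {x₀ x : X} {y₀ : Y} {f : X → Y} (hx : x ∈ (extChartAt I x₀).source)
    (hf : ∀ᶠ x' in 𝓝 x, f x' ∈ (extChartAt I' y₀).source)
    (h : DifferentiableAt ℝ (extChartAt I' y₀ ∘ f ∘ (extChartAt I x₀).symm)
      (extChartAt I x₀ x)) : MDifferentiableAt I I' f x := by
  have : IsManifold I 1 X := IsManifold.of_le (n := ∞) (by simp)
  have h1 : MDifferentiableAt I 𝓘(ℝ, E) (extChartAt I x₀) x :=
    mdifferentiableAt_extChartAt (by simpa using hx)
  have h2 : MDifferentiableAt I 𝓘(ℝ, E')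
      ((extChartAt I' y₀ ∘ f ∘ (extChartAt I x₀).symm) ∘ extChartAt I x₀) x :=
    h.mdifferentiableAt.comp x h1
  have hfx := hf.self_of_nhds
  have e0 : ((extChartAt I' y₀ ∘ f ∘ (extChartAt I x₀).symm) ∘ extChartAt I x₀) x =
      extChartAt I' y₀ (f x) := by
    simp only [Function.comp]
    rw [(extChartAt I x₀).left_inv hx]
  have h3 : MDifferentiableAt 𝓘(ℝ, E') I' (extChartAt I' y₀).symm
      (((extChartAt I' y₀ ∘ f ∘ (extChartAt I x₀).symm) ∘ extChartAt I x₀) x) := by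
    rw [e0]
    have : ContMDiffAt 𝓘(ℝ, E') I' ∞ (extChartAt I' y₀).symm (extChartAt I' y₀ (f x)) :=
      (contMDiffOn_extChartAt_symm y₀).contMDiffAt
        ((isOpen_extChartAt_target y₀).mem_nhds ((extChartAt I' y₀).map_source hfx))
    exact this.mdifferentiableAt (by simp)
  refine (h3.comp x h2).congr_of_eventuallyEq ?_
  filter_upwards [hf, (isOpen_extChartAt_source x₀).mem_nhds hx] with y hy hy'
  simp only [Function.comp]
  rw [(extChartAt I x₀).left_inv hy', (extChartAt I' y₀).left_inv hy]

/-- Transition maps are differentiable and so preserve null sets. Local nullity suffices because it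
is tested in the model space, so no countability of the manifold enters. -/
theorem almostEverywhereOn_of_local [IsManifold I ∞ X] [I.Boundaryless] [FiniteDimensional ℝ E]
    [MeasureSpace E] [BorelSpace E] [(volume : Measure E).IsAddHaarMeasure] {S : Set X}
    {P : X → Prop} (h : ∀ x ∈ S, ∃ W ∈ 𝓝 (extChartAt I x x),
      ∀ᵐ y, y ∈ W → P ((extChartAt I x).symm y)) : CartanForm.AlmostEverywhereOn I S P := by
  intro x₀
  refine measure_null_of_locally_null _ ?_
  rintro _ ⟨x, ⟨⟨hxS, -⟩, hx₀⟩, rfl⟩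
  obtain ⟨W, hW, hP⟩ := h x hxS
  have hWx : extChartAt I x ⁻¹' W ∩ (extChartAt I x).source ∈ 𝓝 x :=
    inter_mem (continuousAt_extChartAt x hW) (extChartAt_source_mem_nhds x)
  set T : Set X := {y ∈ S | ¬ P y} ∩ (extChartAt I x₀).source with hT
  refine ⟨extChartAt I x₀ '' (T ∩ (extChartAt I x ⁻¹' W ∩ (extChartAt I x).source)), ?_, ?_⟩
  · have hc := continuousAt_extChartAt_symm' (I := I) hx₀
    have hpre : (extChartAt I x₀).symm ⁻¹' (extChartAt I x ⁻¹' W ∩ (extChartAt I x).source) ∈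
        𝓝 (extChartAt I x₀ x) := hc.preimage_mem_nhds (by
      rwa [(extChartAt I x₀).left_inv hx₀])
    refine mem_nhdsWithin_iff_exists_mem_nhds_inter.2 ⟨_, hpre, ?_⟩
    rintro _ ⟨hy1, ⟨y, hy, rfl⟩⟩
    refine mem_image_of_mem _ ⟨hy, ?_⟩
    rwa [mem_preimage, (extChartAt I x₀).left_inv hy.2] at hy1
  · set Z := extChartAt I x '' (T ∩ (extChartAt I x ⁻¹' W ∩ (extChartAt I x).source)) with hZ
    have hZ0 : volume Z = 0 := by
      refine measure_mono_null ?_ hP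
      rintro _ ⟨y, ⟨hyT, hyW, hys⟩, rfl⟩ hy
      have := hy hyW
      rw [(extChartAt I x).left_inv hys] at this
      exact hyT.1.2 this
    have himg : extChartAt I x₀ '' (T ∩ (extChartAt I x ⁻¹' W ∩ (extChartAt I x).source)) =
        (extChartAt I x₀ ∘ (extChartAt I x).symm) '' Z := by
      rw [hZ, image_image]
      refine image_congr fun y hy => ?_
      simp only [Function.comp]
      rw [(extChartAt I x).left_inv hy.2.2]
    rw [himg]
    refine addHaar_image_eq_zero_of_differentiableOn_of_addHaar_eq_zero volume ?_ hZ0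
    rintro _ ⟨y, ⟨hyT, hyW, hys⟩, rfl⟩
    have h1 : ContMDiffAt 𝓘(ℝ, E) I ∞ (extChartAt I x).symm (extChartAt I x y) :=
      (contMDiffOn_extChartAt_symm x).contMDiffAt
        ((isOpen_extChartAt_target x).mem_nhds ((extChartAt I x).map_source hys))
    have h2 : ContMDiffAt I 𝓘(ℝ, E) ∞ (extChartAt I x₀)
        ((extChartAt I x).symm (extChartAt I x y)) := by
      rw [(extChartAt I x).left_inv hys]
      exact contMDiffAt_extChartAt' (by simpa using hyT.2)
    exact ((h2.comp _ h1).contDiffAt.differentiableAt (by simp)).differentiableWithinAt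

end Charts

/-! ### Functions whose derivative at a point is the Liouville or the Cartan form. -/

namespace CartanForm

variable {n : ℕ} {M : Type*} [TopologicalSpace M] [ChartedSpace (Model n) M]
  [IsManifold (𝓡 n) ∞ M]

/-- The pairing of the momentum of `ℓ` with the position of `ℓ'` in a natural chart. -/
noncomputable def liouvillePotential (ℓ₀ ℓ ℓ' : CotangentBundle n M) : ℝ :=
  (extChartAt (cotModel n) ℓ₀ ℓ).2 (extChartAt (cotModel n) ℓ₀ ℓ').1

/-- With the momentum frozen, `p dq` at `ℓ` is the differential of a function. An equality `f^* s =
dθ` at a point thereby follows from the vanishing of the derivative of `θ` minus this potential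
along `f`, which is what the coordinate estimates provide. -/
theorem hasMFDerivAt_liouvillePotential {ℓ₀ ℓ : CotangentBundle n M}
    (h : ℓ ∈ (extChartAt (cotModel n) ℓ₀).source) :
    HasMFDerivAt (cotModel n) 𝓘(ℝ, ℝ) (liouvillePotential ℓ₀ ℓ) ℓ (liouvilleForm ℓ) := by
  set p := (extChartAt (cotModel n) ℓ₀ ℓ).2 with hp
  have h1 : HasMFDerivAt 𝓘(ℝ, Model n × (Model n →L[ℝ] ℝ)) 𝓘(ℝ, ℝ)
      (fun y : Model n × (Model n →L[ℝ] ℝ) => p y.1) (extChartAt (cotModel n) ℓ₀ ℓ)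
      (p.comp (ContinuousLinearMap.fst ℝ (Model n) (Model n →L[ℝ] ℝ))) :=
    (p.comp (ContinuousLinearMap.fst ℝ (Model n) (Model n →L[ℝ] ℝ))).hasFDerivAt.hasMFDerivAt
  refine (h1.comp ℓ (hasMFDerivAt_chart h)).congr_mfderiv ?_
  ext v
  exact (liouvilleForm_eq ℓ₀ ℓ h v).symm

theorem hasMFDerivAt_cartanPotential (H : ℝ → CotangentBundle n M → ℝ) {ℓ₀ : CotangentBundle n M}
    {z : ℝ × CotangentBundle n M} (h : z.2 ∈ (extChartAt (cotModel n) ℓ₀).source) :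
    HasMFDerivAt (𝓘(ℝ, ℝ).prod (cotModel n)) 𝓘(ℝ, ℝ)
      (fun z' : ℝ × CotangentBundle n M => liouvillePotential ℓ₀ z.2 z'.2 - H z.1 z.2 * z'.1) z
      (cartanForm H z) := by
  have h1 := (hasMFDerivAt_liouvillePotential h).comp z
    (hasMFDerivAt_snd (I := 𝓘(ℝ, ℝ)) (I' := cotModel n) z)
  have h2 : HasMFDerivAt (𝓘(ℝ, ℝ).prod (cotModel n)) 𝓘(ℝ, ℝ)
      (fun z' : ℝ × CotangentBundle n M => H z.1 z.2 * z'.1) z _ :=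
    ((hasFDerivAt_id z.1).const_mul (H z.1 z.2)).hasMFDerivAt.comp z
    (hasMFDerivAt_fst (I := 𝓘(ℝ, ℝ)) (I' := cotModel n) z)
  have h3 := h1.sub h2
  exact h3

end CartanForm

namespace CartanForm

variable {n : ℕ} {M : Type*} [TopologicalSpace M] [ChartedSpace (Model n) M]
  [IsManifold (𝓡 n) ∞ M]

/-! ### Flow boxes in natural coordinates -/

theorem hasFDerivAt_comp_extChartAt_symm {ℓ₀ ℓ : CotangentBundle n M}
    (hℓ : ℓ ∈ (extChartAt (cotModel n) ℓ₀).source) {h : CotangentBundle n M → ℝ}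
    (hh : MDifferentiableAt (cotModel n) 𝓘(ℝ, ℝ) h ℓ) :
    HasFDerivAt (h ∘ (extChartAt (cotModel n) ℓ₀).symm)
      ((cotDifferential h ℓ).comp (chartSymmDeriv ℓ₀ (extChartAt (cotModel n) ℓ₀ ℓ))) (extChartAt (cotModel n) ℓ₀ ℓ) := by
  have e := (extChartAt (cotModel n) ℓ₀).left_inv hℓ
  have h1 := hasMFDerivAt_chart_symm ((extChartAt (cotModel n) ℓ₀).map_source hℓ)
  have h2 : HasMFDerivAt (cotModel n) 𝓘(ℝ, ℝ) h
      ((extChartAt (cotModel n) ℓ₀).symm (extChartAt (cotModel n) ℓ₀ ℓ))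
      (cotDifferential h ℓ) := by
    rw [e]
    exact hh.hasMFDerivAt
  exact (h2.comp _ h1).hasFDerivAt

/-- Hamilton's equations in natural coordinates. -/
theorem hamilton_equations_chart {ℓ₀ : CotangentBundle n M} {γ : ℝ → CotangentBundle n M} {t : ℝ}
    (hℓ : γ t ∈ (extChartAt (cotModel n) ℓ₀).source) {h : CotangentBundle n M → ℝ}
    (hh : MDifferentiableAt (cotModel n) 𝓘(ℝ, ℝ) h (γ t))
    (hγ : HasMFDerivAt 𝓘(ℝ, ℝ) (cotModel n) γ t
      ((1 : ℝ →L[ℝ] ℝ).smulRight (hamiltonianVectorField h (γ t)))) :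
    ∃ X : Model n × (Model n →L[ℝ] ℝ),
      HasDerivAt (fun s => extChartAt (cotModel n) ℓ₀ (γ s)) X t ∧
      (∀ v, fderiv ℝ (h ∘ (extChartAt (cotModel n) ℓ₀).symm) (extChartAt (cotModel n) ℓ₀ (γ t)) v =
        v.2 X.1 - X.2 v.1) ∧
      liouvilleForm (γ t) (hamiltonianVectorField h (γ t)) =
        (extChartAt (cotModel n) ℓ₀ (γ t)).2 X.1 := by
  refine ⟨chartDeriv ℓ₀ (γ t) (hamiltonianVectorField h (γ t)), ?_, fun v => ?_,
    liouvilleForm_eq ℓ₀ (γ t) hℓ _⟩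
  · set Y : Model n × (Model n →L[ℝ] ℝ) := hamiltonianVectorField h (γ t) with hY
    have h1 : HasFDerivAt (fun s => extChartAt (cotModel n) ℓ₀ (γ s))
        ((chartDeriv ℓ₀ (γ t)).comp ((1 : ℝ →L[ℝ] ℝ).smulRight Y)) t :=
      ((hasMFDerivAt_chart hℓ).comp t hγ).hasFDerivAt
    have h2 : HasDerivAt (fun s => extChartAt (cotModel n) ℓ₀ (γ s))
        (((chartDeriv ℓ₀ (γ t)).comp ((1 : ℝ →L[ℝ] ℝ).smulRight Y)) 1) t := h1.hasDerivAt
    have h3 : ((chartDeriv ℓ₀ (γ t)).comp ((1 : ℝ →L[ℝ] ℝ).smulRight Y)) 1 =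
        chartDeriv ℓ₀ (γ t) Y := by simp
    rwa [h3] at h2
  · have e1 : chartDeriv ℓ₀ (γ t) (chartSymmDeriv ℓ₀ (extChartAt (cotModel n) ℓ₀ (γ t)) v) = v := by
      have := DFunLike.congr_fun (chartDeriv_comp_chartSymmDeriv
        ((extChartAt (cotModel n) ℓ₀).map_source hℓ)) v
      rwa [(extChartAt (cotModel n) ℓ₀).left_inv hℓ] at this
    have e0 := (hasFDerivAt_comp_extChartAt_symm hℓ hh).fderiv
    refine (DFunLike.congr_fun e0 v).trans ?_
    have e2 := symplecticForm_hamiltonianVectorField h (γ t)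
      (chartSymmDeriv ℓ₀ (extChartAt (cotModel n) ℓ₀ (γ t)) v)
    have e3 := symplecticForm_eq ℓ₀ (γ t) hℓ
      (chartSymmDeriv ℓ₀ (extChartAt (cotModel n) ℓ₀ (γ t)) v) (hamiltonianVectorField h (γ t))
    rw [e1] at e3
    exact e2.trans e3

variable {α : M → ℝ} {U : Set M} {J : Set ℝ} {O : Set (CotangentBundle n M)}
  {H : ℝ → CotangentBundle n M → ℝ} {Φ : ℝ → CotangentBundle n M → CotangentBundle n M}

theorem HamiltonianFlowAssumption.intervalIntegrable_actionDensity
    (hH : HamiltonianFlowAssumption J α U O H Φ) (hJc : J.OrdConnected) {q : M} (hq : q ∈ U)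
    {t₀ t₁ : ℝ} (h₀ : t₀ ∈ J) (h₁ : t₁ ∈ J) :
    IntervalIntegrable (fun t => actionDensity H t (flowAt α Φ t q)) volume t₀ t₁ := by
  obtain ⟨hm, C, hC⟩ := hH.lipschitzCaratheodory.bounded_measurable q hq
  have hsub : uIoc t₀ t₁ ⊆ J := uIoc_subset_uIcc.trans (hJc.uIcc_subset h₀ h₁)
  rw [intervalIntegrable_iff]
  have : IsFiniteMeasure (volume.restrict (uIoc t₀ t₁)) := ⟨by simp⟩
  refine Integrable.of_bound
    (hm.mono_measure (Measure.restrict_mono hsub le_rfl)).aestronglyMeasurable C ?_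
  exact ae_restrict_of_ae_restrict_of_subset hsub hC

theorem HamiltonianFlowAssumption.thetaGraph_sub
    (hH : HamiltonianFlowAssumption J α U O H Φ) (hJc : J.OrdConnected) (hJ0 : (0 : ℝ) ∈ J)
    {q : M} (hq : q ∈ U) {t₀ t₁ : ℝ} (h₀ : t₀ ∈ J) (h₁ : t₁ ∈ J) :
    thetaGraph α H Φ (t₁, q) - thetaGraph α H Φ (t₀, q) =
      ∫ t in t₀..t₁, actionDensity H t (flowAt α Φ t q) := by
  have h := intervalIntegral.integral_interval_sub_left
    (hH.intervalIntegrable_actionDensity hJc hq hJ0 h₁)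
    (hH.intervalIntegrable_actionDensity hJc hq hJ0 h₀)
  rw [← h]
  change (α q + ∫ s in (0 : ℝ)..t₁, actionDensity H s (flowAt α Φ s q)) -
    (α q + ∫ s in (0 : ℝ)..t₀, actionDensity H s (flowAt α Φ s q)) = _
  ring

variable (α U J H Φ) in
/-- On the time interval `[a, b]` and a ball of radius `r` in the preferred chart at `q₀`, the flow
stays in the natural chart at `ℓ₀` and solves Hamilton's equations there. -/
structure FlowBox (ℓ₀ : CotangentBundle n M) (q₀ : M) (a b r : ℝ) (K : ℝ≥0) : Prop where
  radius_pos : 0 < r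
  radius_le : r ≤ 1 / 2
  interval : Icc a b ⊆ J
  target : Metric.ball (extChartAt (𝓡 n) q₀ q₀) r ⊆ (extChartAt (𝓡 n) q₀).target
  mem : ∀ u ∈ Metric.ball (extChartAt (𝓡 n) q₀ q₀) r, (extChartAt (𝓡 n) q₀).symm u ∈ U
  source : ∀ t ∈ Icc a b, ∀ u ∈ Metric.ball (extChartAt (𝓡 n) q₀ q₀) r,
    flowAt α Φ t ((extChartAt (𝓡 n) q₀).symm u) ∈ (extChartAt (cotModel n) ℓ₀).source
  flow : CoordinateFlow a b (Metric.ball (extChartAt (𝓡 n) q₀ q₀) r) K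
    (fun t u => extChartAt (cotModel n) ℓ₀ (flowAt α Φ t ((extChartAt (𝓡 n) q₀).symm u)))
    (fun t => H t ∘ (extChartAt (cotModel n) ℓ₀).symm)
    (fun t u => actionDensity H t (flowAt α Φ t ((extChartAt (𝓡 n) q₀).symm u)))
  lip : ∃ D : ℝ≥0, LipschitzOnWith D
    (fun x : ℝ × Model n => thetaGraph α H Φ (x.1, (extChartAt (𝓡 n) q₀).symm x.2))
    (Icc a b ×ˢ Metric.ball (extChartAt (𝓡 n) q₀ q₀) r)

omit [IsManifold (𝓡 n) ∞ M] in
theorem exists_lipschitz_ball {q₀ : M} (hU : IsOpen U) (hq₀ : q₀ ∈ U)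
    (hα : ContMDiffOn (𝓡 n) 𝓘(ℝ, ℝ) ∞ α U) :
    ∃ D : ℝ≥0, ∃ W ∈ 𝓝 (extChartAt (𝓡 n) q₀ q₀),
      LipschitzOnWith D (α ∘ (extChartAt (𝓡 n) q₀).symm) W := by
  have h1 := (hα.contMDiffAt (hU.mem_nhds hq₀))
  have h2 := (contMDiffAt_iff.1 h1).2
  simp only [extChartAt_model_space_eq_id, PartialEquiv.refl_coe, Function.id_comp,
    ModelWithCorners.Boundaryless.range_eq_univ, contDiffWithinAt_univ] at h2
  exact (h2.of_le (m := 1) (by norm_cast)).exists_lipschitzOnWith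

theorem FlowBox.mono_radius {ℓ₀ : CotangentBundle n M} {q₀ : M} {a b r r' : ℝ} {K : ℝ≥0}
    (h : FlowBox α U J H Φ ℓ₀ q₀ a b r K) (hr' : 0 < r') (hr : r' ≤ r) :
    FlowBox α U J H Φ ℓ₀ q₀ a b r' K := by
  have hs : Metric.ball (extChartAt (𝓡 n) q₀ q₀) r' ⊆ Metric.ball (extChartAt (𝓡 n) q₀ q₀) r :=
    Metric.ball_subset_ball hr
  obtain ⟨D, hD⟩ := h.lip
  exact ⟨hr', hr.trans h.radius_le, h.interval, hs.trans h.target, fun u hu => h.mem u (hs hu),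
    fun t ht u hu => h.source t ht u (hs hu), h.flow.mono_set hs,
    D, hD.mono (prod_mono Subset.rfl hs)⟩

theorem HamiltonianFlowAssumption.exists_flowBox (hH : HamiltonianFlowAssumption J α U O H Φ)
    (hU : IsOpen U) (hα : ContMDiffOn (𝓡 n) 𝓘(ℝ, ℝ) ∞ α U) (hJ : IsOpen J)
    (hJc : J.OrdConnected) (hJ0 : (0 : ℝ) ∈ J) {t₁ : ℝ} (ht₁ : t₁ ∈ J) {q₀ : M} (hq₀ : q₀ ∈ U) :
    ∃ a b r : ℝ, ∃ K : ℝ≥0, a < t₁ ∧ t₁ < b ∧ FlowBox α U J H Φ (flowAt α Φ t₁ q₀) q₀ a b r K := by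
  set ψ := extChartAt (𝓡 n) q₀ with hψ
  set ℓ₀ := flowAt α Φ t₁ q₀ with hℓ₀
  obtain ⟨K, V, hV, hVs, hVm, hVL⟩ := hH.lipschitz (t₁, q₀) ⟨ht₁, hq₀⟩
  rw [(hJ.prod hU).nhdsWithin_eq ⟨ht₁, hq₀⟩] at hV
  obtain ⟨C, V', hV', hV's, hVC⟩ := hH.lipschitzCaratheodory.uniform q₀ hq₀
  obtain ⟨D, W, hW, hD⟩ := exists_lipschitz_ball hU hq₀ hα
  have hc : ContinuousAt ψ.symm (ψ q₀) := continuousAt_extChartAt_symm q₀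
  have e0 : ψ.symm (ψ q₀) = q₀ := extChartAt_to_inv q₀
  have hc2 : ContinuousAt (fun x : ℝ × Model n => (x.1, ψ.symm x.2)) (t₁, ψ q₀) :=
    continuousAt_fst.prodMk (ContinuousAt.comp (f := Prod.snd) hc continuousAt_snd)
  have hn1 : ∀ᶠ x : ℝ × Model n in 𝓝 (t₁, ψ q₀), (x.1, ψ.symm x.2) ∈ V := by
    refine hc2.eventually (?_ : V ∈ 𝓝 (t₁, ψ.symm (ψ q₀)))
    rwa [e0]
  have hn2 : ∀ᶠ x : ℝ × Model n in 𝓝 (t₁, ψ q₀), (x.1, ψ.symm x.2) ∈ J ×ˢ U := by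
    have h1 : ψ.symm (ψ q₀) ∈ U := by rwa [e0]
    exact hc2.eventually ((hJ.prod hU).mem_nhds ⟨ht₁, h1⟩)
  have hn3 : ∀ᶠ u in 𝓝 (ψ q₀), ψ.symm u ∈ V' ∧ u ∈ ψ.target ∧ u ∈ W := by
    have h1 : ∀ᶠ u in 𝓝 (ψ q₀), u ∈ ψ.target := extChartAt_target_mem_nhds q₀
    have h2 : ∀ᶠ u in 𝓝 (ψ q₀), u ∈ W := hW
    refine (hc.eventually (?_ : V' ∈ 𝓝 (ψ.symm (ψ q₀)))).and (h1.and h2)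
    rwa [e0]
  have hn := (hn1.and hn2).and (continuous_snd.continuousAt.eventually hn3)
  obtain ⟨δ, hδ, hball⟩ := Metric.eventually_nhds_iff.1 hn
  -- Half of `δ` lets the closed time interval fit in the neighbourhood; `1 / 2` makes the diameter
  -- of the ball at most one.
  set r := min (δ / 2) (1 / 2) with hr
  have hr0 : 0 < r := by positivity
  have hrδ : r < δ := (min_le_left _ _).trans_lt (by linarith)
  have key : ∀ t ∈ Icc (t₁ - r) (t₁ + r), ∀ u ∈ Metric.ball (ψ q₀) r,
      ((t, ψ.symm u) ∈ V ∧ (t, ψ.symm u) ∈ J ×ˢ U) ∧ ψ.symm u ∈ V' ∧ u ∈ ψ.target ∧ u ∈ W := by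
    intro t ht u hu
    refine hball (y := (t, u)) ?_
    rw [Prod.dist_eq, max_lt_iff]
    refine ⟨?_, (Metric.mem_ball.1 hu).trans hrδ⟩
    rw [Real.dist_eq]
    refine lt_of_le_of_lt (abs_le.2 ⟨?_, ?_⟩) hrδ <;> linarith [ht.1, ht.2]
  have hmid : t₁ ∈ Icc (t₁ - r) (t₁ + r) := ⟨by linarith, by linarith⟩
  have hcen : ψ q₀ ∈ Metric.ball (ψ q₀) r := Metric.mem_ball_self hr0
  have hI : Icc (t₁ - r) (t₁ + r) ⊆ J := fun t ht => (key t ht _ hcen).1.2.1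
  have hΛ : ∀ u ∈ Metric.ball (ψ q₀) r,
      dSection (n := n) α (ψ.symm u) ∈ graphOfDifferential (n := n) α U := fun u hu =>
    mem_image_of_mem _ (key t₁ hmid u hu).1.2.2
  have hsrc : ∀ t ∈ Icc (t₁ - r) (t₁ + r), ∀ u ∈ Metric.ball (ψ q₀) r,
      flowAt α Φ t (ψ.symm u) ∈ (extChartAt (cotModel n) ℓ₀).source := fun t ht u hu =>
    hVm (key t ht u hu).1.1
  have hres := ae_mono (Measure.restrict_mono (μ := volume) hI le_rfl)
  have hGu : ∀ᵐ t ∂(volume.restrict J), ∀ u ∈ Metric.ball (ψ q₀) r, ∀ v ∈ Metric.ball (ψ q₀) r,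
      |actionDensity H t (flowAt α Φ t (ψ.symm u)) - actionDensity H t (flowAt α Φ t (ψ.symm v))| ≤
        C * dist u v := by
    filter_upwards [hVC] with t ht u hu v hv
    have := ht _ (key t₁ hmid u hu).2.1 _ (key t₁ hmid v hv).2.1
    rwa [ψ.right_inv (key t₁ hmid u hu).2.2.1, ψ.right_inv (key t₁ hmid v hv).2.2.1] at this
  refine ⟨t₁ - r, t₁ + r, r, K, by linarith, by linarith, hr0, min_le_right _ _, hI,
    fun u hu => (key t₁ hmid u hu).2.2.1, fun u hu => (key t₁ hmid u hu).1.2.2, hsrc, ?_, ?_⟩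
  · refine ⟨LipschitzOnWith.of_dist_le_mul ?_, ?_, ?_, ?_, ?_, C, hres hGu⟩
    · rintro ⟨t, u⟩ ⟨ht, hu⟩ ⟨t', u'⟩ ⟨ht', hu'⟩
      have := hVL _ (key t ht u hu).1.1 _ (key t' ht' u' hu').1.1
      rw [extChartAt_prod] at this
      simp only [PartialEquiv.prod_coe, extChartAt_model_space_eq_id, PartialEquiv.refl_coe,
        id_eq] at this
      rwa [ψ.right_inv (key t ht u hu).2.2.1, ψ.right_inv (key t' ht' u' hu').2.2.1] at this
    · filter_upwards [hres hH.differentiable, ae_restrict_mem measurableSet_Icc] with t ht htI u hu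
      exact (hasFDerivAt_comp_extChartAt_symm (hsrc t htI u hu)
        (ht _ (hΛ u hu))).differentiableAt
    · intro u hu
      filter_upwards [hres hH.differentiable, hres (hH.ode _ (hΛ u hu)),
        ae_restrict_mem measurableSet_Icc] with t htd hto htI
      obtain ⟨X, h1, h2, h3⟩ := hamilton_equations_chart
        (γ := fun s => flowAt α Φ s (ψ.symm u)) (hsrc t htI u hu) (htd _ (hΛ u hu)) hto
      refine ⟨X, h1, h2, ?_⟩
      change liouvilleForm _ _ - _ = _
      rw [h3]
      simp only [Function.comp]
      rw [(extChartAt (cotModel n) ℓ₀).left_inv (hsrc t htI u hu)]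
    · intro u hu
      exact (hH.lipschitzCaratheodory.bounded_measurable _ (key t₁ hmid u hu).1.2.2).1.mono_measure
        (Measure.restrict_mono hI le_rfl)
    · intro u hu
      obtain ⟨-, C', hC'⟩ :=
        hH.lipschitzCaratheodory.bounded_measurable _ (key t₁ hmid u hu).1.2.2
      exact ⟨C', hres hC'⟩
  · obtain ⟨-, C₀, hC₀⟩ := hH.lipschitzCaratheodory.bounded_measurable q₀ hq₀
    have hbd : ∀ᵐ t ∂(volume.restrict J), ∀ u ∈ Metric.ball (ψ q₀) r,
        |actionDensity H t (flowAt α Φ t (ψ.symm u))| ≤ C₀ + C := by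
      filter_upwards [hGu, hC₀] with t ht ht₀ u hu
      have h1 := ht u hu _ hcen
      rw [e0] at h1
      have h2 : (C : ℝ) * dist u (ψ q₀) ≤ C * 1 := by
        gcongr
        exact (Metric.mem_ball.1 hu).le.trans ((min_le_right _ _).trans (by norm_num))
      have h3 := abs_sub_abs_le_abs_sub (actionDensity H t (flowAt α Φ t (ψ.symm u)))
        (actionDensity H t (flowAt α Φ t q₀))
      linarith
    have hJae : ∀ {p : ℝ → Prop}, (∀ᵐ t ∂(volume.restrict J), p t) → ∀ {s t : ℝ}, s ∈ J → t ∈ J →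
        ∀ᵐ x, x ∈ uIoc s t → p x := by
      intro p hp s t hs ht
      have hp' := (ae_restrict_iff' hJ.measurableSet).1 hp
      filter_upwards [hp'] with x hx hxs
      exact hx (hJc.uIcc_subset hs ht (uIoc_subset_uIcc hxs))
    -- `θ` integrates from time zero, which may lie outside the box, so the Lipschitz constant of
    -- the density must be uniform over almost all of `J`. On the box `|t| ≤ |t₁| + 1`.
    have hsub : ∀ t ∈ Icc (t₁ - r) (t₁ + r), ∀ u ∈ Metric.ball (ψ q₀) r,
        ∀ v ∈ Metric.ball (ψ q₀) r,
        |thetaGraph α H Φ (t, ψ.symm u) - thetaGraph α H Φ (t, ψ.symm v)| ≤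
          (D + C * (|t₁| + 1)) * dist u v := by
      intro t ht u hu v hv
      have h1 : |α (ψ.symm u) - α (ψ.symm v)| ≤ D * dist u v :=
        hD.dist_le_mul _ (key t ht u hu).2.2.2 _ (key t ht v hv).2.2.2
      have h2 : |∫ s in (0 : ℝ)..t, (actionDensity H s (flowAt α Φ s (ψ.symm u)) -
          actionDensity H s (flowAt α Φ s (ψ.symm v)))| ≤ C * dist u v * |t - 0| := by
        rw [← Real.norm_eq_abs]
        refine intervalIntegral.norm_integral_le_of_norm_le_const_ae ?_
        filter_upwards [hJae hGu hJ0 (hI ht)] with x hx hxs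
        exact hx hxs u hu v hv
      have h3 : |t - 0| ≤ |t₁| + 1 := by
        have : |t - t₁| ≤ 1 := by
          have : r ≤ 1 / 2 := min_le_right _ _
          refine abs_le.2 ⟨?_, ?_⟩ <;> linarith [ht.1, ht.2]
        have := abs_sub_abs_le_abs_sub t t₁
        rw [sub_zero]
        linarith
      rw [intervalIntegral.integral_sub
        (hH.intervalIntegrable_actionDensity hJc (key t ht u hu).1.2.2 hJ0 (hI ht))
        (hH.intervalIntegrable_actionDensity hJc (key t ht v hv).1.2.2 hJ0 (hI ht))] at h2
      have h4 : C * dist u v * |t - 0| ≤ C * dist u v * (|t₁| + 1) := by gcongr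
      have e : thetaGraph α H Φ (t, ψ.symm u) - thetaGraph α H Φ (t, ψ.symm v) =
          (α (ψ.symm u) - α (ψ.symm v)) +
          ((∫ s in (0 : ℝ)..t, actionDensity H s (flowAt α Φ s (ψ.symm u))) -
            ∫ s in (0 : ℝ)..t, actionDensity H s (flowAt α Φ s (ψ.symm v))) := by
        change (α (ψ.symm u) + ∫ s in (0 : ℝ)..t, actionDensity H s (flowAt α Φ s (ψ.symm u))) -
          (α (ψ.symm v) + ∫ s in (0 : ℝ)..t, actionDensity H s (flowAt α Φ s (ψ.symm v))) = _
        ring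
      rw [e]
      refine (abs_add_le _ _).trans ((add_le_add h1 (h2.trans h4)).trans_eq (by ring))
    have htime : ∀ t ∈ Icc (t₁ - r) (t₁ + r), ∀ t' ∈ Icc (t₁ - r) (t₁ + r),
        ∀ u ∈ Metric.ball (ψ q₀) r,
        |thetaGraph α H Φ (t, ψ.symm u) - thetaGraph α H Φ (t', ψ.symm u)| ≤
          (C₀ + C) * |t - t'| := by
      intro t ht t' ht' u hu
      rw [hH.thetaGraph_sub hJc hJ0 (key t ht u hu).1.2.2 (hI ht') (hI ht), ← Real.norm_eq_abs]
      refine intervalIntegral.norm_integral_le_of_norm_le_const_ae ?_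
      filter_upwards [hJae hbd (hI ht') (hI ht)] with x hx hxs
      exact hx hxs u hu
    refine ⟨D + C * (‖t₁‖₊ + 1) + (‖C₀‖₊ + C), LipschitzOnWith.of_dist_le_mul ?_⟩
    rintro ⟨t, u⟩ ⟨ht, hu⟩ ⟨t', u'⟩ ⟨ht', hu'⟩
    have h1 := hsub t ht u hu u' hu'
    have h2 := htime t ht t' ht' u' hu'
    have h3 : (C₀ + C) * |t - t'| ≤ (|C₀| + C) * |t - t'| := by
      gcongr
      exact le_abs_self _
    have h4 : |t - t'| ≤ dist ((t, u) : ℝ × Model n) (t', u') := le_max_left (dist t t') _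
    have h5 : dist u u' ≤ dist ((t, u) : ℝ × Model n) (t', u') := le_max_right (dist t t') _
    rw [Real.dist_eq]
    refine (abs_sub_le _ (thetaGraph α H Φ (t, ψ.symm u')) _).trans ?_
    push_cast
    rw [add_mul, Real.norm_eq_abs, Real.norm_eq_abs]
    refine add_le_add (h1.trans ?_) ((h2.trans h3).trans ?_) <;> gcongr

end CartanForm

namespace CartanForm

open AffineMap (lineMap)

variable {n : ℕ} {M : Type*} [TopologicalSpace M] [ChartedSpace (Model n) M]
  [IsManifold (𝓡 n) ∞ M]

/-! ### The action as a primitive along segments, for all times -/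

omit [TopologicalSpace M] [ChartedSpace (Model n) M] [IsManifold (𝓡 n) ∞ M] in
theorem hasDerivAt_of_hasMFDerivAt {g : ℝ → ℝ} {s : ℝ} {L : ℝ →L[ℝ] ℝ}
    (h : HasMFDerivAt 𝓘(ℝ, ℝ) 𝓘(ℝ, ℝ) g s L) : HasDerivAt g (L 1) s := by
  have h' : HasFDerivAt g L s := h.hasFDerivAt
  exact h'.hasDerivAt

theorem hasMFDerivAt_liouvillePotential_comp {E : Type*} [NormedAddCommGroup E] [NormedSpace ℝ E]
    {A : Type*} [TopologicalSpace A] {I : ModelWithCorners ℝ E A} {X : Type*} [TopologicalSpace X]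
    [ChartedSpace A X] {f : X → CotangentBundle n M} {x : X} {ℓ₀ : CotangentBundle n M}
    (h : f x ∈ (extChartAt (cotModel n) ℓ₀).source) (hf : MDifferentiableAt I (cotModel n) f x) :
    HasMFDerivAt I 𝓘(ℝ, ℝ) (fun x' => liouvillePotential ℓ₀ (f x) (f x')) x
      (pullbackForm I (cotModel n) f liouvilleForm x) :=
  (hasMFDerivAt_liouvillePotential h).comp x hf.hasMFDerivAt

theorem hasDerivAt_liouvillePotential_comp {f : ℝ → CotangentBundle n M} {s : ℝ}
    {ℓ₀ : CotangentBundle n M} (h : f s ∈ (extChartAt (cotModel n) ℓ₀).source)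
    (hf : MDifferentiableAt 𝓘(ℝ, ℝ) (cotModel n) f s) :
    HasDerivAt (fun s' => liouvillePotential ℓ₀ (f s) (f s'))
      (pullbackForm 𝓘(ℝ, ℝ) (cotModel n) f liouvilleForm s (1 : ℝ)) s :=
  hasDerivAt_of_hasMFDerivAt (hasMFDerivAt_liouvillePotential_comp h hf)

theorem mdifferentiableAt_curve_of_chart {f : ℝ → CotangentBundle n M} {s : ℝ}
    {ℓ₀ : CotangentBundle n M} (h : ∀ᶠ s' in 𝓝 s, f s' ∈ (extChartAt (cotModel n) ℓ₀).source)
    (hf : DifferentiableAt ℝ (fun s' => extChartAt (cotModel n) ℓ₀ (f s')) s) :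
    MDifferentiableAt 𝓘(ℝ, ℝ) (cotModel n) f s :=
  mdifferentiableAt_of_chart (x₀ := s) (mem_extChartAt_source s) h hf

/-- At a point of `Λ` the covector is `dα(q)` itself, so `ℓ ∘ π_*` is the chain rule for `α ∘ π`.
This is the initial condition for the propagation in time. -/
theorem hasMFDerivAt_comp_proj {α : M → ℝ} {q : M} (h : MDifferentiableAt (𝓡 n) 𝓘(ℝ, ℝ) α q) :
    HasMFDerivAt (cotModel n) 𝓘(ℝ, ℝ) (fun z : CotangentBundle n M => α z.proj)
      (dSection (n := n) α q) (liouvilleForm (dSection (n := n) α q)) := by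
  have hπ : MDifferentiableAt (cotModel n) (𝓡 n) (fun z : CotangentBundle n M => z.proj)
      (dSection (n := n) α q) :=
    Bundle.mdifferentiableAt_proj (fun x : M => TangentSpace (𝓡 n) x →L[ℝ] ℝ)
  have h' : HasMFDerivAt (𝓡 n) 𝓘(ℝ, ℝ) α (dSection (n := n) α q).proj
    (mfderiv (𝓡 n) 𝓘(ℝ, ℝ) α q) := h.hasMFDerivAt
  exact h'.comp _ hπ.hasMFDerivAt

variable {α : M → ℝ} {U : Set M} {J : Set ℝ} {O : Set (CotangentBundle n M)}
  {H : ℝ → CotangentBundle n M → ℝ} {Φ : ℝ → CotangentBundle n M → CotangentBundle n M}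

variable (α H Φ) in
/-- Almost everywhere along every segment of `B` in the preferred chart at `q₀`, the flow at time
`t` is differentiable and the derivative of the action is given by the Liouville form. -/
def SegmentPrimitive (q₀ : M) (B : Set (Model n)) (t : ℝ) : Prop :=
  ∀ u ∈ B, ∀ v ∈ B, ∀ᵐ s : ℝ, s ∈ Ioo (0 : ℝ) 1 →
    MDifferentiableAt 𝓘(ℝ, ℝ) (cotModel n)
      (fun s' : ℝ => flowAt α Φ t ((extChartAt (𝓡 n) q₀).symm (lineMap u v s'))) s ∧
    HasDerivAt (fun s' : ℝ => thetaGraph α H Φ (t, (extChartAt (𝓡 n) q₀).symm (lineMap u v s')))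
      (pullbackForm 𝓘(ℝ, ℝ) (cotModel n)
        (fun s' : ℝ => flowAt α Φ t ((extChartAt (𝓡 n) q₀).symm (lineMap u v s')))
        liouvilleForm s (1 : ℝ)) s

theorem SegmentPrimitive.mono {q₀ : M} {B B' : Set (Model n)} {t : ℝ}
    (h : SegmentPrimitive α H Φ q₀ B t) (hs : B' ⊆ B) : SegmentPrimitive α H Φ q₀ B' t :=
  fun u hu v hv => h u (hs hu) v (hs hv)

namespace FlowBox

variable {ℓ₀ : CotangentBundle n M} {q₀ : M} {a b r : ℝ} {K : ℝ≥0}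

theorem ae_mdifferentiableAt_segment (h : FlowBox α U J H Φ ℓ₀ q₀ a b r K) {t : ℝ}
    (ht : t ∈ Icc a b) {u v : Model n} (hu : u ∈ Metric.ball (extChartAt (𝓡 n) q₀ q₀) r)
    (hv : v ∈ Metric.ball (extChartAt (𝓡 n) q₀ q₀) r) : ∀ᵐ s : ℝ, s ∈ Ioo (0 : ℝ) 1 →
      MDifferentiableAt 𝓘(ℝ, ℝ) (cotModel n)
        (fun s' : ℝ => flowAt α Φ t ((extChartAt (𝓡 n) q₀).symm (lineMap u v s'))) s := by
  have hmem : ∀ s ∈ Icc (0 : ℝ) 1, lineMap u v s ∈ Metric.ball (extChartAt (𝓡 n) q₀ q₀) r :=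
    fun s hs => lineMap_mem_of_convex (convex_ball _ _) hu hv hs
  have hL : LipschitzOnWith (K * nndist u v) (fun s : ℝ => extChartAt (cotModel n) ℓ₀
      (flowAt α Φ t ((extChartAt (𝓡 n) q₀).symm (lineMap u v s)))) (Icc 0 1) :=
    (h.flow.lip_param ht).comp (lipschitzWith_lineMap u v).lipschitzOnWith hmem
  have hd := hL.ae_differentiableAt_Icc
  rw [ae_restrict_iff' measurableSet_Icc] at hd
  filter_upwards [hd] with s hs hs1
  refine mdifferentiableAt_curve_of_chart (ℓ₀ := ℓ₀) ?_ (hs (Ioo_subset_Icc_self hs1)).1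
  filter_upwards [Icc_mem_nhds hs1.1 hs1.2] with s' hs'
  exact h.source t ht _ (hmem s' hs')

/-- `SegmentPrimitive` refers to no chart of `T^*M`, so it passes between flow boxes with different
natural charts; `PrimitiveAlongSegments` is its expression in one chart, to which the estimates
apply. The two differ by the derivative of `liouvillePotential` along the segment. -/
theorem segmentPrimitive_iff (h : FlowBox α U J H Φ ℓ₀ q₀ a b r K) {t : ℝ} (ht : t ∈ Icc a b) :
    SegmentPrimitive α H Φ q₀ (Metric.ball (extChartAt (𝓡 n) q₀ q₀) r) t ↔
    PrimitiveAlongSegments (Metric.ball (extChartAt (𝓡 n) q₀ q₀) r)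
      (fun u => thetaGraph α H Φ (t, (extChartAt (𝓡 n) q₀).symm u))
      (fun u => extChartAt (cotModel n) ℓ₀ (flowAt α Φ t ((extChartAt (𝓡 n) q₀).symm u))) := by
  have hpot : ∀ u ∈ Metric.ball (extChartAt (𝓡 n) q₀ q₀) r,
      ∀ v ∈ Metric.ball (extChartAt (𝓡 n) q₀ q₀) r, ∀ᵐ s : ℝ, s ∈ Ioo (0 : ℝ) 1 →
      HasDerivAt (fun s' : ℝ => liouvillePotential ℓ₀
          (flowAt α Φ t ((extChartAt (𝓡 n) q₀).symm (lineMap u v s)))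
          (flowAt α Φ t ((extChartAt (𝓡 n) q₀).symm (lineMap u v s'))))
        (pullbackForm 𝓘(ℝ, ℝ) (cotModel n)
          (fun s' : ℝ => flowAt α Φ t ((extChartAt (𝓡 n) q₀).symm (lineMap u v s')))
          liouvilleForm s (1 : ℝ)) s := by
    intro u hu v hv
    filter_upwards [h.ae_mdifferentiableAt_segment ht hu hv] with s hs hs1
    exact hasDerivAt_liouvillePotential_comp
      (f := fun s' : ℝ => flowAt α Φ t ((extChartAt (𝓡 n) q₀).symm (lineMap u v s'))) (h.source t ht _
      (lineMap_mem_of_convex (convex_ball _ _) hu hv (Ioo_subset_Icc_self hs1))) (hs hs1)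
  have hiff : PrimitiveAlongSegments (Metric.ball (extChartAt (𝓡 n) q₀ q₀) r)
      (fun u => thetaGraph α H Φ (t, (extChartAt (𝓡 n) q₀).symm u))
      (fun u => extChartAt (cotModel n) ℓ₀ (flowAt α Φ t ((extChartAt (𝓡 n) q₀).symm u))) ↔
      ∀ u ∈ Metric.ball (extChartAt (𝓡 n) q₀ q₀) r,
      ∀ v ∈ Metric.ball (extChartAt (𝓡 n) q₀ q₀) r, ∀ᵐ s : ℝ, s ∈ Ioo (0 : ℝ) 1 →
      HasDerivAt (fun s' : ℝ => thetaGraph α H Φ (t, (extChartAt (𝓡 n) q₀).symm (lineMap u v s')) -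
        liouvillePotential ℓ₀
          (flowAt α Φ t ((extChartAt (𝓡 n) q₀).symm (lineMap u v s)))
          (flowAt α Φ t ((extChartAt (𝓡 n) q₀).symm (lineMap u v s')))) 0 s := Iff.rfl
  rw [hiff]
  constructor
  · intro hP u hu v hv
    filter_upwards [hP u hu v hv, hpot u hu v hv] with s h1 h2 hs
    have h3 := (h1 hs).2.sub (h2 hs)
    rw [sub_self] at h3
    exact h3
  · intro hP u hu v hv
    filter_upwards [hP u hu v hv, hpot u hu v hv, h.ae_mdifferentiableAt_segment ht hu hv]
      with s h1 h2 h3 hs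
    refine ⟨h3 hs, ?_⟩
    have h4 := (h1 hs).add (h2 hs)
    rw [zero_add] at h4
    refine h4.congr_of_eventuallyEq (Eventually.of_forall fun s' => ?_)
    exact (sub_add_cancel _ _).symm

theorem theta_sub (h : FlowBox α U J H Φ ℓ₀ q₀ a b r K)
    (hH : HamiltonianFlowAssumption J α U O H Φ) (hJc : J.OrdConnected) (hJ0 : (0 : ℝ) ∈ J) :
    ∀ t₀ ∈ Icc a b, ∀ t₁ ∈ Icc a b, ∀ u ∈ Metric.ball (extChartAt (𝓡 n) q₀ q₀) r,
      thetaGraph α H Φ (t₁, (extChartAt (𝓡 n) q₀).symm u) -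
        thetaGraph α H Φ (t₀, (extChartAt (𝓡 n) q₀).symm u) =
      ∫ t in t₀..t₁, actionDensity H t (flowAt α Φ t ((extChartAt (𝓡 n) q₀).symm u)) :=
  fun _ h₀ _ h₁ u hu =>
    hH.thetaGraph_sub hJc hJ0 (h.mem u hu) (h.interval h₀) (h.interval h₁)

theorem segmentPrimitive (h : FlowBox α U J H Φ ℓ₀ q₀ a b r K)
    (hH : HamiltonianFlowAssumption J α U O H Φ) (hJc : J.OrdConnected) (hJ0 : (0 : ℝ) ∈ J)
    {t₀ t₁ : ℝ} (h₀ : t₀ ∈ Icc a b) (h₁ : t₁ ∈ Icc a b)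
    (hP : SegmentPrimitive α H Φ q₀ (Metric.ball (extChartAt (𝓡 n) q₀ q₀) r) t₀) :
    SegmentPrimitive α H Φ q₀ (Metric.ball (extChartAt (𝓡 n) q₀ q₀) r) t₁ :=
  (h.segmentPrimitive_iff h₁).2 (h.flow.primitiveAlongSegments (convex_ball _ _)
    (θ := fun t u => thetaGraph α H Φ (t, (extChartAt (𝓡 n) q₀).symm u))
    (h.theta_sub hH hJc hJ0) h₀ h₁ ((h.segmentPrimitive_iff h₀).1 hP))

theorem segmentPrimitive_zero (h : FlowBox α U J H Φ ℓ₀ q₀ a b r K)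
    (hH : HamiltonianFlowAssumption J α U O H Φ) (hU : IsOpen U)
    (hα : ContMDiffOn (𝓡 n) 𝓘(ℝ, ℝ) ∞ α U) (h0 : (0 : ℝ) ∈ Icc a b) :
    SegmentPrimitive α H Φ q₀ (Metric.ball (extChartAt (𝓡 n) q₀ q₀) r) 0 := by
  intro u hu v hv
  filter_upwards [h.ae_mdifferentiableAt_segment h0 hu hv] with s hs hs1
  refine ⟨hs hs1, ?_⟩
  have hmem : ∀ s ∈ Icc (0 : ℝ) 1, (extChartAt (𝓡 n) q₀).symm (lineMap u v s) ∈ U :=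
    fun s hs => h.mem _ (lineMap_mem_of_convex (convex_ball _ _) hu hv hs)
  have hflow : ∀ q ∈ U, flowAt α Φ 0 q = dSection (n := n) α q := fun q hq =>
    hH.initial _ (mem_image_of_mem _ hq)
  set f : ℝ → CotangentBundle n M :=
    fun s' : ℝ => flowAt α Φ 0 ((extChartAt (𝓡 n) q₀).symm (lineMap u v s')) with hf
  have hfs : f s = dSection (n := n) α ((extChartAt (𝓡 n) q₀).symm (lineMap u v s)) :=
    hflow _ (hmem s (Ioo_subset_Icc_self hs1))
  have h1 : HasMFDerivAt (cotModel n) 𝓘(ℝ, ℝ) (fun z : CotangentBundle n M => α z.proj) (f s)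
      (liouvilleForm (f s)) := by
    rw [hfs]
    exact hasMFDerivAt_comp_proj (((hα.contMDiffAt (hU.mem_nhds
      (hmem s (Ioo_subset_Icc_self hs1)))).mdifferentiableAt (by simp)))
  have h2 : HasDerivAt (fun s' => α (f s').proj)
      (pullbackForm 𝓘(ℝ, ℝ) (cotModel n) f liouvilleForm s (1 : ℝ)) s :=
    hasDerivAt_of_hasMFDerivAt (h1.comp s (hs hs1).hasMFDerivAt)
  refine h2.congr_of_eventuallyEq ?_
  filter_upwards [Icc_mem_nhds hs1.1 hs1.2] with s' hs'
  have e1 : (f s').proj = (extChartAt (𝓡 n) q₀).symm (lineMap u v s') := by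
    rw [hf]
    simp only
    rw [hflow _ (hmem s' hs')]
    rfl
  rw [e1]
  change α _ + (∫ x in (0 : ℝ)..0, _) = _
  rw [intervalIntegral.integral_same, add_zero]
  rfl

end FlowBox

/-- The property holds at time zero and every flow box transports it in both directions, so
connectedness of `J` brings it to `t₁`. The radius may shrink on the way; hence `Q` asks only for
some positive radius. -/
theorem HamiltonianFlowAssumption.exists_flowBox_primitive
    (hH : HamiltonianFlowAssumption J α U O H Φ)
    (hU : IsOpen U) (hα : ContMDiffOn (𝓡 n) 𝓘(ℝ, ℝ) ∞ α U) (hJ : IsOpen J)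
    (hJc : J.OrdConnected) (hJ0 : (0 : ℝ) ∈ J) {t₁ : ℝ} (ht₁ : t₁ ∈ J) {q₀ : M} (hq₀ : q₀ ∈ U) :
    ∃ a b r : ℝ, ∃ K : ℝ≥0, a < t₁ ∧ t₁ < b ∧
      FlowBox α U J H Φ (flowAt α Φ t₁ q₀) q₀ a b r K ∧
      ∀ t ∈ Icc a b, SegmentPrimitive α H Φ q₀ (Metric.ball (extChartAt (𝓡 n) q₀ q₀) r) t := by
  set Q : ℝ → Prop := fun t => ∃ r, 0 < r ∧
    SegmentPrimitive α H Φ q₀ (Metric.ball (extChartAt (𝓡 n) q₀ q₀) r) t with hQ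
  have step : ∀ {a b r : ℝ} {K : ℝ≥0} {ℓ₀ : CotangentBundle n M},
      FlowBox α U J H Φ ℓ₀ q₀ a b r K → ∀ t ∈ Icc a b, ∀ t' ∈ Icc a b, Q t → Q t' := by
    rintro a b r K ℓ₀ hbox t ht t' ht' ⟨r', hr', hP⟩
    have hr0 := hbox.radius_pos
    refine ⟨min r r', lt_min hr0 hr', ?_⟩
    exact (hbox.mono_radius (lt_min hr0 hr') (min_le_left _ _)).segmentPrimitive hH hJc hJ0 ht ht'
      (hP.mono (Metric.ball_subset_ball (min_le_right _ _)))
  have hQ0 : Q 0 := by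
    obtain ⟨a, b, r, K, ha, hb, hbox⟩ := hH.exists_flowBox hU hα hJ hJc hJ0 hJ0 hq₀
    exact ⟨r, hbox.radius_pos, hbox.segmentPrimitive_zero hH hU hα ⟨ha.le, hb.le⟩⟩
  have hQ1 : Q t₁ := by
    refine hJc.isPreconnected.induction₂' (fun t t' => Q t → Q t') (fun t ht => ?_)
      (fun x y z _ _ _ hxy hyz h => hyz (hxy h)) hJ0 ht₁ hQ0
    obtain ⟨a, b, r, K, ha, hb, hbox⟩ := hH.exists_flowBox hU hα hJ hJc hJ0 ht hq₀
    filter_upwards [mem_nhdsWithin_of_mem_nhds (Icc_mem_nhds ha hb)] with t' ht'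
    exact ⟨step hbox t ⟨ha.le, hb.le⟩ t' ht', step hbox t' ht' t ⟨ha.le, hb.le⟩⟩
  obtain ⟨r', hr', hP⟩ := hQ1
  obtain ⟨a, b, r, K, ha, hb, hbox⟩ := hH.exists_flowBox hU hα hJ hJc hJ0 ht₁ hq₀
  have hbox' := hbox.mono_radius (lt_min hbox.radius_pos hr') (min_le_left r r')
  exact ⟨a, b, min r r', K, ha, hb, hbox', fun t ht => hbox'.segmentPrimitive hH hJc hJ0
    ⟨ha.le, hb.le⟩ ht (hP.mono (Metric.ball_subset_ball (min_le_right _ _)))⟩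

end CartanForm

namespace CartanForm

variable {n : ℕ} {M : Type*} [TopologicalSpace M] [ChartedSpace (Model n) M]
  [IsManifold (𝓡 n) ∞ M]

/-! ### The action as a primitive of the Cartan form, almost everywhere -/

variable {α : M → ℝ} {U : Set M} {J : Set ℝ} {O : Set (CotangentBundle n M)}
  {H : ℝ → CotangentBundle n M → ℝ} {Φ : ℝ → CotangentBundle n M → CotangentBundle n M}

theorem hasMFDerivAt_cartanPotential_comp (H : ℝ → CotangentBundle n M → ℝ) {E : Type*}
    [NormedAddCommGroup E] [NormedSpace ℝ E] {A : Type*} [TopologicalSpace A]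
    {I : ModelWithCorners ℝ E A} {X : Type*} [TopologicalSpace X] [ChartedSpace A X]
    {f : X → ℝ × CotangentBundle n M} {x : X} {ℓ₀ : CotangentBundle n M}
    (h : (f x).2 ∈ (extChartAt (cotModel n) ℓ₀).source)
    (hf : MDifferentiableAt I (𝓘(ℝ, ℝ).prod (cotModel n)) f x) :
    HasMFDerivAt I 𝓘(ℝ, ℝ)
      (fun x' => liouvillePotential ℓ₀ (f x).2 (f x').2 - H (f x).1 (f x).2 * (f x').1) x
      (pullbackForm I (𝓘(ℝ, ℝ).prod (cotModel n)) f (cartanForm H) x) :=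
  (hasMFDerivAt_cartanPotential H h).comp x hf.hasMFDerivAt

theorem eq_mfderiv_of_hasMFDerivAt_sub {E : Type*} [NormedAddCommGroup E] [NormedSpace ℝ E]
    {A : Type*} [TopologicalSpace A] {I : ModelWithCorners ℝ E A} {X : Type*} [TopologicalSpace X]
    [ChartedSpace A X] {f g : X → ℝ} {x : X} {L : TangentSpace I x →L[ℝ] ℝ}
    (h : HasMFDerivAt I 𝓘(ℝ, ℝ) (fun x' => f x' - g x') x (0 : TangentSpace I x →L[ℝ] ℝ))
    (hg : HasMFDerivAt I 𝓘(ℝ, ℝ) g x L) :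
    MDifferentiableAt I 𝓘(ℝ, ℝ) f x ∧ L = mfderiv I 𝓘(ℝ, ℝ) f x := by
  have e : HasMFDerivAt I 𝓘(ℝ, ℝ) f x L := by
    refine ((h.add hg).congr_of_eventuallyEq (Eventually.of_forall fun x' => ?_)).congr_mfderiv ?_
    · exact (sub_add_cancel _ _).symm
    · exact zero_add L
  exact ⟨e.mdifferentiableAt, e.mfderiv.symm⟩

omit [IsManifold (𝓡 n) ∞ M] in
theorem extChartAt_prod_apply (t₁ : ℝ) (q₀ : M) (z : ℝ × M) :
    extChartAt (𝓘(ℝ, ℝ).prod (𝓡 n)) (t₁, q₀) z = (z.1, extChartAt (𝓡 n) q₀ z.2) := by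
  rw [extChartAt_prod, extChartAt_model_space_eq_id]
  rfl

omit [IsManifold (𝓡 n) ∞ M] in
theorem extChartAt_prod_symm_apply (t₁ : ℝ) (q₀ : M) (x : ℝ × Model n) :
    (extChartAt (𝓘(ℝ, ℝ).prod (𝓡 n)) (t₁, q₀)).symm x = (x.1, (extChartAt (𝓡 n) q₀).symm x.2) := by
  rw [extChartAt_prod, extChartAt_model_space_eq_id]
  rfl

omit [IsManifold (𝓡 n) ∞ M] in
theorem mem_extChartAt_prod_source {t₁ : ℝ} {q₀ : M} {z : ℝ × M} :
    z ∈ (extChartAt (𝓘(ℝ, ℝ).prod (𝓡 n)) (t₁, q₀)).source ↔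
      z.2 ∈ (extChartAt (𝓡 n) q₀).source := by
  rw [extChartAt_prod, extChartAt_model_space_eq_id]
  exact ⟨fun h => h.2, fun h => ⟨trivial, h⟩⟩

theorem isAddHaarMeasure_volume_prod (n : ℕ) :
    (volume : Measure (ℝ × Model n)).IsAddHaarMeasure :=
  Measure.prod.instIsAddHaarMeasure (volume : Measure ℝ) (volume : Measure (Model n))

namespace FlowBox

variable {ℓ₀ : CotangentBundle n M} {q₀ : M} {a b r : ℝ} {K : ℝ≥0}

theorem dist_le_one (h : FlowBox α U J H Φ ℓ₀ q₀ a b r K) :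
    ∀ u ∈ Metric.ball (extChartAt (𝓡 n) q₀ q₀) r,
    ∀ v ∈ Metric.ball (extChartAt (𝓡 n) q₀ q₀) r, dist u v ≤ 1 := by
  intro u hu v hv
  have h1 := dist_triangle_right u v (extChartAt (𝓡 n) q₀ q₀)
  have h2 := h.radius_le
  rw [Metric.mem_ball] at hu hv
  linarith

theorem abs_sub_le (h : FlowBox α U J H Φ ℓ₀ q₀ a b r K)
    (hP : ∀ t ∈ Icc a b, SegmentPrimitive α H Φ q₀ (Metric.ball (extChartAt (𝓡 n) q₀ q₀) r) t) :
    ∀ t ∈ Icc a b, ∀ u ∈ Metric.ball (extChartAt (𝓡 n) q₀ q₀) r,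
    ∀ v ∈ Metric.ball (extChartAt (𝓡 n) q₀ q₀) r,
      |thetaGraph α H Φ (t, (extChartAt (𝓡 n) q₀).symm v) -
          thetaGraph α H Φ (t, (extChartAt (𝓡 n) q₀).symm u) -
        (extChartAt (cotModel n) ℓ₀ (flowAt α Φ t ((extChartAt (𝓡 n) q₀).symm u))).2
          ((extChartAt (cotModel n) ℓ₀ (flowAt α Φ t ((extChartAt (𝓡 n) q₀).symm v))).1 -
          (extChartAt (cotModel n) ℓ₀ (flowAt α Φ t ((extChartAt (𝓡 n) q₀).symm u))).1)| ≤
        (K ^ 2 : ℝ≥0) * dist u v ^ 2 := by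
  intro t ht u hu v hv
  obtain ⟨D, hD⟩ := h.lip
  have hθ : LipschitzOnWith D (fun u => thetaGraph α H Φ (t, (extChartAt (𝓡 n) q₀).symm u))
      (Metric.ball (extChartAt (𝓡 n) q₀ q₀) r) := by
    refine LipschitzOnWith.of_dist_le_mul fun x hx y hy => ?_
    simpa [Prod.dist_eq] using hD.dist_le_mul (t, x) ⟨ht, hx⟩ (t, y) ⟨ht, hy⟩
  have := ((h.segmentPrimitive_iff ht).1 (hP t ht)).abs_sub_le (convex_ball _ _)
    (h.flow.lip_param ht) hθ hu hv
  push_cast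
  exact this

/-- The quadratic estimate gives a zero derivative at every point and every time of the box.
Rademacher's theorem is needed only for the differentiability of the flow. -/
theorem hasMFDerivAt_action (h : FlowBox α U J H Φ ℓ₀ q₀ a b r K)
    (hP : ∀ t ∈ Icc a b, SegmentPrimitive α H Φ q₀ (Metric.ball (extChartAt (𝓡 n) q₀ q₀) r) t)
    {t : ℝ} (ht : t ∈ Icc a b) {u : Model n}
    (hu : u ∈ Metric.ball (extChartAt (𝓡 n) q₀ q₀) r) :
    HasMFDerivAt (𝓡 n) 𝓘(ℝ, ℝ) (fun q => thetaGraph α H Φ (t, q) -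
      liouvillePotential ℓ₀ (flowAt α Φ t ((extChartAt (𝓡 n) q₀).symm u)) (flowAt α Φ t q))
      ((extChartAt (𝓡 n) q₀).symm u)
      (0 : TangentSpace (𝓡 n) ((extChartAt (𝓡 n) q₀).symm u) →L[ℝ] ℝ) := by
  refine hasMFDerivAt_zero_of_chart ((extChartAt (𝓡 n) q₀).map_target (h.target hu)) ?_
  rw [(extChartAt (𝓡 n) q₀).right_inv (h.target hu)]
  set g : Model n → ℝ := (fun q => thetaGraph α H Φ (t, q) -
      liouvillePotential ℓ₀ (flowAt α Φ t ((extChartAt (𝓡 n) q₀).symm u)) (flowAt α Φ t q)) ∘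
      (extChartAt (𝓡 n) q₀).symm with hg
  have h1 : (fun v => g v - g u) =O[𝓝 u] fun v => ‖v - u‖ ^ 2 := by
    refine Asymptotics.IsBigO.of_bound (K ^ 2 : ℝ≥0) ?_
    filter_upwards [Metric.isOpen_ball.mem_nhds hu] with v hv
    have := h.abs_sub_le hP t ht u hu v hv
    rw [norm_pow, norm_norm, ← dist_eq_norm v u, dist_comm v u, Real.norm_eq_abs]
    refine le_trans (le_of_eq ?_) this
    congr 1
    simp only [hg, Function.comp, liouvillePotential, map_sub]
    ring
  have h2 : HasFDerivAt (fun v => g v - g u) (0 : Model n →L[ℝ] ℝ) u := h1.hasFDerivAt one_lt_two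
  refine (h2.add_const (g u)).congr_of_eventuallyEq (Eventually.of_forall fun v => ?_)
  exact (sub_add_cancel _ _).symm

theorem ae_action (h : FlowBox α U J H Φ ℓ₀ q₀ a b r K)
    (hP : ∀ t ∈ Icc a b, SegmentPrimitive α H Φ q₀ (Metric.ball (extChartAt (𝓡 n) q₀ q₀) r) t)
    {t : ℝ} (ht : t ∈ Icc a b) :
    ∀ᵐ u, u ∈ Metric.ball (extChartAt (𝓡 n) q₀ q₀) r →
      MDifferentiableAt (𝓡 n) (cotModel n) (flowAt α Φ t) ((extChartAt (𝓡 n) q₀).symm u) ∧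
      MDifferentiableAt (𝓡 n) 𝓘(ℝ, ℝ) (fun q' => thetaGraph α H Φ (t, q'))
        ((extChartAt (𝓡 n) q₀).symm u) ∧
      pullbackForm (𝓡 n) (cotModel n) (flowAt α Φ t) liouvilleForm
        ((extChartAt (𝓡 n) q₀).symm u) =
        mfderiv (𝓡 n) 𝓘(ℝ, ℝ) (fun q' => thetaGraph α H Φ (t, q'))
          ((extChartAt (𝓡 n) q₀).symm u) := by
  have hR := (h.flow.lip_param ht).ae_differentiableWithinAt (μ := volume)
    Metric.isOpen_ball.measurableSet
  rw [ae_restrict_iff' Metric.isOpen_ball.measurableSet] at hR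
  filter_upwards [hR] with u hd hu
  have hn := Metric.isOpen_ball.mem_nhds hu
  have hd' := (hd hu).differentiableAt hn
  set q := (extChartAt (𝓡 n) q₀).symm u with hq
  have hqs : q ∈ (extChartAt (𝓡 n) q₀).source := (extChartAt (𝓡 n) q₀).map_target (h.target hu)
  have hqu : extChartAt (𝓡 n) q₀ q = u := (extChartAt (𝓡 n) q₀).right_inv (h.target hu)
  have hev : ∀ᶠ q' in 𝓝 q, flowAt α Φ t q' ∈ (extChartAt (cotModel n) ℓ₀).source := by
    have hc : ContinuousAt (extChartAt (𝓡 n) q₀) q := continuousAt_extChartAt' hqs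
    have h1 : ∀ᶠ q' in 𝓝 q, extChartAt (𝓡 n) q₀ q' ∈ Metric.ball (extChartAt (𝓡 n) q₀ q₀) r :=
      hc.eventually (by rwa [hqu])
    filter_upwards [h1, (isOpen_extChartAt_source q₀).mem_nhds hqs] with q' h1 h2
    have := h.source t ht _ h1
    rwa [(extChartAt (𝓡 n) q₀).left_inv h2] at this
  have hm : MDifferentiableAt (𝓡 n) (cotModel n) (flowAt α Φ t) q :=
    mdifferentiableAt_of_chart (y₀ := ℓ₀) hqs hev (by rw [hqu]; exact hd')
  exact ⟨hm, eq_mfderiv_of_hasMFDerivAt_sub (h.hasMFDerivAt_action hP ht hu)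
    (hasMFDerivAt_liouvillePotential_comp hev.self_of_nhds hm)⟩

theorem eventually_mem (h : FlowBox α U J H Φ ℓ₀ q₀ a b r K) {t : ℝ} (ht : t ∈ Ioo a b) {q : M}
    (hqs : q ∈ (extChartAt (𝓡 n) q₀).source)
    (hq : extChartAt (𝓡 n) q₀ q ∈ Metric.ball (extChartAt (𝓡 n) q₀ q₀) r) :
    ∀ᶠ z : ℝ × M in 𝓝 (t, q), z.1 ∈ Ioo a b ∧ z.2 ∈ (extChartAt (𝓡 n) q₀).source ∧
      extChartAt (𝓡 n) q₀ z.2 ∈ Metric.ball (extChartAt (𝓡 n) q₀ q₀) r ∧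
      flowAt α Φ z.1 z.2 ∈ (extChartAt (cotModel n) ℓ₀).source := by
  have hc : ContinuousAt (extChartAt (𝓡 n) q₀) q := continuousAt_extChartAt' hqs
  have h1 : ∀ᶠ q' in 𝓝 q, q' ∈ (extChartAt (𝓡 n) q₀).source ∧
      extChartAt (𝓡 n) q₀ q' ∈ Metric.ball (extChartAt (𝓡 n) q₀ q₀) r :=
    Filter.Eventually.and ((isOpen_extChartAt_source q₀).mem_nhds hqs)
      (hc.eventually (Metric.isOpen_ball.mem_nhds hq))
  have h2 : ∀ᶠ t' in 𝓝 t, t' ∈ Ioo a b := isOpen_Ioo.mem_nhds ht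
  rw [nhds_prod_eq]
  filter_upwards [h2.prod_mk h1] with z hz
  refine ⟨hz.1, hz.2.1, hz.2.2, ?_⟩
  have := h.source z.1 (Ioo_subset_Icc_self hz.1) _ hz.2.2
  rwa [(extChartAt (𝓡 n) q₀).left_inv hz.2.1] at this

theorem ae_hasFDerivAt_action (h : FlowBox α U J H Φ ℓ₀ q₀ a b r K)
    (hH : HamiltonianFlowAssumption J α U O H Φ) (hJc : J.OrdConnected) (hJ0 : (0 : ℝ) ∈ J)
    (hab : a ≤ b)
    (hP : ∀ t ∈ Icc a b, SegmentPrimitive α H Φ q₀ (Metric.ball (extChartAt (𝓡 n) q₀ q₀) r) t) :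
    ∀ᵐ t, t ∈ Ioo a b → ∀ u ∈ Metric.ball (extChartAt (𝓡 n) q₀ q₀) r,
      HasFDerivAt (fun x : ℝ × Model n =>
        thetaGraph α H Φ (x.1, (extChartAt (𝓡 n) q₀).symm x.2) -
        (liouvillePotential ℓ₀ (flowAt α Φ t ((extChartAt (𝓡 n) q₀).symm u))
          (flowAt α Φ x.1 ((extChartAt (𝓡 n) q₀).symm x.2)) -
        H t (flowAt α Φ t ((extChartAt (𝓡 n) q₀).symm u)) * x.1))
        (0 : ℝ × Model n →L[ℝ] ℝ) (t, u) := by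
  filter_upwards [h.flow.hasFDerivAt_action (h.theta_sub hH hJc hJ0) (h.abs_sub_le hP) hab
    (convex_ball _ _) Metric.isOpen_ball h.dist_le_one] with t ht hti u hu
  have h1 := ht hti u hu
  simp only [Function.comp] at h1
  rw [(extChartAt (cotModel n) ℓ₀).left_inv (h.source t (Ioo_subset_Icc_self hti) u hu)] at h1
  refine h1.congr_of_eventuallyEq (Eventually.of_forall fun x => ?_)
  simp only [liouvillePotential]
  ring

theorem mdifferentiableAt_flowGraph (h : FlowBox α U J H Φ ℓ₀ q₀ a b r K) {t : ℝ}
    (ht : t ∈ Ioo a b) {u : Model n} (hu : u ∈ Metric.ball (extChartAt (𝓡 n) q₀ q₀) r)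
    (hd : DifferentiableAt ℝ (fun x : ℝ × Model n => extChartAt (cotModel n) ℓ₀
      (flowAt α Φ x.1 ((extChartAt (𝓡 n) q₀).symm x.2))) (t, u)) :
    MDifferentiableAt (𝓘(ℝ, ℝ).prod (𝓡 n)) (𝓘(ℝ, ℝ).prod (cotModel n)) (flowGraph α Φ)
      (t, (extChartAt (𝓡 n) q₀).symm u) := by
  have hqs := (extChartAt (𝓡 n) q₀).map_target (h.target hu)
  have hqu := (extChartAt (𝓡 n) q₀).right_inv (h.target hu)
  have h1 : MDifferentiableAt (𝓘(ℝ, ℝ).prod (𝓡 n)) 𝓘(ℝ, ℝ) (Prod.fst : ℝ × M → ℝ)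
    (t, (extChartAt (𝓡 n) q₀).symm u) := mdifferentiableAt_fst
  refine h1.prodMk (mdifferentiableAt_of_chart (x₀ := (t, q₀)) (y₀ := ℓ₀)
    (mem_extChartAt_prod_source.2 hqs) ?_ ?_)
  · filter_upwards [h.eventually_mem ht hqs (by rwa [hqu])] with z hz
    exact hz.2.2.2
  · rw [extChartAt_prod_apply]
    simp only
    rw [hqu]
    refine hd.congr_of_eventuallyEq (Eventually.of_forall fun x => ?_)
    simp only [Function.comp]
    rw [extChartAt_prod_symm_apply]
    rfl

/-- Two null sets are discarded: the points where Rademacher's theorem fails for the flow in `(t,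
u)`, and the product of the exceptional times with the space of initial data. -/
theorem ae_cartan (h : FlowBox α U J H Φ ℓ₀ q₀ a b r K)
    (hH : HamiltonianFlowAssumption J α U O H Φ) (hJc : J.OrdConnected) (hJ0 : (0 : ℝ) ∈ J)
    (hab : a ≤ b)
    (hP : ∀ t ∈ Icc a b, SegmentPrimitive α H Φ q₀ (Metric.ball (extChartAt (𝓡 n) q₀ q₀) r) t) :
    ∀ᵐ x : ℝ × Model n, x ∈ Ioo a b ×ˢ Metric.ball (extChartAt (𝓡 n) q₀ q₀) r →
      MDifferentiableAt (𝓘(ℝ, ℝ).prod (𝓡 n)) (𝓘(ℝ, ℝ).prod (cotModel n))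
        (flowGraph α Φ) (x.1, (extChartAt (𝓡 n) q₀).symm x.2) ∧
      MDifferentiableAt (𝓘(ℝ, ℝ).prod (𝓡 n)) 𝓘(ℝ, ℝ) (thetaGraph α H Φ)
        (x.1, (extChartAt (𝓡 n) q₀).symm x.2) ∧
      pullbackForm (𝓘(ℝ, ℝ).prod (𝓡 n)) (𝓘(ℝ, ℝ).prod (cotModel n))
        (flowGraph α Φ) (cartanForm H) (x.1, (extChartAt (𝓡 n) q₀).symm x.2) =
        mfderiv (𝓘(ℝ, ℝ).prod (𝓡 n)) 𝓘(ℝ, ℝ) (thetaGraph α H Φ)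
          (x.1, (extChartAt (𝓡 n) q₀).symm x.2) := by
  set W := Ioo a b ×ˢ Metric.ball (extChartAt (𝓡 n) q₀ q₀) r with hW
  have hWo : IsOpen W := isOpen_Ioo.prod Metric.isOpen_ball
  have := isAddHaarMeasure_volume_prod n
  have hR := (h.flow.lip.mono (prod_mono Ioo_subset_Icc_self Subset.rfl :
    W ⊆ _)).ae_differentiableWithinAt (μ := (volume : Measure (ℝ × Model n))) hWo.measurableSet
  rw [ae_restrict_iff' hWo.measurableSet] at hR
  have hM := (Measure.quasiMeasurePreserving_fst (μ := (volume : Measure ℝ))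
    (ν := (volume : Measure (Model n)))).ae (h.ae_hasFDerivAt_action hH hJc hJ0 hab hP)
  filter_upwards [hR, hM] with x hx1 hx2 hxW
  obtain ⟨t, u⟩ := x
  have hd := (hx1 hxW).differentiableAt (hWo.mem_nhds hxW)
  have hm := h.mdifferentiableAt_flowGraph hxW.1 hxW.2 hd
  have hqs := (extChartAt (𝓡 n) q₀).map_target (h.target hxW.2)
  have hqu := (extChartAt (𝓡 n) q₀).right_inv (h.target hxW.2)
  refine ⟨hm, eq_mfderiv_of_hasMFDerivAt_sub ?_ (hasMFDerivAt_cartanPotential_comp H (ℓ₀ := ℓ₀)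
    (h.source t (Ioo_subset_Icc_self hxW.1) u hxW.2) hm)⟩
  refine hasMFDerivAt_zero_of_chart (x₀ := (t, q₀)) (mem_extChartAt_prod_source.2 hqs) ?_
  rw [extChartAt_prod_apply]
  simp only
  rw [hqu]
  refine (hx2 hxW.1 u hxW.2).congr_of_eventuallyEq (Eventually.of_forall fun x => ?_)
  simp only [Function.comp]
  rw [extChartAt_prod_symm_apply]
  rfl

theorem lipschitz_theta (h : FlowBox α U J H Φ ℓ₀ q₀ a b r K) {t₁ : ℝ} (ht : t₁ ∈ Ioo a b) :
    ∃ C : ℝ≥0, ∃ V ∈ 𝓝 (t₁, q₀), V ⊆ (extChartAt (𝓘(ℝ, ℝ).prod (𝓡 n)) (t₁, q₀)).source ∧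
      ∀ y ∈ V, ∀ z ∈ V, dist (thetaGraph α H Φ y) (thetaGraph α H Φ z) ≤
        C * dist (extChartAt (𝓘(ℝ, ℝ).prod (𝓡 n)) (t₁, q₀) y)
          (extChartAt (𝓘(ℝ, ℝ).prod (𝓡 n)) (t₁, q₀) z) := by
  obtain ⟨D, hD⟩ := h.lip
  refine ⟨D, _, h.eventually_mem ht (mem_extChartAt_source q₀)
    (Metric.mem_ball_self h.radius_pos), fun z hz => mem_extChartAt_prod_source.2 hz.2.1, ?_⟩
  rintro ⟨t, q⟩ hy ⟨t', q'⟩ hz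
  have := hD.dist_le_mul (t, extChartAt (𝓡 n) q₀ q) ⟨Ioo_subset_Icc_self hy.1, hy.2.2.1⟩
    (t', extChartAt (𝓡 n) q₀ q') ⟨Ioo_subset_Icc_self hz.1, hz.2.2.1⟩
  simp only at this
  rw [(extChartAt (𝓡 n) q₀).left_inv hy.2.1, (extChartAt (𝓡 n) q₀).left_inv hz.2.1] at this
  rw [extChartAt_prod_apply, extChartAt_prod_apply]
  exact this

end FlowBox

end CartanForm

namespace CartanForm

variable {n : ℕ} {M : Type*} [TopologicalSpace M] [ChartedSpace (Model n) M]
  [IsManifold (𝓡 n) ∞ M]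

/-! ### The action as a primitive of the Cartan form, along curves -/

variable {α : M → ℝ} {U : Set M} {J : Set ℝ} {O : Set (CotangentBundle n M)}
  {H : ℝ → CotangentBundle n M → ℝ} {Φ : ℝ → CotangentBundle n M → CotangentBundle n M}

namespace FlowBox

variable {ℓ₀ : CotangentBundle n M} {q₀ : M} {a b r : ℝ} {K : ℝ≥0}

/-- This covers the passage of a curve through an exceptional time. When the time component has zero
derivative, the error `dist u u' ^ 2 + |t' - t|` of `abs_action_sub_le` is `o(|s' - s|)`. -/
theorem hasDerivAt_action_of_deriv_time_eq_zero (h : FlowBox α U J H Φ ℓ₀ q₀ a b r K)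
    (hH : HamiltonianFlowAssumption J α U O H Φ) (hJc : J.OrdConnected) (hJ0 : (0 : ℝ) ∈ J)
    (hP : ∀ t ∈ Icc a b, SegmentPrimitive α H Φ q₀ (Metric.ball (extChartAt (𝓡 n) q₀ q₀) r) t)
    {c : ℝ → ℝ × Model n} {s : ℝ} {C : ℝ≥0}
    (hc : ∀ᶠ s' in 𝓝 s, c s' ∈ Icc a b ×ˢ Metric.ball (extChartAt (𝓡 n) q₀ q₀) r ∧
      dist (c s) (c s') ≤ C * |s' - s|)
    (hτ : HasDerivAt (fun s' => (c s').1) 0 s) :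
    HasDerivAt (fun s' => thetaGraph α H Φ ((c s').1, (extChartAt (𝓡 n) q₀).symm (c s').2) -
      liouvillePotential ℓ₀ (flowAt α Φ (c s).1 ((extChartAt (𝓡 n) q₀).symm (c s).2))
        (flowAt α Φ (c s').1 ((extChartAt (𝓡 n) q₀).symm (c s').2))) 0 s := by
  have hcs := hc.self_of_nhds.1
  obtain ⟨D, hD⟩ := h.flow.abs_action_sub_le
    (θ := fun t u => thetaGraph α H Φ (t, (extChartAt (𝓡 n) q₀).symm u))
    (h.theta_sub hH hJc hJ0) (h.abs_sub_le hP) h.dist_le_one hcs.1 hcs.2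
  rw [hasDerivAt_iff_isLittleO]
  have h1 : (fun s' => (c s').1 - (c s).1) =o[𝓝 s] fun s' => s' - s := by
    simpa using hasDerivAt_iff_isLittleO.1 hτ
  have h2 : (fun s' : ℝ => ‖s' - s‖ ^ 2) =o[𝓝 s] fun s' => s' - s :=
    Asymptotics.isLittleO_pow_sub_sub s one_lt_two
  have h3 := ((h2.const_mul_left ((C : ℝ) ^ 2)).add h1.norm_left).const_mul_left |D|
  refine (Asymptotics.IsBigO.of_bound 1 ?_).trans_isLittleO h3
  filter_upwards [hc] with s' hs'
  have h4 := hD _ hs'.1.1 _ hs'.1.2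
  have h5 : dist (c s).2 (c s').2 ≤ C * |s' - s| := le_trans (le_max_right _ _) hs'.2
  have h6 : dist (c s).2 (c s').2 ^ 2 ≤ C ^ 2 * |s' - s| ^ 2 := by
    rw [← mul_pow]
    gcongr
  rw [one_mul, Real.norm_eq_abs, Real.norm_eq_abs]
  calc _ = _ := by
        congr 1
        simp only [liouvillePotential, smul_zero, sub_zero, map_sub]
        ring
    _ ≤ _ := h4
    _ ≤ |D| * (dist (c s).2 (c s').2 ^ 2 + |(c s').1 - (c s).1|) := by
      gcongr
      exact le_abs_self D
    _ ≤ |D| * (C ^ 2 * |s' - s| ^ 2 + |(c s').1 - (c s).1|) := by gcongr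
    _ ≤ _ := le_abs_self _

/-- A curve is a null set and may stay at an exceptional time, so the identity almost everywhere on
`J × Λ` says nothing about it. At good times the chain rule applies, whatever the initial data; at
almost every parameter whose time is exceptional the time component is stationary, and the preceding
lemma applies. -/
theorem ae_hasDerivAt_curve (h : FlowBox α U J H Φ ℓ₀ q₀ a b r K)
    (hH : HamiltonianFlowAssumption J α U O H Φ) (hJc : J.OrdConnected) (hJ0 : (0 : ℝ) ∈ J)
    (hab : a ≤ b)
    (hP : ∀ t ∈ Icc a b, SegmentPrimitive α H Φ q₀ (Metric.ball (extChartAt (𝓡 n) q₀ q₀) r) t)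
    {c : ℝ → ℝ × M} {S : Set ℝ} (hS : IsOpen S) {C : ℝ≥0}
    (hL : LipschitzOnWith C (fun s => ((c s).1, extChartAt (𝓡 n) q₀ (c s).2)) S)
    (hc : ∀ s ∈ S, (c s).1 ∈ Ioo a b ∧ (c s).2 ∈ (extChartAt (𝓡 n) q₀).source ∧
      extChartAt (𝓡 n) q₀ (c s).2 ∈ Metric.ball (extChartAt (𝓡 n) q₀ q₀) r) :
    ∀ᵐ s, s ∈ S → HasDerivAt (fun s' => thetaGraph α H Φ (c s'))
      (pullbackForm 𝓘(ℝ, ℝ) (𝓘(ℝ, ℝ).prod (cotModel n)) (flowGraph α Φ ∘ c) (cartanForm H) s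
        (1 : ℝ)) s := by
  set ψ := extChartAt (𝓡 n) q₀ with hψ
  set ch : ℝ → ℝ × Model n := fun s => ((c s).1, ψ (c s).2) with hch
  have hmaps : MapsTo ch S (Icc a b ×ˢ Metric.ball (ψ q₀) r) :=
    fun s hs => ⟨Ioo_subset_Icc_self (hc s hs).1, (hc s hs).2.2⟩
  have hZ := h.flow.lip.comp hL hmaps
  have hN := h.ae_hasFDerivAt_action hH hJc hJ0 hab hP
  filter_upwards [hL.ae_differentiableWithinAt_of_mem_real, hZ.ae_differentiableWithinAt_of_mem_real,
    ae_deriv_eq_zero_of_mem_null (τ := fun s => (c s).1) (ae_iff.1 hN)] with s hd1 hd2 hd3 hs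
  have hSn := hS.mem_nhds hs
  have hchd : DifferentiableAt ℝ ch s := (hd1 hs).differentiableAt hSn
  have hZd := (hd2 hs).differentiableAt hSn
  have hτd : DifferentiableAt ℝ (fun s' => (c s').1) s := hchd.fst
  have hinv : ∀ s' ∈ S, ψ.symm (ch s').2 = (c s').2 := fun s' hs' => ψ.left_inv (hc s' hs').2.1
  have hsrc : ∀ s' ∈ S, flowAt α Φ (c s').1 (c s').2 ∈ (extChartAt (cotModel n) ℓ₀).source := by
    intro s' hs'
    have := h.source _ (Ioo_subset_Icc_self (hc s' hs').1) _ (hc s' hs').2.2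
    rwa [ψ.left_inv (hc s' hs').2.1] at this
  have hf : MDifferentiableAt 𝓘(ℝ, ℝ) (cotModel n)
      (fun s' => flowAt α Φ (c s').1 (c s').2) s := by
    refine mdifferentiableAt_curve_of_chart (ℓ₀ := ℓ₀) ?_ (hZd.congr_of_eventuallyEq ?_)
    · filter_upwards [hSn] with s' hs' using hsrc s' hs'
    · filter_upwards [hSn] with s' hs'
      simp only [Function.comp]
      rw [hinv s' hs']
  have hF : MDifferentiableAt 𝓘(ℝ, ℝ) (𝓘(ℝ, ℝ).prod (cotModel n)) (flowGraph α Φ ∘ c) s :=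
    hτd.mdifferentiableAt.prodMk hf
  have hpot := hasDerivAt_of_hasMFDerivAt
    (hasMFDerivAt_cartanPotential_comp H (ℓ₀ := ℓ₀) (hsrc s hs) hF)
  have h0 : HasDerivAt (fun s' => thetaGraph α H Φ ((ch s').1, ψ.symm (ch s').2) -
      (liouvillePotential ℓ₀ (flowAt α Φ (ch s).1 (ψ.symm (ch s).2))
        (flowAt α Φ (ch s').1 (ψ.symm (ch s').2)) -
      H (ch s).1 (flowAt α Φ (ch s).1 (ψ.symm (ch s).2)) * (ch s').1)) 0 s := by
    by_cases hM : (c s).1 ∈ Ioo a b → ∀ u ∈ Metric.ball (ψ q₀) r,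
      HasFDerivAt (fun x : ℝ × Model n => thetaGraph α H Φ (x.1, ψ.symm x.2) -
        (liouvillePotential ℓ₀ (flowAt α Φ (c s).1 (ψ.symm u))
          (flowAt α Φ x.1 (ψ.symm x.2)) -
        H (c s).1 (flowAt α Φ (c s).1 (ψ.symm u)) * x.1))
        (0 : ℝ × Model n →L[ℝ] ℝ) ((c s).1, u)
    · have h1 := hM (hc s hs).1 _ (hc s hs).2.2
      exact HasFDerivAt.comp_hasDerivAt (f := ch) s h1 hchd.hasDerivAt
    · have hτ : HasDerivAt (fun s' => (ch s').1) 0 s := by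
        have := hτd.hasDerivAt
        rwa [hd3 hM hτd] at this
      have h1 := h.hasDerivAt_action_of_deriv_time_eq_zero hH hJc hJ0 hP (c := ch) (C := C) (by
        filter_upwards [hSn] with s' hs'
        refine ⟨⟨Ioo_subset_Icc_self (hc s' hs').1, (hc s' hs').2.2⟩, ?_⟩
        rw [← Real.dist_eq, dist_comm (ch s)]
        exact hL.dist_le_mul s' hs' s hs) hτ
      have h2 := h1.add (hτ.const_mul (H (ch s).1 (flowAt α Φ (ch s).1 (ψ.symm (ch s).2))))
      rw [mul_zero, add_zero] at h2
      refine h2.congr_of_eventuallyEq (Eventually.of_forall fun s' => ?_)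
      simp only [Pi.add_apply]
      ring
  have h1 := h0.add hpot
  rw [zero_add] at h1
  refine h1.congr_of_eventuallyEq ?_
  filter_upwards [hSn] with s' hs'
  simp only [Pi.add_apply]
  rw [hinv s' hs', hinv s hs]
  exact (sub_add_cancel _ _).symm

end FlowBox

omit [IsManifold (𝓡 n) ∞ M] in
theorem exists_curve_chart {c : ℝ → ℝ × M} {S : Set ℝ}
    (hcL : LipschitzOnManifold 𝓘(ℝ, ℝ) (𝓘(ℝ, ℝ).prod (𝓡 n)) c S) {s₁ : ℝ} (hs₁ : s₁ ∈ S)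
    {a b r : ℝ} (hr : 0 < r) (ha : a < (c s₁).1) (hb : (c s₁).1 < b) :
    ∃ ε > 0, ∃ C : ℝ≥0, LipschitzOnWith C
        (fun s => ((c s).1, extChartAt (𝓡 n) (c s₁).2 (c s).2)) (Metric.ball s₁ ε ∩ S) ∧
      ∀ s ∈ Metric.ball s₁ ε ∩ S, (c s).1 ∈ Ioo a b ∧
        (c s).2 ∈ (extChartAt (𝓡 n) (c s₁).2).source ∧
        extChartAt (𝓡 n) (c s₁).2 (c s).2 ∈
          Metric.ball (extChartAt (𝓡 n) (c s₁).2 (c s₁).2) r := by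
  obtain ⟨C, V, hV, -, hVm, hVL⟩ := hcL s₁ hs₁
  have hL : LipschitzOnWith C (fun s => ((c s).1, extChartAt (𝓡 n) (c s₁).2 (c s).2)) V := by
    refine LipschitzOnWith.of_dist_le_mul fun y hy z hz => ?_
    have h1 := hVL y hy z hz
    rw [extChartAt_model_space_eq_id] at h1
    have e := extChartAt_prod_apply (n := n) (c s₁).1 (c s₁).2
    rw [← e, ← e]
    exact h1
  have hs₁V : s₁ ∈ V := mem_of_mem_nhdsWithin hs₁ hV
  have hW : Ioo a b ×ˢ Metric.ball (extChartAt (𝓡 n) (c s₁).2 (c s₁).2) r ∈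
      𝓝 ((c s₁).1, extChartAt (𝓡 n) (c s₁).2 (c s₁).2) :=
    (isOpen_Ioo.prod Metric.isOpen_ball).mem_nhds ⟨⟨ha, hb⟩, Metric.mem_ball_self hr⟩
  have h2 := nhdsWithin_le_of_mem hV ((hL.continuousOn s₁ hs₁V).preimage_mem_nhdsWithin hW)
  obtain ⟨ε, hε, hsub⟩ := Metric.mem_nhdsWithin_iff.1 (inter_mem hV h2)
  refine ⟨ε, hε, C, hL.mono fun s hs => (hsub hs).1, fun s hs => ?_⟩
  exact ⟨(hsub hs).2.1, mem_extChartAt_prod_source.1 (hVm (hsub hs).1), (hsub hs).2.2⟩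

/-! ### From flow boxes to the global statements. -/

section Global

variable (hH : HamiltonianFlowAssumption J α U O H Φ) (hU : IsOpen U)
  (hα : ContMDiffOn (𝓡 n) 𝓘(ℝ, ℝ) ∞ α U) (hJ : IsOpen J) (hJc : J.OrdConnected)
  (hJ0 : (0 : ℝ) ∈ J)

include hH hU hα hJ hJc hJ0

theorem lipschitzOnManifold_thetaGraph :
    LipschitzOnManifold (𝓘(ℝ, ℝ).prod (𝓡 n)) 𝓘(ℝ, ℝ) (thetaGraph α H Φ) (J ×ˢ U) := by
  rintro ⟨t₁, q₀⟩ ⟨ht₁, hq₀⟩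
  obtain ⟨a, b, r, K, ha, hb, hbox⟩ := hH.exists_flowBox hU hα hJ hJc hJ0 ht₁ hq₀
  obtain ⟨C, V, hV, hVs, hVL⟩ := hbox.lipschitz_theta ⟨ha, hb⟩
  refine ⟨C, V, mem_nhdsWithin_of_mem_nhds hV, hVs, fun y _ => ?_, ?_⟩
  · rw [extChartAt_model_space_eq_id]
    trivial
  · rw [extChartAt_model_space_eq_id]
    exact hVL

theorem almostEverywhereOn_pullback_liouvilleForm {t : ℝ} (ht : t ∈ J) :
    AlmostEverywhereOn (𝓡 n) U fun q =>
      MDifferentiableAt (𝓡 n) (cotModel n) (flowAt α Φ t) q ∧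
      MDifferentiableAt (𝓡 n) 𝓘(ℝ, ℝ) (fun q' => thetaGraph α H Φ (t, q')) q ∧
      pullbackForm (𝓡 n) (cotModel n) (flowAt α Φ t) liouvilleForm q =
        mfderiv (𝓡 n) 𝓘(ℝ, ℝ) (fun q' => thetaGraph α H Φ (t, q')) q := by
  refine almostEverywhereOn_of_local fun q₀ hq₀ => ?_
  obtain ⟨a, b, r, K, ha, hb, hbox, hP⟩ :=
    hH.exists_flowBox_primitive hU hα hJ hJc hJ0 ht hq₀
  exact ⟨_, Metric.ball_mem_nhds _ hbox.radius_pos, hbox.ae_action hP ⟨ha.le, hb.le⟩⟩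

theorem almostEverywhereOn_pullback_cartanForm :
    AlmostEverywhereOn (𝓘(ℝ, ℝ).prod (𝓡 n)) (J ×ˢ U) fun z =>
      MDifferentiableAt (𝓘(ℝ, ℝ).prod (𝓡 n)) (𝓘(ℝ, ℝ).prod (cotModel n)) (flowGraph α Φ) z ∧
      MDifferentiableAt (𝓘(ℝ, ℝ).prod (𝓡 n)) 𝓘(ℝ, ℝ) (thetaGraph α H Φ) z ∧
      pullbackForm (𝓘(ℝ, ℝ).prod (𝓡 n)) (𝓘(ℝ, ℝ).prod (cotModel n))
        (flowGraph α Φ) (cartanForm H) z =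
        mfderiv (𝓘(ℝ, ℝ).prod (𝓡 n)) 𝓘(ℝ, ℝ) (thetaGraph α H Φ) z := by
  have := isAddHaarMeasure_volume_prod n
  refine almostEverywhereOn_of_local ?_
  rintro ⟨t₁, q₀⟩ ⟨ht₁, hq₀⟩
  obtain ⟨a, b, r, K, ha, hb, hbox, hP⟩ :=
    hH.exists_flowBox_primitive hU hα hJ hJc hJ0 ht₁ hq₀
  refine ⟨Ioo a b ×ˢ Metric.ball (extChartAt (𝓡 n) q₀ q₀) r, ?_, ?_⟩
  · rw [extChartAt_prod_apply]
    exact (isOpen_Ioo.prod Metric.isOpen_ball).mem_nhds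
      ⟨⟨ha, hb⟩, Metric.mem_ball_self hbox.radius_pos⟩
  · filter_upwards [hbox.ae_cartan hH hJc hJ0 (ha.trans hb).le hP] with y hy hyW
    rw [extChartAt_prod_symm_apply]
    exact hy hyW

/-- Along the curve `θ` is Lipschitz, hence absolutely continuous, so the derivative identified
almost everywhere is integrable and integrates to the increment. -/
theorem integral_pullback_cartanForm {c : ℝ → ℝ × M} (hc : MapsTo c (Icc 0 1) (J ×ˢ U))
    (hcL : LipschitzOnManifold 𝓘(ℝ, ℝ) (𝓘(ℝ, ℝ).prod (𝓡 n)) c (Icc 0 1)) :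
    IntervalIntegrable (fun s : ℝ => pullbackForm 𝓘(ℝ, ℝ) (𝓘(ℝ, ℝ).prod (cotModel n))
        (flowGraph α Φ ∘ c) (cartanForm H) s (1 : ℝ)) volume 0 1 ∧
      ∫ s in (0 : ℝ)..1, pullbackForm 𝓘(ℝ, ℝ) (𝓘(ℝ, ℝ).prod (cotModel n))
        (flowGraph α Φ ∘ c) (cartanForm H) s (1 : ℝ) =
      thetaGraph α H Φ (c 1) - thetaGraph α H Φ (c 0) := by
  have hder : ∀ᵐ s, s ∈ Ioo (0 : ℝ) 1 → HasDerivAt (fun s' => thetaGraph α H Φ (c s'))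
      (pullbackForm 𝓘(ℝ, ℝ) (𝓘(ℝ, ℝ).prod (cotModel n)) (flowGraph α Φ ∘ c) (cartanForm H) s
        (1 : ℝ)) s := by
    rw [ae_iff]
    refine measure_null_of_locally_null _ fun s₁ hs₁ => ?_
    simp only [mem_ofPred_eq, Classical.not_imp] at hs₁
    have hs₁I := Ioo_subset_Icc_self hs₁.1
    obtain ⟨a, b, r, K, ha, hb, hbox, hP⟩ :=
      hH.exists_flowBox_primitive hU hα hJ hJc hJ0 (hc hs₁I).1 (hc hs₁I).2
    obtain ⟨ε, hε, C, hL, hmem⟩ := exists_curve_chart hcL hs₁I hbox.radius_pos ha hb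
    have hsub : Metric.ball s₁ ε ∩ Ioo 0 1 ⊆ Metric.ball s₁ ε ∩ Icc 0 1 :=
      inter_subset_inter_right _ Ioo_subset_Icc_self
    have hae := hbox.ae_hasDerivAt_curve hH hJc hJ0 (ha.trans hb).le hP
      (Metric.isOpen_ball.inter isOpen_Ioo) (hL.mono hsub) fun s hs => hmem s (hsub hs)
    refine ⟨_, inter_mem_nhdsWithin _ (Metric.ball_mem_nhds s₁ hε),
      measure_mono_null ?_ (ae_iff.1 hae)⟩
    rintro s ⟨hs1, hs2⟩
    simp only [mem_ofPred_eq, Classical.not_imp] at hs1 ⊢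
    exact ⟨⟨hs2, hs1.1⟩, hs1.2⟩
  have hloc : LocallyLipschitzOn (Icc 0 1) (fun s => thetaGraph α H Φ (c s)) := by
    intro s₁ hs₁
    obtain ⟨a, b, r, K, ha, hb, hbox⟩ :=
      hH.exists_flowBox hU hα hJ hJc hJ0 (hc hs₁).1 (hc hs₁).2
    obtain ⟨ε, hε, C, hL, hmem⟩ := exists_curve_chart hcL hs₁ hbox.radius_pos ha hb
    obtain ⟨D, hD⟩ := hbox.lip
    refine ⟨D * C, Metric.ball s₁ ε ∩ Icc 0 1, inter_mem (mem_nhdsWithin_of_mem_nhds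
      (Metric.ball_mem_nhds s₁ hε)) self_mem_nhdsWithin, ?_⟩
    have h1 := hD.comp hL fun s hs => ⟨Ioo_subset_Icc_self (hmem s hs).1, (hmem s hs).2.2⟩
    have h2 : EqOn (fun s => thetaGraph α H Φ (c s))
        ((fun x : ℝ × Model n => thetaGraph α H Φ (x.1, (extChartAt (𝓡 n) (c s₁).2).symm x.2)) ∘
          fun s => ((c s).1, extChartAt (𝓡 n) (c s₁).2 (c s).2))
        (Metric.ball s₁ ε ∩ Icc 0 1) := by
      intro s hs
      simp only [Function.comp]
      rw [(extChartAt (𝓡 n) (c s₁).2).left_inv (hmem s hs).2.1]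
    intro s hs s' hs'
    rw [h2 hs, h2 hs']
    exact h1 hs hs'
  obtain ⟨D, hD⟩ := hloc.exists_lipschitzOnWith_of_compact isCompact_Icc
  have hac : AbsolutelyContinuousOnInterval (fun s => thetaGraph α H Φ (c s)) 0 1 := by
    refine LipschitzOnWith.absolutelyContinuousOnInterval (K := D) ?_
    rwa [uIcc_of_le zero_le_one]
  have heq : ∀ᵐ s, s ∈ uIoc (0 : ℝ) 1 → deriv (fun s' => thetaGraph α H Φ (c s')) s =
      pullbackForm 𝓘(ℝ, ℝ) (𝓘(ℝ, ℝ).prod (cotModel n)) (flowGraph α Φ ∘ c) (cartanForm H) s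
        (1 : ℝ) := by
    filter_upwards [hder, compl_mem_ae_iff.2 (measure_singleton (1 : ℝ))] with s hs hs1 hsI
    rw [uIoc_of_le zero_le_one] at hsI
    exact (hs ⟨hsI.1, lt_of_le_of_ne hsI.2 hs1⟩).deriv
  refine ⟨hac.intervalIntegrable_deriv.congr_ae
    ((ae_restrict_iff' measurableSet_uIoc).2 heq), ?_⟩
  rw [← hac.integral_deriv_eq_sub]
  exact (intervalIntegral.integral_congr_ae heq).symm

end Global

end CartanForm

theorem lemma3p2 {n : ℕ} {M : Type*} [TopologicalSpace M] [ChartedSpace (CartanForm.Model n) M]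
    [IsManifold (𝓡 n) ∞ M] [T2Space M] [ParacompactSpace M] [ConnectedSpace M]
    (α : M → ℝ) (U : Set M) (hU : IsOpen U) (hUc : ContractibleSpace U)
    (hα : ContMDiffOn (𝓡 n) 𝓘(ℝ, ℝ) ∞ α U)
    (J : Set ℝ) (hJ : IsOpen J) (hJc : J.OrdConnected) (hJ0 : (0 : ℝ) ∈ J)
    (O : Set (CartanForm.CotangentBundle n M)) (hO : IsOpen O)
    (hOΛ : CartanForm.graphOfDifferential α U ⊆ O)
    (H : ℝ → CartanForm.CotangentBundle n M → ℝ)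
    (Φ : ℝ → CartanForm.CotangentBundle n M → CartanForm.CotangentBundle n M)
    (hH : CartanForm.HamiltonianFlowAssumption J α U O H Φ) :
    -- `θ` is a locally Lipschitz function on `J × Λ`
    CartanForm.LipschitzOnManifold (𝓘(ℝ, ℝ).prod (𝓡 n)) 𝓘(ℝ, ℝ)
      (CartanForm.thetaGraph α H Φ) (J ×ˢ U) ∧
    -- for each `t ∈ J`, the form `𝓗_t^* s` equals `d θ_t` almost everywhere on `Λ`
    (∀ t ∈ J, CartanForm.AlmostEverywhereOn (𝓡 n) U fun q =>
      MDifferentiableAt (𝓡 n) (CartanForm.cotModel n) (CartanForm.flowAt α Φ t) q ∧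
      MDifferentiableAt (𝓡 n) 𝓘(ℝ, ℝ) (fun q' => CartanForm.thetaGraph α H Φ (t, q')) q ∧
      CartanForm.pullbackForm (𝓡 n) (CartanForm.cotModel n) (CartanForm.flowAt α Φ t)
        CartanForm.liouvilleForm q =
        mfderiv (𝓡 n) 𝓘(ℝ, ℝ) (fun q' => CartanForm.thetaGraph α H Φ (t, q')) q) ∧
    -- the form `𝓗^* (s - H dt)` equals `d θ` almost everywhere on `J × Λ`
    (CartanForm.AlmostEverywhereOn (𝓘(ℝ, ℝ).prod (𝓡 n)) (J ×ˢ U) fun z =>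
      MDifferentiableAt (𝓘(ℝ, ℝ).prod (𝓡 n)) (𝓘(ℝ, ℝ).prod (CartanForm.cotModel n))
        (CartanForm.flowGraph α Φ) z ∧
      MDifferentiableAt (𝓘(ℝ, ℝ).prod (𝓡 n)) 𝓘(ℝ, ℝ) (CartanForm.thetaGraph α H Φ) z ∧
      CartanForm.pullbackForm (𝓘(ℝ, ℝ).prod (𝓡 n)) (𝓘(ℝ, ℝ).prod (CartanForm.cotModel n))
        (CartanForm.flowGraph α Φ) (CartanForm.cartanForm H) z =
        mfderiv (𝓘(ℝ, ℝ).prod (𝓡 n)) 𝓘(ℝ, ℝ) (CartanForm.thetaGraph α H Φ) z) ∧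
    -- exactness along curves: the integral of `𝓗^* (s - H dt)` along any Lipschitz curve in
    -- `J × Λ` is the increment of `θ`
    (∀ c : ℝ → ℝ × M, MapsTo c (Icc 0 1) (J ×ˢ U) →
      CartanForm.LipschitzOnManifold 𝓘(ℝ, ℝ) (𝓘(ℝ, ℝ).prod (𝓡 n)) c (Icc 0 1) →
      IntervalIntegrable (fun s : ℝ => CartanForm.pullbackForm 𝓘(ℝ, ℝ)
        (𝓘(ℝ, ℝ).prod (CartanForm.cotModel n)) (CartanForm.flowGraph α Φ ∘ c)
        (CartanForm.cartanForm H) s (1 : ℝ)) volume 0 1 ∧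
      ∫ s in (0 : ℝ)..1, CartanForm.pullbackForm 𝓘(ℝ, ℝ)
        (𝓘(ℝ, ℝ).prod (CartanForm.cotModel n)) (CartanForm.flowGraph α Φ ∘ c)
        (CartanForm.cartanForm H) s (1 : ℝ) =
      CartanForm.thetaGraph α H Φ (c 1) - CartanForm.thetaGraph α H Φ (c 0)) := by
  exact ⟨CartanForm.lipschitzOnManifold_thetaGraph hH hU hα hJ hJc hJ0,
    fun _ ht => CartanForm.almostEverywhereOn_pullback_liouvilleForm hH hU hα hJ hJc hJ0 ht,
    CartanForm.almostEverywhereOn_pullback_cartanForm hH hU hα hJ hJc hJ0,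
    fun _ hc hcL => CartanForm.integral_pullback_cartanForm hH hU hα hJ hJc hJ0 hc hcL⟩
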